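/- **Setting.** Let $\mathcal X$ be a measurable context space, $\mathcal A$ a finite set of $K$ arms, and $D$ a probability distribution of $(x,r)\in\mathcal X\times[0,1]^{\mathcal A}$ with context marginal $D_{\mathcal X}$. Let $f^*(x,a)=\mathbb E[r(a)\mid x]$ and let $\pi^*(x)$ maximize $f^*(x,\cdot)$. For a probability kernel $p$ from $\mathcal X$ to $\mathcal A$, let $D(p)$ be the law of $(x,a,r(a))$ for $(x,r)\sim D$, $a\sim p(\cdot|x)$. Let $\mathcal F_1,\dots,\mathcal F_M$ be classes of models $f:\mathcal X\times\mathcal A\to[0,1]$ with finite VC subgraph dimensions $1\le d_1\le\dots\le d_M$ (the largest number of points of $\mathcal X\times\mathcal A\times\mathbb R$ shattered by the subgraphs $\{(x,a,y):y<f(x,a)\}$, $f\in\mathcal F_i$). Put $b_i(p)=\inf_{f\in\mathcal F_i}\mathbb E_{x\sim D_{\mathcal X}}\mathbb E_{a\sim p(\cdot|x)}[(f(x,a)-f^*(x,a))^2]$, $B_i=\sup_p b_i(p)$, and, for a known $C_1>0$, $\xi_i(n,\zeta)=C_1d_i\ln(n)\ln(1/\zeta)/n$. **Estimation oracle.** For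 a constant $C_0\ge1$ and every $i\in[M]$, $\mathrm{EstOracle}_i$ maps data sets to models so that for every probability kernel $p$, every $n\ge2$ and every $\zeta\in(0,1)$, with probability at least $1-\zeta$ its output $\hat f$ on $n$ i.i.d. samples from $D(p)$ satisfies $$\mathbb E_{x\sim D_{\mathcal X}}\mathbb E_{a\sim p(\cdot|x)}[(\hat f(x,a)-f^*(x,a))^2]\le\min_{j\in[i]}\big(C_0b_j(p)+\xi_j(n,\zeta/i)\big).$$ **Algorithm ($\text{Mod-IGW}$).** Inputs: $\tau_1\ge2$ and $\delta\in(0,1)$. Put $\tau_0=0$ and $\tau_{m+1}=2\tau_m$ for $m\ge1$; epoch $m$ consists of the rounds $\tau_{m-1}+1,\dots,\tau_m$. Start with $\hat f_1\equiv0$, $\mathcal I_1=[M]$, $\gamma_1=1$. In each round $t$ of epoch $m$, $(x_t,r_t)\sim D$ is drawn independently of the past, the learner observes $x_t$, draws $a_t\sim p_m(\cdot|x_t)$ and observes $r_t(a_t)$, where, with $\hat a$ a maximizer of $\hat f_m(x,\cdot)$, $$p_m(a|x)=\frac1{K+\gamma_m(\hat f_m(x,\hat a)-\hat f_m(x,a))}\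 (a\ne\hat a),\qquad p_m(\hat a|x)=1-\sum_{a'\ne\hat a}p_m(a'|x).$$ With $S_m$ the data of epoch $m$, put $\hat f_{m+1}=\mathrm{EstOracle}_M(S_m)$, $\mathcal I_{m+1}=\{i\in\mathcal I_m:\mathrm{MTOracle}(i,S_m,\delta/(4Mm^2))=\textbf{False}\}$, and $\gamma_{m+1}=\gamma_{m+1,i_{m+1}}$, where $i_{m+1}=\min\mathcal I_{m+1}$ (and $M$ if $\mathcal I_{m+1}=\emptyset$) and $$\gamma_{m+1,i}=\sqrt{\frac{K}{8\,\xi_i(\tau_m-\tau_{m-1},\delta/(4Mm^2))}}.$$ Let $m^*_i\in\{0,1,2,\dots\}\cup\{\infty\}$ be the supremum of the epochs $m\ge1$ with $\xi_i(\tau_m-\tau_{m-1},\delta/(4Mm^2))\ge C_0\min_{i'\le i}B_{i'}$ ($0$ if there are none), with $\tau_\infty=\infty$. **Misspecification test.** There are $\beta'_i\in(0,1]$ and $\beta_i\in[0,\infty]$, $i\in[M]$, with $\beta_i$ non-decreasing in $i$ and with $\beta_i>\beta'_i\tau_{m^*_i}$ or $\beta_i=\infty$, and $\beta_0=0$, such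 that for all $i\in[M]$, epochs $m\ge 1$ and $\zeta\in(0,1)$: if $\tau_m\le\beta'_i\tau_{m^*_i}$ then $\Pr[\mathrm{MTOracle}(i,S_m,\zeta)=\textbf{False}]\ge1-\zeta$, and if $\tau_m>\beta_i$ then $\Pr[\mathrm{MTOracle}(i,S_m,\zeta)=\textbf{True}]\ge1-\zeta$. **Statement.** Let $R_t=\sum_{s=1}^t\big[f^*(x_s,\pi^*(x_s))-f^*(x_s,a_s)\big]$. There is a constant $c$ that depends only on $C_1$ and $\tau_1$ such that, in this setting and under these two requirements on the oracles, with probability at least $1-\delta$, for all $i\in[M]$ and all rounds $t\ge3$ with $t\le\beta'_i\tau_{m^*_i}$, $$R_t\le c\left(\beta_{i-1}\ln\frac{d_i}{d_1}+\sqrt{K\,d_i\,t\,\ln(t)\,\ln\Big(\frac{M\ln t}{\delta}\Big)}\right),$$ where $\infty\cdot0=0$. -/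

import Mathlib

open MeasureTheory ProbabilityTheory
open scoped ENNReal

noncomputable section

namespace ModelSelection

/-- A model: a map from contexts and arms to `[0,1]`. -/
abbrev Model (X A : Type*) := X → A → unitInterval

/-- One observation `(x, a, r(a))` of the learner. -/
abbrev Obs (X A : Type*) := X × A × unitInterval

section VC

variable {X A : Type*}

/-- The subgraphs `{((x,a),y) | y < f(x,a)}`, `f ∈ F`, shatter the finite set `P`. -/
def SubgraphShatters (F : Set (Model X A)) (P : Finset ((X × A) × ℝ)) : Prop :=
  ∀ Q ⊆ P, ∃ f ∈ F, ∀ z ∈ P, (z.2 < (f z.1.1 z.1.2 : ℝ) ↔ z ∈ Q)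

/-- The VC subgraph dimension of a model class: the largest size of a finite set of points that is
shattered by the subgraphs of its members. -/
def vcSubgraphDim (F : Set (Model X A)) : ℕ∞ :=
  ⨆ (P : Finset ((X × A) × ℝ)) (_ : SubgraphShatters F P), (P.card : ℕ∞)

end VC

section Environment

variable {X A : Type*} [MeasurableSpace X] [MeasurableSpace A]

/-- `fstar(x,a) = E[r(a) | x]` (a measurable version of it), where `(x,r) ∼ D`. -/
def IsMeanReward (D : Measure (X × (A → unitInterval))) (fstar : Model X A) : Prop :=
  ∀ a, Measurable (fun x => fstar x a) ∧
    D[fun z => (z.2 a : ℝ) | MeasurableSpace.comap Prod.fst inferInstance]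
      =ᵐ[D] fun z => (fstar z.1 a : ℝ)

/-- `πstar(x)` maximizes `fstar(x,·)`. -/
def IsOptimalPolicy (fstar : Model X A) (πstar : X → A) : Prop :=
  ∀ x a, fstar x a ≤ fstar x (πstar x)

/-- The law `D(p)` of `(x, a, r(a))` when `(x,r) ∼ D` and then `a ∼ p(·|x)`. -/
def sampleLaw (D : Measure (X × (A → unitInterval))) (p : Kernel X A) : Measure (Obs X A) :=
  (D ⊗ₘ p.comap Prod.fst measurable_fst).map fun z => (z.1.1, z.2, z.1.2 z.2)

/-- `E_{x ∼ D_X} E_{a ∼ p(·|x)} (f(x,a) - fstar(x,a))²`. -/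
def sqRisk (D : Measure (X × (A → unitInterval))) (fstar : Model X A) (p : Kernel X A)
    (f : Model X A) : ℝ :=
  ∫ x, ∫ a, ((f x a : ℝ) - fstar x a) ^ 2 ∂(p x) ∂D.fst

/-- The average squared misspecification error `b(p)` of a class `F` under the kernel `p`. -/
def misspec (D : Measure (X × (A → unitInterval))) (fstar : Model X A) (F : Set (Model X A))
    (p : Kernel X A) : ℝ :=
  ⨅ f : F, sqRisk D fstar p f

/-- The average squared misspecification error `B` of a class `F`: the worst case of `b(p)` over
all probability kernels `p`. -/
def maxMisspec (D : Measure (X × (A → unitInterval))) (fstar : Model X A)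
    (F : Set (Model X A)) : ℝ :=
  ⨆ p : {p : Kernel X A // IsMarkovKernel p}, misspec D fstar F p

end Environment

/-- The estimation rate `C₁ d ln(n) ln(1/ζ) / n`. -/
def rate (C₁ : ℝ) (d n : ℕ) (ζ : ℝ) : ℝ :=
  C₁ * d * Real.log n * Real.log (1 / ζ) / n

/-- The last round `τ_m` of epoch `m`: `τ_0 = 0`, and `τ_{m+1} = 2 τ_m` for `m ≥ 1`. -/
def epochEnd (τ₁ : ℕ) : ℕ → ℕ
  | 0 => 0
  | m + 1 => 2 ^ m * τ₁

/-- The number `τ_m - τ_{m-1}` of rounds of epoch `m`. -/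
def epochLen (τ₁ m : ℕ) : ℕ := epochEnd τ₁ m - epochEnd τ₁ (m - 1)

/-- The epoch `m(t)` that contains round `t`. -/
def epochOf (τ₁ t : ℕ) : ℕ := sInf {m | t ≤ epochEnd τ₁ m}

/-- The inputs and subroutines of the algorithm, for `M` classes with indices `1, …, M`. -/
structure ModIGW (X A : Type*) where
  /-- number of model classes -/
  M : ℕ
  /-- initial epoch length -/
  τ₁ : ℕ
  /-- confidence parameter -/
  δ : ℝ
  /-- constant of the estimation rates -/
  C₁ : ℝ
  /-- complexity of each class -/
  d : ℕ → ℕ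
  /-- estimation oracle `i`, on a data set of size `n` -/
  est : (i n : ℕ) → (Fin n → Obs X A) → Model X A
  /-- misspecification test of class `i`, on a data set of size `n`, at a confidence level -/
  mt : (i n : ℕ) → (Fin n → Obs X A) → ℝ → Bool
  /-- the arm chosen among those of largest predicted reward -/
  best : (A → unitInterval) → A

namespace ModIGW

variable {X A : Type*} (alg : ModIGW X A)

/-- The estimation rate `ξ_i(n, ζ)` of class `i`. -/
def xi (i n : ℕ) (ζ : ℝ) : ℝ := rate alg.C₁ (alg.d i) n ζ

/-- The confidence level `δ / (4 M m²)` used after epoch `m`. -/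
def level (m : ℕ) : ℝ := alg.δ / (4 * alg.M * (m : ℝ) ^ 2)

/-- The data `S_m` of epoch `m`, where `h t` is the observation of round `t = 1, 2, …`. -/
def data (h : ℕ → Obs X A) (m : ℕ) : Fin (epochLen alg.τ₁ m) → Obs X A :=
  fun k => h (epochEnd alg.τ₁ (m - 1) + 1 + k)

/-- The estimate `f̂_m` used in epoch `m`. -/
def fhat (h : ℕ → Obs X A) : ℕ → Model X A
  | 0 => fun _ _ => 0
  | 1 => fun _ _ => 0
  | m + 2 => alg.est alg.M _ (alg.data h (m + 1))

/-- The index set `I_m` of epoch `m`. -/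
def indexSet (h : ℕ → Obs X A) : ℕ → Finset ℕ
  | 0 => Finset.Icc 1 alg.M
  | 1 => Finset.Icc 1 alg.M
  | m + 2 => (indexSet h (m + 1)).filter fun i =>
      alg.mt i _ (alg.data h (m + 1)) (alg.level (m + 1)) = false

/-- The smallest index `i_m` in `I_m` (and `M` if `I_m` is empty). -/
def index (h : ℕ → Obs X A) (m : ℕ) : ℕ :=
  if hne : (alg.indexSet h m).Nonempty then (alg.indexSet h m).min' hne else alg.M

variable [Fintype A]

/-- The exploration parameter `γ_{m+1,i}` of class `i` in epoch `m+1`. -/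
def gammaClass (m i : ℕ) : ℝ :=
  √(Fintype.card A / (8 * alg.xi i (epochLen alg.τ₁ m) (alg.level m)))

/-- The exploration parameter `γ_m` of epoch `m`. -/
def gamma (h : ℕ → Obs X A) : ℕ → ℝ
  | 0 => 1
  | 1 => 1
  | m + 2 => alg.gammaClass (m + 1) (alg.index h (m + 2))

open Classical in
/-- Inverse gap weighting: the probability of arm `a` when the predicted rewards are `v`, the arm
predicted to be best is `b`, and the exploration parameter is `γ`. -/
def igw (γ : ℝ) (v : A → unitInterval) (b a : A) : ℝ :=
  if a = b then
    1 - ∑ a' ∈ Finset.univ.erase b, 1 / (Fintype.card A + γ * ((v b : ℝ) - v a'))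
  else 1 / (Fintype.card A + γ * ((v b : ℝ) - v a))

/-- The action selection probabilities `p_m(a|x)` of epoch `m`. -/
def actionProb (h : ℕ → Obs X A) (m : ℕ) (x : X) (a : A) : ℝ :=
  igw (alg.gamma h m) (alg.fhat h m x) (alg.best (alg.fhat h m x)) a

end ModIGW

section Oracle

variable {X A : Type*} [MeasurableSpace X] [MeasurableSpace A]

/-- The oracles are measurable, and `best` is a measurable selection of a maximizer. -/
structure ModIGW.Regular (alg : ModIGW X A) : Prop where
  est_meas : ∀ i n, Measurable fun q : (Fin n → Obs X A) × X × A => alg.est i n q.1 q.2.1 q.2.2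
  mt_meas : ∀ i n ζ, Measurable fun s : Fin n → Obs X A => alg.mt i n s ζ
  best_meas : Measurable alg.best
  best_max : ∀ (v : A → unitInterval) (b : A), v b ≤ v (alg.best v)

/-- The requirement on the estimation oracles: for every `i ∈ [M]`, every probability kernel `p`,
every `n ≥ 2` and every `ζ ∈ (0,1)`, with probability at least `1-ζ` over `n` independent samples
from `D(p)`, the risk of the output of oracle `i` is at most
`min_{j ∈ [i]} (C₀ b_j(p) + ξ_j(n, ζ/i))`. -/
def EstimationOracle (D : Measure (X × (A → unitInterval))) (fstar : Model X A)
    (F : ℕ → Set (Model X A)) (alg : ModIGW X A) (C₀ : ℝ) : Prop :=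
  ∀ i ∈ Finset.Icc 1 alg.M, ∀ p : Kernel X A, IsMarkovKernel p →
    ∀ n : ℕ, 2 ≤ n → ∀ ζ ∈ Set.Ioo (0 : ℝ) 1,
      ENNReal.ofReal (1 - ζ) ≤ (Measure.pi fun _ : Fin n => sampleLaw D p)
        {s | ∀ j ∈ Finset.Icc 1 i,
          sqRisk D fstar p (alg.est i n s) ≤ C₀ * misspec D fstar (F j) p + alg.xi j n (ζ / i)}

/-- The safe epoch `m*_i`: the largest epoch `m ≥ 1` with
`ξ_i(τ_m - τ_{m-1}, δ/(4Mm²)) ≥ C₀ min_{i' ≤ i} B_{i'}`. It is infinite if these `m` are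
unbounded, and `0` if there are none. -/
def safeEpoch (D : Measure (X × (A → unitInterval))) (fstar : Model X A)
    (F : ℕ → Set (Model X A)) (alg : ModIGW X A) (C₀ : ℝ) (i : ℕ) : ℕ∞ :=
  ⨆ (m : ℕ) (_ : 1 ≤ m ∧ ∃ i' ∈ Finset.Icc 1 i,
    C₀ * maxMisspec D fstar (F i') ≤ alg.xi i (epochLen alg.τ₁ m) (alg.level m)), (m : ℕ∞)

/-- The number `τ_{m*_i}` of rounds up to the end of the safe epoch, possibly infinite. -/
def safeRounds (D : Measure (X × (A → unitInterval))) (fstar : Model X A)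
    (F : ℕ → Set (Model X A)) (alg : ModIGW X A) (C₀ : ℝ) (i : ℕ) : ℝ≥0∞ :=
  if safeEpoch D fstar F alg C₀ i = ⊤ then ⊤
  else (epochEnd alg.τ₁ (safeEpoch D fstar F alg C₀ i).toNat : ℝ≥0∞)

end Oracle

section Run

variable {X A Ω : Type*} [MeasurableSpace X] [MeasurableSpace A] [MeasurableSpace Ω]

/-- The observations `(x_t, a_t, r_t(a_t))` of a run. -/
def obs (x : ℕ → Ω → X) (r : ℕ → Ω → A → unitInterval) (a : ℕ → Ω → A) (ω : Ω) (t : ℕ) :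
    Obs X A :=
  (x t ω, a t ω, r t ω (a t ω))

/-- The information in the contexts, reward vectors and actions of the rounds `1, …, t-1`. -/
abbrev past (x : ℕ → Ω → X) (r : ℕ → Ω → A → unitInterval) (a : ℕ → Ω → A) (t : ℕ) :
    MeasurableSpace Ω :=
  ⨆ s ∈ Finset.Ico 1 t, MeasurableSpace.comap (fun ω => (x s ω, r s ω, a s ω)) inferInstance

/-- The information in the context and the reward vector of round `t`. -/
abbrev current (x : ℕ → Ω → X) (r : ℕ → Ω → A → unitInterval) (t : ℕ) : MeasurableSpace Ω :=
  MeasurableSpace.comap (fun ω => (x t ω, r t ω)) inferInstance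

/-- The random contexts, reward vectors and actions `x_t, r_t, a_t`, `t = 1, 2, …`, on the
probability space `(Ω, μ)` are those of a run of the algorithm in the environment `D`: in every
round `t`, `(x_t, r_t)` has law `D` and is independent of the past, and, given the past, `x_t` and
`r_t`, the action `a_t` has the distribution `p_m(·|x_t)`, where `m` is the epoch of `t`. -/
structure IsRun [Fintype A] (D : Measure (X × (A → unitInterval))) (alg : ModIGW X A)
    (μ : Measure Ω) (x : ℕ → Ω → X) (r : ℕ → Ω → A → unitInterval) (a : ℕ → Ω → A) : Prop where
  x_meas : ∀ t, Measurable (x t)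
  r_meas : ∀ t, Measurable (r t)
  a_meas : ∀ t, Measurable (a t)
  law : ∀ t, 1 ≤ t → μ.map (fun ω => (x t ω, r t ω)) = D
  indep : ∀ t, 1 ≤ t → Indep (current x r t) (past x r a t) μ
  action : ∀ t, 1 ≤ t → ∀ b : A,
    μ[(a t ⁻¹' {b}).indicator (fun _ => (1 : ℝ)) | past x r a t ⊔ current x r t]
      =ᵐ[μ] fun ω => alg.actionProb (obs x r a ω) (epochOf alg.τ₁ t) (x t ω) b

/-- The requirement on the misspecification test, with parameters `β'_i ∈ (0,1]` and a
non-decreasing sequence `β_i > β'_i τ_{m*_i}` (`β_i` may be infinite, and has to be if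
`τ_{m*_i}` is; `β_0 = 0`): for all `i ∈ [M]`, epochs `m` and `ζ ∈ (0,1)`, the test on the data of
epoch `m` of the run answers `False` with probability at least `1-ζ` if `τ_m ≤ β'_i τ_{m*_i}`, and
`True` with probability at least `1-ζ` if `τ_m > β_i`. -/
structure MisspecificationTest (D : Measure (X × (A → unitInterval))) (fstar : Model X A)
    (F : ℕ → Set (Model X A)) (alg : ModIGW X A) (C₀ : ℝ) (β' β : ℕ → ℝ≥0∞)
    (μ : Measure Ω) (x : ℕ → Ω → X) (r : ℕ → Ω → A → unitInterval) (a : ℕ → Ω → A) : Prop where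
  beta_zero : β 0 = 0
  beta_mono : ∀ i ∈ Finset.Icc 1 alg.M, ∀ j ∈ Finset.Icc 1 alg.M, i ≤ j → β i ≤ β j
  beta'_mem : ∀ i ∈ Finset.Icc 1 alg.M, 0 < β' i ∧ β' i ≤ 1
  beta_gt : ∀ i ∈ Finset.Icc 1 alg.M,
    β' i * safeRounds D fstar F alg C₀ i < β i ∨ β i = ⊤
  answers_false : ∀ i ∈ Finset.Icc 1 alg.M, ∀ m : ℕ, 1 ≤ m → ∀ ζ ∈ Set.Ioo (0 : ℝ) 1,
    (epochEnd alg.τ₁ m : ℝ≥0∞) ≤ β' i * safeRounds D fstar F alg C₀ i →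
      ENNReal.ofReal (1 - ζ) ≤ μ {ω | alg.mt i _ (alg.data (obs x r a ω) m) ζ = false}
  answers_true : ∀ i ∈ Finset.Icc 1 alg.M, ∀ m : ℕ, 1 ≤ m → ∀ ζ ∈ Set.Ioo (0 : ℝ) 1,
    β i < (epochEnd alg.τ₁ m : ℝ≥0∞) →
      ENNReal.ofReal (1 - ζ) ≤ μ {ω | alg.mt i _ (alg.data (obs x r a ω) m) ζ = true}

/-- The cumulative regret `R_t = ∑_{s ≤ t} (fstar(x_s, πstar(x_s)) - fstar(x_s, a_s))`. -/
def regret (fstar : Model X A) (πstar : X → A) (x : ℕ → Ω → X) (a : ℕ → Ω → A) (t : ℕ)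
    (ω : Ω) : ℝ :=
  ∑ s ∈ Finset.Icc 1 t,
    ((fstar (x s ω) (πstar (x s ω)) : ℝ) - fstar (x s ω) (a s ω))

end Run

end ModelSelection

end

/-! With probability at least `1 - δ` every estimate is accurate, every test that must give a
definite answer gives it, and the regret exceeds its predictable part by less than `√(2 t log (12 t²
/ δ))`, simultaneously for all epochs and rounds (`IsRun.measure_goodHistory_ge`). The action
probabilities of an epoch depend on earlier epochs only. Hence, given the past, its observations are
independent samples from one law `D(p)` (`IsRun.lintegral_epoch`), so the oracle guarantee applies.
The regret noise is controlled by Azuma's inequality. A union bound combines the three, and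
everything after it is deterministic.

The deterministic core is inverse gap weighting. Since `p(a|x) (K + γ gap) ≥ 1`, the AM-GM
inequality bounds the change of any policy's regret between two models by a multiple of `K/γ`, a
small fraction of regrets under the model that generated `p`, and a multiple of `γ` times the
squared distance of the two models under `p`. So if regrets under the current estimate and under
`fstar` agree up to a factor 2 and an error `e`, then under the next estimate they agree with error
`e/4 + K/(4γ) + 16 γ η`, where `η` bounds its squared error (`RegretsComparable.step`). All regrets
lie in `[0,1]`, so this recursion can be started in any epoch `l₀` with `e = 1`. The initial error
shrinks by 4 per epoch while epochs only double, so a bad start costs `O(τ_{l₀})` in total. With `γ`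
of order `√(K/ξ_i)` the persistent part is of order `√(K ξ_i)` per round and sums to the square root
in the bound (`sum_epochs_le`).

Up to round `β'_i τ_{m*_i}` class `i` survives its tests, so `i_m ≤ i`, and the squared error is at
most `7 ξ_i` (`SafeHorizon.sq_error_le`). It remains that `γ`, tuned to class `i_m`, suits class
`i`: `d_i ≤ 2 d_{i_m}` suffices. If `d_i ≤ 2 d_1` this always holds and `l₀ = 2` works. Otherwise
`l₀` is the epoch after the first one ending beyond `β_{i-1}`: all smaller classes are then rejected
and `i_m = i`. The start costs `O(β_{i-1})` beyond a multiple of `τ₁`, and `ln(d_i/d_1) > ln 2` pays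
for it. This is the origin of the factor `ln(d_i/d_1)`. -/

set_option linter.unusedSectionVars false

noncomputable section

namespace ModelSelection

/-! ### Inverse gap weighting on a single context. -/

section InverseGapWeighting

variable {A : Type*} [Fintype A] {γ : ℝ} {v : A → unitInterval} {b : A}

theorem card_add_gap_pos (hγ : 0 ≤ γ) (hb : ∀ a, v a ≤ v b) (a : A) :
    0 < (Fintype.card A : ℝ) + γ * ((v b : ℝ) - v a) := by
  have : 0 < (Fintype.card A : ℝ) := by exact_mod_cast Fintype.card_pos_iff.2 ⟨b⟩
  have h2 : (v a : ℝ) ≤ v b := hb a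
  have := mul_nonneg hγ (sub_nonneg.2 h2)
  linarith

theorem card_add_gap_ge (hγ : 0 ≤ γ) (hb : ∀ a, v a ≤ v b) (a : A) :
    (Fintype.card A : ℝ) ≤ (Fintype.card A : ℝ) + γ * ((v b : ℝ) - v a) := by
  have h2 : (v a : ℝ) ≤ v b := hb a
  have := mul_nonneg hγ (sub_nonneg.2 h2)
  linarith

theorem one_div_card_le_igw_best (hγ : 0 ≤ γ) (hb : ∀ a, v a ≤ v b) :
    1 / (Fintype.card A : ℝ) ≤ ModIGW.igw γ v b b := by
  classical
  have hK : 0 < (Fintype.card A : ℝ) := by exact_mod_cast Fintype.card_pos_iff.2 ⟨b⟩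
  have h1 : ∑ a' ∈ Finset.univ.erase b, 1 / ((Fintype.card A : ℝ) + γ * ((v b : ℝ) - v a')) ≤
      ∑ a' ∈ Finset.univ.erase b, 1 / (Fintype.card A : ℝ) :=
    Finset.sum_le_sum fun a _ => one_div_le_one_div_of_le hK (card_add_gap_ge hγ hb a)
  rw [Finset.sum_const, Finset.card_erase_of_mem (Finset.mem_univ _), Finset.card_univ,
    nsmul_eq_mul, Nat.cast_pred (Fintype.card_pos_iff.2 ⟨b⟩)] at h1
  have h2 : ((Fintype.card A : ℝ) - 1) * (1 / Fintype.card A) = 1 - 1 / Fintype.card A := by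
    field_simp
  have h3 : ModIGW.igw γ v b b =
      1 - ∑ a' ∈ Finset.univ.erase b, 1 / ((Fintype.card A : ℝ) + γ * ((v b : ℝ) - v a')) := by
    unfold ModIGW.igw
    rw [if_pos rfl]
  rw [h3]
  linarith

theorem igw_of_ne {a : A} (h : a ≠ b) :
    ModIGW.igw γ v b a = 1 / ((Fintype.card A : ℝ) + γ * ((v b : ℝ) - v a)) := by
  simp [ModIGW.igw, h]

theorem igw_nonneg (hγ : 0 ≤ γ) (hb : ∀ a, v a ≤ v b) (a : A) : 0 ≤ ModIGW.igw γ v b a := by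
  by_cases h : a = b
  · subst h
    exact le_trans (by positivity) (one_div_card_le_igw_best hγ hb)
  · rw [igw_of_ne h]
    exact (one_div_pos.2 (card_add_gap_pos hγ hb a)).le

theorem sum_igw : ∑ a, ModIGW.igw γ v b a = 1 := by
  classical
  rw [← Finset.add_sum_erase _ _ (Finset.mem_univ b)]
  have : ∑ a ∈ Finset.univ.erase b, ModIGW.igw γ v b a =
      ∑ a ∈ Finset.univ.erase b, 1 / ((Fintype.card A : ℝ) + γ * ((v b : ℝ) - v a)) :=
    Finset.sum_congr rfl fun a ha => igw_of_ne (Finset.ne_of_mem_erase ha)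
  rw [this]
  unfold ModIGW.igw
  rw [if_pos rfl]
  -- `igw` erases with the classical instance of decidable equality, the goal with the local one.
  have h : (Finset.univ.erase b : Finset A) = @Finset.erase A (fun a b => Classical.propDecidable (a = b)) Finset.univ b := by
    congr!
  rw [h]
  ring

/-- The exploration guarantee: the importance weight `1/p(a|x)` is at most `K + γ gap`. It is an
equality off the best arm; on the best arm it holds because the other arms take at most `(K-1)/K` of
the mass. -/
theorem one_le_igw_mul (hγ : 0 ≤ γ) (hb : ∀ a, v a ≤ v b) (a : A) :
    1 ≤ ModIGW.igw γ v b a * (Fintype.card A + γ * ((v b : ℝ) - v a)) := by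
  by_cases h : a = b
  · subst h
    have := one_div_card_le_igw_best hγ hb
    have hK : 0 < (Fintype.card A : ℝ) := by exact_mod_cast Fintype.card_pos_iff.2 ⟨a⟩
    rw [sub_self, mul_zero, add_zero]
    rwa [div_le_iff₀ hK] at this
  · rw [igw_of_ne h, one_div_mul_cancel (card_add_gap_pos hγ hb a).ne']

/-- The exploitation guarantee: each arm contributes at most `gap / (K + γ gap) ≤ 1/γ` to the regret
predicted by the model. -/
theorem sum_igw_mul_gap_le (hγ : 0 < γ) (hb : ∀ a, v a ≤ v b) :
    ∑ a, ModIGW.igw γ v b a * ((v b : ℝ) - v a) ≤ Fintype.card A / γ := by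
  have h : ∀ a ∈ Finset.univ, ModIGW.igw γ v b a * ((v b : ℝ) - v a) ≤ 1 / γ := by
    intro a _
    by_cases h : a = b
    · subst h
      simp [hγ.le]
    · rw [igw_of_ne h, one_div_mul_eq_div, div_le_div_iff₀ (card_add_gap_pos hγ.le hb a) hγ]
      have hK : 0 ≤ (Fintype.card A : ℝ) := by positivity
      linarith
  refine (Finset.sum_le_sum h).trans_eq ?_
  simp [Finset.card_univ, div_eq_mul_inv]

end InverseGapWeighting

/-! ### Regret of policies under different models and its propagation from epoch to epoch. -/

section Policies

variable {X A : Type*} [MeasurableSpace X]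

/-- `q(a|x)` is a measurable stochastic policy. -/
structure IsPolicy [Fintype A] (q : X → A → ℝ) : Prop where
  meas : ∀ a, Measurable fun x => q x a
  nonneg : ∀ x a, 0 ≤ q x a
  sum_eq_one : ∀ x, ∑ a, q x a = 1

/-- The expected regret of the policy `q` when `f` is the mean reward. -/
def gapRegret [Fintype A] (best : (A → unitInterval) → A) (ν : Measure X) (f : Model X A)
    (q : X → A → ℝ) : ℝ :=
  ∫ x, ∑ a, q x a * ((f x (best (f x)) : ℝ) - f x a) ∂ν

open Classical in
/-- The policy that plays a best arm of the model `f`. -/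
def greedy (best : (A → unitInterval) → A) (f : Model X A) (x : X) (a : A) : ℝ :=
  if a = best (f x) then 1 else 0

theorem sum_greedy_mul [Fintype A] (best : (A → unitInterval) → A) (f : Model X A) (x : X)
    (g : A → ℝ) : ∑ a, greedy best f x a * g a = g (best (f x)) := by
  rw [Finset.sum_eq_single (best (f x)) (fun a _ h => by simp [greedy, h]) (by simp)]
  simp [greedy]

theorem IsPolicy.le_one [Fintype A] {q : X → A → ℝ} (hq : IsPolicy q) (x : X) (a : A) :
    q x a ≤ 1 := by
  rw [← hq.sum_eq_one x]
  exact Finset.single_le_sum (fun a _ => hq.nonneg x a) (Finset.mem_univ a)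

theorem IsPolicy.sum_mul_le_one [Fintype A] {q : X → A → ℝ} (hq : IsPolicy q) (x : X)
    {g : A → ℝ} (hg : ∀ a, g a ≤ 1) : ∑ a, q x a * g a ≤ 1 := by
  rw [← hq.sum_eq_one x]
  exact Finset.sum_le_sum fun a _ => mul_le_of_le_one_right (hq.nonneg x a) (hg a)

/-- `best` selects a maximizer. -/
abbrev IsArgmax (best : (A → unitInterval) → A) : Prop :=
  ∀ (v : A → unitInterval) (b : A), v b ≤ v (best v)

theorem measurable_model_apply {f : Model X A} (hf : Measurable f) (a : A) :
    Measurable fun x => (f x a : ℝ) :=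
  measurable_subtype_coe.comp ((measurable_pi_apply a).comp hf)

/-- Regret under the model `f` and under the model `g` agree for all policies, up to a factor `2`
and the additive error `e`. -/
def RegretsComparable [Fintype A] (best : (A → unitInterval) → A) (ν : Measure X) (f g : Model X A)
    (e : ℝ) : Prop :=
  ∀ q : X → A → ℝ, IsPolicy q → gapRegret best ν g q ≤ 2 * gapRegret best ν f q + e ∧
    gapRegret best ν f q ≤ 2 * gapRegret best ν g q + e

theorem RegretsComparable.mono [Fintype A] {best : (A → unitInterval) → A} {ν : Measure X}
    {f g : Model X A} {e e' : ℝ}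
    (h : RegretsComparable best ν f g e) (he : e ≤ e') : RegretsComparable best ν f g e' :=
  fun q hq => ⟨by linarith [(h q hq).1], by linarith [(h q hq).2]⟩

variable [MeasurableSpace A] [Fintype A] [MeasurableSingletonClass A]

theorem measurable_eval_arm (Y : Type*) [MeasurableSpace Y] :
    Measurable fun z : (A → Y) × A => z.1 z.2 :=
  measurable_from_prod_countable_left fun a => measurable_pi_apply a

variable {best : (A → unitInterval) → A} {ν : Measure X}

theorem measurable_best_value (hbest : Measurable best) {f : Model X A} (hf : Measurable f) :
    Measurable fun x => (f x (best (f x)) : ℝ) :=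
  measurable_subtype_coe.comp ((measurable_eval_arm _).comp (hf.prodMk (hbest.comp hf)))

theorem isPolicy_greedy (hbest : Measurable best) {f : Model X A} (hf : Measurable f) :
    IsPolicy (greedy best f) where
  meas a := by
    unfold greedy
    refine Measurable.ite ?_ measurable_const measurable_const
    have : {x | a = best (f x)} = (fun x => best (f x)) ⁻¹' {a} := by
      ext x; simp [eq_comm]
    rw [this]
    exact (hbest.comp hf) (measurableSet_singleton a)
  nonneg x a := by unfold greedy; split_ifs <;> norm_num
  sum_eq_one x := by simpa using sum_greedy_mul best f x fun _ => 1

theorem measurable_gap_sum (hbest : Measurable best) {f : Model X A} (hf : Measurable f)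
    {q : X → A → ℝ} (hq : IsPolicy q) :
    Measurable fun x => ∑ a, q x a * ((f x (best (f x)) : ℝ) - f x a) :=
  Finset.measurable_sum _ fun a _ =>
    (hq.meas a).mul ((measurable_best_value hbest hf).sub (measurable_model_apply hf a))

theorem gap_sum_mem (hmax : IsArgmax best) (f : Model X A) {q : X → A → ℝ} (hq : IsPolicy q)
    (x : X) : ∑ a, q x a * ((f x (best (f x)) : ℝ) - f x a) ∈ Set.Icc (0 : ℝ) 1 := by
  refine ⟨Finset.sum_nonneg fun a _ => mul_nonneg (hq.nonneg x a) (sub_nonneg.2 (hmax (f x) a)),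
    hq.sum_mul_le_one x fun a => ?_⟩
  have := (f x (best (f x))).2.2
  have := (f x a).2.1
  linarith

theorem integrable_gap_sum [IsProbabilityMeasure ν] (hbest : Measurable best)
    (hmax : IsArgmax best) {f : Model X A} (hf : Measurable f) {q : X → A → ℝ}
    (hq : IsPolicy q) :
    Integrable (fun x => ∑ a, q x a * ((f x (best (f x)) : ℝ) - f x a)) ν :=
  Integrable.of_mem_Icc 0 1 (measurable_gap_sum hbest hf hq).aemeasurable
    (ae_of_all _ fun x => gap_sum_mem hmax f hq x)

theorem gapRegret_mem [IsProbabilityMeasure ν] (hbest : Measurable best)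
    (hmax : IsArgmax best) {f : Model X A} (hf : Measurable f) {q : X → A → ℝ}
    (hq : IsPolicy q) : gapRegret best ν f q ∈ Set.Icc (0 : ℝ) 1 := by
  refine ⟨integral_nonneg fun x => (gap_sum_mem hmax f hq x).1, ?_⟩
  have := integral_mono (integrable_gap_sum hbest hmax hf hq) (integrable_const (μ := ν) (1 : ℝ))
    fun x => (gap_sum_mem hmax f hq x).2
  simpa [gapRegret] using this

theorem gapRegret_greedy_self (f : Model X A) : gapRegret best ν f (greedy best f) = 0 := by
  simp [gapRegret, sum_greedy_mul]

/-- AM-GM in the form `|s| ≤ c w + s²/(4 c w)`, with `1/w` replaced by the larger `p`; the factor `q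
≤ 1` is dropped from the quadratic term only. Here `w` will be `K + γ gap`. -/
theorem mul_abs_le_of_one_le_mul {q p w s c : ℝ} (hq0 : 0 ≤ q) (hq1 : q ≤ 1) (hw : 0 < w)
    (hpw : 1 ≤ p * w) (hc : 0 < c) :
    q * |s| ≤ c * (q * w) + (p * s ^ 2) / (4 * c) := by
  have hp : 0 ≤ p := by
    by_contra h
    nlinarith
  have h1 : |s| ≤ c * w + p * s ^ 2 / (4 * c) := by
    have hs : |s| * 1 ≤ |s| * (p * w) := mul_le_mul_of_nonneg_left hpw (abs_nonneg s)
    have h2 : |s| ^ 2 = s ^ 2 := sq_abs s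
    have h3 : 4 * c * |s| ≤ 4 * c * (c * w) + p * s ^ 2 := by
      rw [← h2]
      have h4 : 0 ≤ p * |s| ^ 2 := by positivity
      have h5 : 0 ≤ w * (4 * c * (c * w) + p * |s| ^ 2 - 4 * c * |s|) := by
        nlinarith [sq_nonneg (2 * c * w - |s|), mul_le_mul_of_nonneg_right hpw (sq_nonneg |s|)]
      have := nonneg_of_mul_nonneg_right h5 hw
      linarith
    have : |s| ≤ (4 * c * (c * w) + p * s ^ 2) / (4 * c) := by
      rw [le_div_iff₀ (by positivity)]; linarith
    rwa [add_div, mul_div_cancel_left₀ _ (by positivity)] at this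
  have h6 : 0 ≤ p * s ^ 2 / (4 * c) := by positivity
  calc q * |s| ≤ q * (c * w + p * s ^ 2 / (4 * c)) := mul_le_mul_of_nonneg_left h1 hq0
    _ = c * (q * w) + q * (p * s ^ 2 / (4 * c)) := by ring
    _ ≤ _ := by nlinarith

/-- Pointwise, the difference of regrets is at most the discrepancy of `f` and `g` averaged over `q`
plus their discrepancy at the greedy arm of `g`. Both are bounded by AM-GM against the exploration
weights, whose averages are `K + γ` times a regret under `f₀`. The free parameter `c` balances the
two kinds of terms. -/
theorem gapRegret_sub_le [IsProbabilityMeasure ν] (hbest : Measurable best)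
    (hmax : IsArgmax best) {f g f₀ : Model X A} (hf : Measurable f) (hg : Measurable g)
    (hf₀ : Measurable f₀) {p q : X → A → ℝ} (hp : IsPolicy p) (hq : IsPolicy q) {γ c : ℝ}
    (hγ : 0 ≤ γ) (hc : 0 < c)
    (hw : ∀ x a, 1 ≤ p x a * (Fintype.card A + γ * ((f₀ x (best (f₀ x)) : ℝ) - f₀ x a))) :
    gapRegret best ν g q - gapRegret best ν f q ≤
      c * (2 * Fintype.card A + γ * gapRegret best ν f₀ q +
        γ * gapRegret best ν f₀ (greedy best g)) +
      (∫ x, ∑ a, p x a * ((f x a : ℝ) - g x a) ^ 2 ∂ν) / (2 * c) := by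
  have hsq_meas : Measurable fun x => ∑ a, p x a * ((f x a : ℝ) - g x a) ^ 2 :=
    Finset.measurable_sum _ fun a _ => (hp.meas a).mul
      (((measurable_model_apply hf a).sub (measurable_model_apply hg a)).pow_const 2)
  have hsq_int : Integrable (fun x => ∑ a, p x a * ((f x a : ℝ) - g x a) ^ 2) ν := by
    refine Integrable.of_mem_Icc 0 1 hsq_meas.aemeasurable (ae_of_all _ fun x => ?_)
    refine ⟨Finset.sum_nonneg fun a _ => mul_nonneg (hp.nonneg x a) (sq_nonneg _),
      hp.sum_mul_le_one x fun a => ?_⟩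
    have h1 := (f x a).2.1
    have h2 := (f x a).2.2
    have h3 := (g x a).2.1
    have h4 := (g x a).2.2
    nlinarith
  have i1 := integrable_gap_sum (ν := ν) hbest hmax hg hq
  have i2 := integrable_gap_sum (ν := ν) hbest hmax hf hq
  have i3 := integrable_gap_sum (ν := ν) hbest hmax hf₀ hq
  have i4 := integrable_gap_sum (ν := ν) hbest hmax hf₀ (isPolicy_greedy hbest hg)
  have key := integral_mono (i1.sub i2)
    (((((integrable_const (2 * (Fintype.card A : ℝ))).add (i3.const_mul γ)).add
      (i4.const_mul γ)).const_mul c).add (hsq_int.div_const (2 * c))) (fun x => by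
    simp only [Pi.sub_apply, Pi.add_apply]
    have hgr : ∑ a, greedy best g x a * ((f₀ x (best (f₀ x)) : ℝ) - f₀ x a) =
        (f₀ x (best (f₀ x)) : ℝ) - f₀ x (best (g x)) :=
      sum_greedy_mul best g x fun a => (f₀ x (best (f₀ x)) : ℝ) - f₀ x a
    rw [hgr]
    have hwpos : ∀ a, 0 < (Fintype.card A : ℝ) + γ * ((f₀ x (best (f₀ x)) : ℝ) - f₀ x a) :=
      card_add_gap_pos hγ (hmax (f₀ x))
    have hA : ∑ a, q x a * |(f x a : ℝ) - g x a| ≤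
        c * (Fintype.card A + γ * ∑ a, q x a * ((f₀ x (best (f₀ x)) : ℝ) - f₀ x a)) +
          (∑ a, p x a * ((f x a : ℝ) - g x a) ^ 2) / (4 * c) := by
      have := Finset.sum_le_sum fun a (_ : a ∈ Finset.univ) =>
        mul_abs_le_of_one_le_mul (s := (f x a : ℝ) - g x a) (hq.nonneg x a) (hq.le_one x a)
          (hwpos a) (hw x a) hc
      refine this.trans_eq ?_
      rw [Finset.sum_add_distrib, ← Finset.mul_sum, ← Finset.sum_div]
      congr 2
      simp_rw [mul_add, Finset.sum_add_distrib, ← Finset.sum_mul, hq.sum_eq_one, one_mul,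
        Finset.mul_sum]
      congr 1
      exact Finset.sum_congr rfl fun a _ => by ring
    have hB : |(f x (best (g x)) : ℝ) - g x (best (g x))| ≤
        c * (Fintype.card A + γ * ((f₀ x (best (f₀ x)) : ℝ) - f₀ x (best (g x)))) +
          (∑ a, p x a * ((f x a : ℝ) - g x a) ^ 2) / (4 * c) := by
      have h1 := mul_abs_le_of_one_le_mul (q := 1) (s := (f x (best (g x)) : ℝ) - g x (best (g x)))
        zero_le_one le_rfl (hwpos (best (g x))) (hw x (best (g x))) hc
      have h2 := Finset.single_le_sum (f := fun a => p x a * ((f x a : ℝ) - g x a) ^ 2)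
        (fun a _ => mul_nonneg (hp.nonneg x a) (sq_nonneg _)) (Finset.mem_univ (best (g x)))
      have h3 := div_le_div_of_nonneg_right h2 (by positivity : 0 ≤ 4 * c)
      simp only [one_mul] at h1
      linarith
    have hC : ∑ a, q x a * ((g x (best (g x)) : ℝ) - g x a) -
        ∑ a, q x a * ((f x (best (f x)) : ℝ) - f x a) ≤
        ∑ a, q x a * |(f x a : ℝ) - g x a| + |(f x (best (g x)) : ℝ) - g x (best (g x))| := by
      have h1 : ∑ a, q x a * ((g x (best (g x)) : ℝ) - g x a) -
          ∑ a, q x a * ((f x (best (f x)) : ℝ) - f x a) =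
          ∑ a, q x a * ((f x a : ℝ) - g x a) + (g x (best (g x)) - f x (best (f x))) := by
        have : (g x (best (g x)) - f x (best (f x)) : ℝ) =
            ∑ a, q x a * (g x (best (g x)) - f x (best (f x)) : ℝ) := by
          rw [← Finset.sum_mul, hq.sum_eq_one, one_mul]
        rw [this, ← Finset.sum_sub_distrib, ← Finset.sum_add_distrib]
        exact Finset.sum_congr rfl fun a _ => by ring
      have h2 : ∑ a, q x a * ((f x a : ℝ) - g x a) ≤ ∑ a, q x a * |(f x a : ℝ) - g x a| :=
        Finset.sum_le_sum fun a _ => mul_le_mul_of_nonneg_left (le_abs_self _) (hq.nonneg x a)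
      -- Optimality of `best (f x)` for `f` moves both maximal values to the single arm `best (g
      -- x)`.
      have h3 : (f x (best (g x)) : ℝ) ≤ f x (best (f x)) := hmax (f x) (best (g x))
      have h4 := neg_abs_le ((f x (best (g x)) : ℝ) - g x (best (g x)))
      linarith
    have h5 : ∀ s : ℝ, s / (2 * c) = s / (4 * c) + s / (4 * c) := fun s => by
      field_simp; ring
    rw [h5]
    linarith)
  have e1 : ∫ x, ((fun x => ∑ a, q x a * ((g x (best (g x)) : ℝ) - g x a)) -
      fun x => ∑ a, q x a * ((f x (best (f x)) : ℝ) - f x a)) x ∂ν =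
      gapRegret best ν g q - gapRegret best ν f q := integral_sub i1 i2
  rw [e1] at key
  refine key.trans_eq ?_
  simp only [Pi.add_apply]
  rw [integral_add ?_ (hsq_int.div_const _), integral_const_mul, integral_div,
    integral_add ?_ (i4.const_mul γ), integral_add (integrable_const _) (i3.const_mul γ),
    integral_const_mul]
  · simp [gapRegret, integral_const_mul]
  · exact (integrable_const _).add (i3.const_mul γ)
  · exact (((integrable_const _).add (i3.const_mul γ)).add (i4.const_mul γ)).const_mul c

/-- The start of the recursion, valid for any two models because regrets lie in `[0,1]`. -/
theorem regretsComparable_one [IsProbabilityMeasure ν] (hbest : Measurable best)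
    (hmax : IsArgmax best) {f g : Model X A} (hf : Measurable f) (hg : Measurable g) :
    RegretsComparable best ν f g 1 := by
  intro q hq
  have h1 := gapRegret_mem (ν := ν) hbest hmax hf hq
  have h2 := gapRegret_mem (ν := ν) hbest hmax hg hq
  exact ⟨by linarith [h1.1, h2.2], by linarith [h1.2, h2.1]⟩

/-- One epoch of inverse gap weighting: `p` explores according to the gaps of the model `f₀`, and
the model `f` has small squared error under `p`. -/
theorem RegretsComparable.step [IsProbabilityMeasure ν] (hbest : Measurable best)
    (hmax : IsArgmax best) {f g f₀ : Model X A} (hf : Measurable f) (hg : Measurable g)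
    (hf₀ : Measurable f₀) {p : X → A → ℝ} (hp : IsPolicy p) {γ e η : ℝ} (hγ : 0 < γ)
    (hw : ∀ x a, 1 ≤ p x a * (Fintype.card A + γ * ((f₀ x (best (f₀ x)) : ℝ) - f₀ x a)))
    (h : RegretsComparable best ν f₀ g e)
    (hη : ∫ x, ∑ a, p x a * ((f x a : ℝ) - g x a) ^ 2 ∂ν ≤ η) :
    RegretsComparable best ν f g (e / 4 + Fintype.card A / γ / 4 + 16 * (γ * η)) := by
  have hK : (0 : ℝ) ≤ Fintype.card A / γ := by positivity
  have hη0 : 0 ≤ η := le_trans (integral_nonneg fun x => Finset.sum_nonneg fun a _ =>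
    mul_nonneg (hp.nonneg x a) (sq_nonneg _)) hη
  have hγη : 0 ≤ γ * η := by positivity
  have hη' : ∫ x, ∑ a, p x a * ((g x a : ℝ) - f x a) ^ 2 ∂ν ≤ η := by
    refine le_of_eq_of_le ?_ hη
    congr 1; ext x
    exact Finset.sum_congr rfl fun a _ => by ring
  -- With `c = 1/(16γ)` the two regrets under `f₀` enter with weight `1/16`. Comparability turns the
  -- one of `q` into at most `1/8` of its regret under `g`, which is absorbed on the left, and
  -- leaves `e` with a factor below `1/4`.
  have hc : 0 < 1 / (16 * γ) := by positivity
  have simp1 : ∀ u v I : ℝ, I ≤ η → 1 / (16 * γ) * (2 * Fintype.card A + γ * u + γ * v) +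
      I / (2 * (1 / (16 * γ))) ≤ (2 * (Fintype.card A / γ) + u + v) / 16 + 8 * (γ * η) := by
    intro u v I hI
    have h1 : I / (2 * (1 / (16 * γ))) = 8 * (γ * I) := by field_simp; ring
    have h2 : 1 / (16 * γ) * (2 * Fintype.card A + γ * u + γ * v) =
      (2 * (Fintype.card A / γ) + u + v) / 16 := by field_simp
    rw [h1, h2]
    have := mul_le_mul_of_nonneg_left hI hγ.le
    linarith
  have hself : gapRegret best ν g (greedy best g) = 0 := gapRegret_greedy_self g
  have hself' : gapRegret best ν f (greedy best f) = 0 := gapRegret_greedy_self f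
  have hgg := (h _ (isPolicy_greedy hbest hg)).2
  have fst : ∀ q, IsPolicy q → gapRegret best ν g q ≤ 2 * gapRegret best ν f q +
      (e / 4 + Fintype.card A / γ / 4 + 16 * (γ * η)) := by
    intro q hq
    have h1 := (gapRegret_sub_le (ν := ν) hbest hmax hf hg hf₀ hp hq hγ.le hc hw).trans
      (simp1 _ _ _ hη)
    have h2 := (h q hq).2
    have h3 := (gapRegret_mem (ν := ν) hbest hmax hg hq).1
    linarith
  intro q hq
  refine ⟨fst q hq, ?_⟩
  have h1 := (gapRegret_sub_le (ν := ν) hbest hmax hg hf hf₀ hp hq hγ.le hc hw).trans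
    (simp1 _ _ _ hη')
  have h2 := (h q hq).2
  have h3 := (h _ (isPolicy_greedy hbest hf)).2
  -- The second inequality needs the regret under `g` of the greedy policy of `f`. The first
  -- inequality, just proved, bounds it, as that policy has no regret under `f`.
  have h4 := fst _ (isPolicy_greedy hbest hf)
  have h5 := (gapRegret_mem (ν := ν) hbest hmax hg hq).1
  have he : 0 ≤ e := by
    have := (gapRegret_mem (ν := ν) hbest hmax hf₀ (isPolicy_greedy hbest hg)).1
    linarith
  linarith

end Policies

/-! ### Arithmetic of the doubling epochs. -/

section Epochs

variable {τ₁ : ℕ}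

theorem epochEnd_succ_succ (m : ℕ) : epochEnd τ₁ (m + 2) = 2 * epochEnd τ₁ (m + 1) := by
  simp [epochEnd, pow_succ]; ring

theorem epochEnd_one : epochEnd τ₁ 1 = τ₁ := by simp [epochEnd]

theorem epochLen_one : epochLen τ₁ 1 = τ₁ := by simp [epochLen, epochEnd]

theorem epochLen_add_two (m : ℕ) : epochLen τ₁ (m + 2) = epochEnd τ₁ (m + 1) := by
  rw [epochLen, epochEnd_succ_succ, Nat.add_sub_assoc (by norm_num)]
  norm_num
  omega

theorem epochEnd_mono : Monotone (epochEnd τ₁) := by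
  refine monotone_nat_of_le_succ fun m => ?_
  rcases m with _ | m
  · simp [epochEnd]
  · rw [epochEnd_succ_succ]; omega

theorem le_epochEnd (hτ : 1 ≤ τ₁) (m : ℕ) : m ≤ epochEnd τ₁ m := by
  rcases m with _ | m
  · simp
  · have h1 : m + 1 ≤ 2 ^ m := Nat.lt_two_pow_self
    exact h1.trans (Nat.le_mul_of_pos_right _ hτ)

theorem epochEnd_strictMono (hτ : 1 ≤ τ₁) : StrictMono (epochEnd τ₁) := by
  refine strictMono_nat_of_lt_succ fun m => ?_
  rcases m with _ | m
  · simp only [epochEnd]; omega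
  · rw [epochEnd_succ_succ]
    have := le_epochEnd hτ (m + 1)
    omega

theorem epochEnd_add_epochLen (m : ℕ) :
    epochEnd τ₁ (m - 1) + epochLen τ₁ m = epochEnd τ₁ m := by
  have := epochEnd_mono (τ₁ := τ₁) (Nat.sub_le m 1)
  rw [epochLen]; omega

theorem le_epochEnd_epochOf (hτ : 1 ≤ τ₁) (t : ℕ) : t ≤ epochEnd τ₁ (epochOf τ₁ t) :=
  Nat.sInf_mem (s := {m | t ≤ epochEnd τ₁ m}) ⟨t, le_epochEnd hτ t⟩

theorem epochOf_le {t m : ℕ} (h : t ≤ epochEnd τ₁ m) : epochOf τ₁ t ≤ m :=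
  Nat.sInf_le (s := {m | t ≤ epochEnd τ₁ m}) h

theorem one_le_epochOf (hτ : 1 ≤ τ₁) {t : ℕ} (ht : 1 ≤ t) : 1 ≤ epochOf τ₁ t := by
  by_contra h
  have h0 : epochOf τ₁ t = 0 := by omega
  have := le_epochEnd_epochOf hτ t
  rw [h0] at this
  simp only [epochEnd] at this
  omega

theorem epochEnd_epochOf_lt (hτ : 1 ≤ τ₁) {t : ℕ} (ht : 1 ≤ t) :
    epochEnd τ₁ (epochOf τ₁ t - 1) < t := by
  by_contra h
  have h1 := epochOf_le (not_lt.1 h)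
  have := one_le_epochOf hτ ht
  omega

theorem epochOf_eq (hτ : 1 ≤ τ₁) {t m : ℕ} (h1 : epochEnd τ₁ (m - 1) < t)
    (h2 : t ≤ epochEnd τ₁ m) : epochOf τ₁ t = m := by
  refine le_antisymm (epochOf_le h2) ?_
  by_contra h
  have h3 := le_epochEnd_epochOf hτ t
  have h4 := epochEnd_mono (τ₁ := τ₁) (show epochOf τ₁ t ≤ m - 1 by omega)
  omega

end Epochs

-- Here the sum runs over all arms, not over a set depending on `b`. This makes measurability in `b`
-- visible when `b` is a random arm.
open Classical in
theorem igw_eq {A : Type*} [Fintype A] (γ : ℝ) (v : A → unitInterval) (b a : A) :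
    ModIGW.igw γ v b a = if b = a then
      1 - (∑ a', 1 / ((Fintype.card A : ℝ) + γ * ((v b : ℝ) - v a')) - 1 / Fintype.card A)
    else 1 / ((Fintype.card A : ℝ) + γ * ((v b : ℝ) - v a)) := by
  unfold ModIGW.igw
  rw [Finset.sum_erase_eq_sub (Finset.mem_univ b), sub_self, mul_zero, add_zero]
  simp only [eq_comm]

/-! ### Measurability of the algorithm, and policies as kernels. -/

section Measurability

variable {X A : Type*} [MeasurableSpace X] [MeasurableSpace A] {alg : ModIGW X A}

theorem measurable_data (alg : ModIGW X A) (m : ℕ) :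
    Measurable fun h : ℕ → Obs X A => alg.data h m :=
  measurable_pi_lambda _ fun _ => measurable_pi_apply _

theorem measurable_est_model (hreg : alg.Regular) (i n : ℕ) :
    Measurable fun z : (Fin n → Obs X A) × X => alg.est i n z.1 z.2 :=
  measurable_pi_lambda _ fun _ =>
    (hreg.est_meas i n).comp (measurable_fst.prodMk (measurable_snd.prodMk measurable_const))

theorem measurable_fhat (hreg : alg.Regular) (m : ℕ) :
    Measurable fun z : (ℕ → Obs X A) × X => alg.fhat z.1 m z.2 := by
  rcases m with _ | _ | m
  · exact measurable_const
  · exact measurable_const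
  · exact (measurable_est_model hreg _ _).comp
      (((measurable_data alg (m + 1)).comp measurable_fst).prodMk measurable_snd)

theorem measurable_fhat_model (hreg : alg.Regular) (h : ℕ → Obs X A) (m : ℕ) :
    Measurable (alg.fhat h m) :=
  (measurable_fhat hreg m).comp measurable_prodMk_left

theorem measurableSet_mem_indexSet (hreg : alg.Regular) (i m : ℕ) :
    MeasurableSet {h : ℕ → Obs X A | i ∈ alg.indexSet h m} := by
  induction m using Nat.strong_induction_on with
  | _ m ih =>
    rcases m with _ | _ | m
    · exact MeasurableSet.const _
    · exact MeasurableSet.const _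
    · have : {h : ℕ → Obs X A | i ∈ alg.indexSet h (m + 2)} =
          {h | i ∈ alg.indexSet h (m + 1)} ∩
            (fun h => alg.mt i _ (alg.data h (m + 1)) (alg.level (m + 1))) ⁻¹' {false} := by
        ext h; simp [ModIGW.indexSet]
      rw [this]
      exact (ih _ (by omega)).inter
        (((hreg.mt_meas i _ _).comp (measurable_data alg _)) (measurableSet_singleton _))

theorem measurable_index (hreg : alg.Regular) (m : ℕ) :
    Measurable fun h : ℕ → Obs X A => alg.index h m := by
  -- `Finset ℕ` is countable, so with the discrete σ-algebra measurability only has to be checked on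
  -- single index sets.
  let _ : MeasurableSpace (Finset ℕ) := ⊤
  have h1 : Measurable fun h : ℕ → Obs X A => alg.indexSet h m := by
    refine measurable_to_countable' fun S => ?_
    have : (fun h : ℕ → Obs X A => alg.indexSet h m) ⁻¹' {S} =
        ⋂ i, {h | i ∈ alg.indexSet h m ↔ i ∈ S} := by
      ext h; simp [Finset.ext_iff]
    rw [this]
    exact MeasurableSet.iInter fun i =>
      (measurableSet_mem_indexSet hreg i m).iff (MeasurableSet.const _)
  exact (measurable_from_top (f := fun S : Finset ℕ =>
    if hne : S.Nonempty then S.min' hne else alg.M)).comp h1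

variable [Fintype A]

theorem measurable_gamma (hreg : alg.Regular) (m : ℕ) :
    Measurable fun h : ℕ → Obs X A => alg.gamma h m := by
  rcases m with _ | _ | m
  · exact measurable_const
  · exact measurable_const
  · exact (measurable_from_nat (f := fun i => alg.gammaClass (m + 1) i)).comp
      (measurable_index hreg (m + 2))

theorem gamma_nonneg (alg : ModIGW X A) (h : ℕ → Obs X A) (m : ℕ) : 0 ≤ alg.gamma h m := by
  rcases m with _ | _ | m
  · exact zero_le_one
  · exact zero_le_one
  · exact Real.sqrt_nonneg _

variable [MeasurableSingletonClass A]

theorem measurable_actionProb (hreg : alg.Regular) (m : ℕ) (a : A) :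
    Measurable fun z : (ℕ → Obs X A) × X => alg.actionProb z.1 m z.2 a := by
  have hf := measurable_fhat hreg m
  have hb : Measurable fun z : (ℕ → Obs X A) × X => alg.best (alg.fhat z.1 m z.2) :=
    hreg.best_meas.comp hf
  have hγ : Measurable fun z : (ℕ → Obs X A) × X => alg.gamma z.1 m :=
    (measurable_gamma hreg m).comp measurable_fst
  have hv : Measurable fun z : (ℕ → Obs X A) × X =>
      (alg.fhat z.1 m z.2 (alg.best (alg.fhat z.1 m z.2)) : ℝ) :=
    measurable_subtype_coe.comp ((measurable_eval_arm _).comp (hf.prodMk hb))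
  have hva : ∀ a, Measurable fun z : (ℕ → Obs X A) × X => (alg.fhat z.1 m z.2 a : ℝ) :=
    fun a => measurable_subtype_coe.comp ((measurable_pi_apply a).comp hf)
  have hq : ∀ a, Measurable fun z : (ℕ → Obs X A) × X => 1 / ((Fintype.card A : ℝ) +
      alg.gamma z.1 m * ((alg.fhat z.1 m z.2 (alg.best (alg.fhat z.1 m z.2)) : ℝ) -
        alg.fhat z.1 m z.2 a)) := fun a =>
    (measurable_const.add (hγ.mul (hv.sub (hva a)))).const_div 1
  have hset : MeasurableSet {z : (ℕ → Obs X A) × X | alg.best (alg.fhat z.1 m z.2) = a} :=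
    hb (measurableSet_singleton a)
  classical
  simp only [ModIGW.actionProb, igw_eq]
  exact Measurable.ite hset (measurable_const.sub
    ((Finset.measurable_sum _ fun a' _ => hq a').sub measurable_const)) (hq a)

theorem measurable_actionProb_comp (hreg : alg.Regular) (m : ℕ) (b : A) {S : Type*}
    [MeasurableSpace S] {f : S → ℕ → Obs X A} {g : S → X} (hf : Measurable f)
    (hg : Measurable g) : Measurable fun s => alg.actionProb (f s) m (g s) b := by
  have h := (measurable_actionProb hreg m b).comp (hf.prodMk hg)
  exact h

theorem isPolicy_actionProb (hreg : alg.Regular) (h : ℕ → Obs X A) (m : ℕ) :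
    IsPolicy (alg.actionProb h m) := by
  constructor
  · intro a
    exact measurable_actionProb_comp hreg m a measurable_const measurable_id
  · intro x a
    have h2 := igw_nonneg (gamma_nonneg alg h m) (hreg.best_max (alg.fhat h m x)) a
    exact h2
  · intro x
    have h3 := sum_igw (γ := alg.gamma h m) (v := alg.fhat h m x)
      (b := alg.best (alg.fhat h m x))
    exact h3

/-- A stochastic policy as a kernel. -/
def IsPolicy.kernel {q : X → A → ℝ} (hq : IsPolicy q) : Kernel X A where
  toFun x := ∑ a, ENNReal.ofReal (q x a) • Measure.dirac a
  measurable' := by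
    refine Measure.measurable_of_measurable_coe _ fun s hs => ?_
    simp only [Measure.coe_finsetSum, Measure.coe_smul, Finset.sum_apply, Pi.smul_apply,
      smul_eq_mul]
    exact Finset.measurable_sum _ fun a _ => (hq.meas a).ennreal_ofReal.mul_const _

theorem IsPolicy.kernel_apply {q : X → A → ℝ} (hq : IsPolicy q) (x : X) :
    hq.kernel x = ∑ a, ENNReal.ofReal (q x a) • Measure.dirac a := rfl

theorem IsPolicy.lintegral_kernel {q : X → A → ℝ} (hq : IsPolicy q) (x : X) (φ : A → ℝ≥0∞) :
    ∫⁻ a, φ a ∂(hq.kernel x) = ∑ a, ENNReal.ofReal (q x a) * φ a := by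
  rw [hq.kernel_apply, lintegral_finsetSum_measure]
  simp [lintegral_smul_measure]

theorem IsPolicy.integral_kernel {q : X → A → ℝ} (hq : IsPolicy q) (x : X) (φ : A → ℝ) :
    ∫ a, φ a ∂(hq.kernel x) = ∑ a, q x a * φ a := by
  rw [hq.kernel_apply, integral_finsetSum_measure]
  · refine Finset.sum_congr rfl fun a _ => ?_
    rw [integral_smul_measure, integral_dirac, ENNReal.toReal_ofReal (hq.nonneg x a), smul_eq_mul]
  · intro a _
    exact (integrable_dirac (by simp)).smul_measure ENNReal.ofReal_ne_top

theorem IsPolicy.isMarkovKernel {q : X → A → ℝ} (hq : IsPolicy q) :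
    IsMarkovKernel hq.kernel := by
  refine ⟨fun x => ⟨?_⟩⟩
  rw [← lintegral_one, hq.lintegral_kernel]
  simp only [mul_one]
  rw [← ENNReal.ofReal_sum_of_nonneg fun a _ => hq.nonneg x a, hq.sum_eq_one, ENNReal.ofReal_one]

theorem lintegral_sampleLaw (D : Measure (X × (A → unitInterval))) [IsProbabilityMeasure D]
    {q : X → A → ℝ} (hq : IsPolicy q) {φ : Obs X A → ℝ≥0∞} (hφ : Measurable φ) :
    ∫⁻ o, φ o ∂(sampleLaw D hq.kernel) =
      ∫⁻ y, ∑ a, ENNReal.ofReal (q y.1 a) * φ (y.1, a, y.2 a) ∂D := by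
  have := hq.isMarkovKernel
  have hm : Measurable fun z : (X × (A → unitInterval)) × A => (z.1.1, z.2, z.1.2 z.2) :=
    (measurable_fst.comp measurable_fst).prodMk (measurable_snd.prodMk
      ((measurable_eval_arm _).comp ((measurable_snd.comp measurable_fst).prodMk measurable_snd)))
  rw [sampleLaw, lintegral_map hφ hm]
  refine (Measure.lintegral_compProd (hφ.comp hm)).trans ?_
  simp only [Function.comp_apply, Kernel.comap_apply, hq.lintegral_kernel]

theorem isProbabilityMeasure_sampleLaw (D : Measure (X × (A → unitInterval)))
    [IsProbabilityMeasure D] {q : X → A → ℝ} (hq : IsPolicy q) :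
    IsProbabilityMeasure (sampleLaw D hq.kernel) := by
  refine ⟨?_⟩
  rw [← lintegral_one, lintegral_sampleLaw D hq measurable_const]
  have : ∀ x, ∑ a, ENNReal.ofReal (q x a) = 1 := fun x => by
    rw [← ENNReal.ofReal_sum_of_nonneg fun a _ => hq.nonneg x a, hq.sum_eq_one,
      ENNReal.ofReal_one]
  simp [this]

theorem sqRisk_kernel (D : Measure (X × (A → unitInterval))) (fstar f : Model X A)
    {q : X → A → ℝ} (hq : IsPolicy q) :
    sqRisk D fstar hq.kernel f = ∫ x, ∑ a, q x a * ((f x a : ℝ) - fstar x a) ^ 2 ∂D.fst := by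
  simp only [sqRisk, hq.integral_kernel]

end Measurability

/-! ### Truncated histories: the past as a point of path space. -/

section Truncation

variable {X A : Type*}

/-- The history `h` up to time `t - 1`, padded with `o`. -/
def trunc (o : Obs X A) (t : ℕ) (h : ℕ → Obs X A) : ℕ → Obs X A :=
  fun s => if 1 ≤ s ∧ s < t then h s else o

theorem measurable_trunc [MeasurableSpace X] [MeasurableSpace A] (o : Obs X A) (t : ℕ) :
    Measurable (trunc o t) := by
  refine measurable_pi_lambda _ fun s => ?_
  unfold trunc
  split_ifs
  · exact measurable_pi_apply s
  · exact measurable_const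

theorem trunc_apply {o : Obs X A} {t s : ℕ} (h : ℕ → Obs X A) (h1 : 1 ≤ s) (h2 : s < t) :
    trunc o t h s = h s := by simp [trunc, h1, h2]

theorem trunc_trunc {o : Obs X A} {s t : ℕ} (hst : s ≤ t) (h : ℕ → Obs X A) :
    trunc o s (trunc o t h) = trunc o s h := by
  ext1 u
  unfold trunc
  split_ifs <;> first | rfl | omega

variable {alg : ModIGW X A} {h h' : ℕ → Obs X A} {m t : ℕ}

theorem data_trunc (o : Obs X A) (ht : epochEnd alg.τ₁ m < t) :
    alg.data (trunc o t h) m = alg.data h m := by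
  ext1 k
  refine trunc_apply _ (by omega) ?_
  have := epochEnd_add_epochLen (τ₁ := alg.τ₁) m
  omega

theorem fhat_trunc (o : Obs X A) (ht : epochEnd alg.τ₁ (m - 1) < t) :
    alg.fhat (trunc o t h) m = alg.fhat h m := by
  rcases m with _ | _ | m
  · rfl
  · rfl
  · simp only [ModIGW.fhat]
    rw [data_trunc (m := m + 1) o ht]

theorem indexSet_trunc (o : Obs X A) (ht : epochEnd alg.τ₁ (m - 1) < t) :
    alg.indexSet (trunc o t h) m = alg.indexSet h m := by
  induction m using Nat.strong_induction_on with
  | _ m ih =>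
    rcases m with _ | _ | m
    · rfl
    · rfl
    · simp only [ModIGW.indexSet]
      rw [ih (m + 1) (by omega) ((epochEnd_mono (by omega)).trans_lt ht), data_trunc (m := m + 1) o ht]

/-- The action probabilities of epoch `m` use data up to the end of epoch `m - 1` only. They are
thus functions of the truncated history, which is measurable with respect to the past. -/
theorem actionProb_trunc [Fintype A] (o : Obs X A) (ht : epochEnd alg.τ₁ (m - 1) < t) :
    alg.actionProb (trunc o t h) m = alg.actionProb h m := by
  have h1 : alg.gamma (trunc o t h) m = alg.gamma h m := by
    rcases m with _ | _ | m
    · rfl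
    · rfl
    · simp only [ModIGW.gamma, ModIGW.index, indexSet_trunc o ht]
  unfold ModIGW.actionProb
  rw [h1, fhat_trunc o ht]

end Truncation

/-- The hypothesis says that `w` acts as conditional probability of `S` given `m`: the measures
`μ.restrict S` and `μ.withDensity w` agree on `m`. They therefore integrate `m`-measurable functions
alike. -/
theorem lintegral_eq_of_setLIntegral_eq {Ω : Type*} {m m0 : MeasurableSpace Ω} (hm : m ≤ m0)
    {μ : Measure Ω} {S : Set Ω} (hS : MeasurableSet S) {w : Ω → ℝ≥0∞} (hw : Measurable w)
    (h : ∀ s, MeasurableSet[m] s → μ (s ∩ S) = ∫⁻ ω in s, w ω ∂μ) {G : Ω → ℝ≥0∞}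
    (hG : Measurable[m] G) :
    ∫⁻ ω, S.indicator G ω ∂μ = ∫⁻ ω, w ω * G ω ∂μ := by
  have h1 : (μ.restrict S).trim hm = (μ.withDensity w).trim hm := by
    refine @Measure.ext _ m _ _ fun s hs => ?_
    rw [trim_measurableSet_eq hm hs, trim_measurableSet_eq hm hs,
      Measure.restrict_apply (hm _ hs), withDensity_apply _ (hm _ hs), h s hs]
  rw [lintegral_indicator hS, ← lintegral_trim hm hG, h1, lintegral_trim hm hG,
    lintegral_withDensity_eq_lintegral_mul _ hw (hG.mono hm le_rfl)]
  rfl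

/-! ### Conditional law of a single observation and of the data of an epoch. -/

variable {X A Ω : Type*} [MeasurableSpace X] [MeasurableSpace A] [Fintype A]
  [MeasurableSingletonClass A] [MeasurableSpace Ω]
  {D : Measure (X × (A → unitInterval))} {alg : ModIGW X A}
  {μ : Measure Ω} {x : ℕ → Ω → X} {r : ℕ → Ω → A → unitInterval} {a : ℕ → Ω → A}

theorem IsRun.measurable_obs (hrun : IsRun D alg μ x r a) (t : ℕ) :
    Measurable fun ω => obs x r a ω t :=
  (hrun.x_meas t).prodMk ((hrun.a_meas t).prodMk
    ((measurable_eval_arm _).comp ((hrun.r_meas t).prodMk (hrun.a_meas t))))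

theorem IsRun.measurable_history (hrun : IsRun D alg μ x r a) :
    Measurable fun ω => obs x r a ω :=
  measurable_pi_lambda _ hrun.measurable_obs

theorem IsRun.past_le (hrun : IsRun D alg μ x r a) (t : ℕ) : past x r a t ≤ ‹MeasurableSpace Ω› :=
  iSup₂_le fun s _ => Measurable.comap_le
    ((hrun.x_meas s).prodMk ((hrun.r_meas s).prodMk (hrun.a_meas s)))

theorem IsRun.current_le (hrun : IsRun D alg μ x r a) (t : ℕ) :
    current x r t ≤ ‹MeasurableSpace Ω› :=
  Measurable.comap_le ((hrun.x_meas t).prodMk (hrun.r_meas t))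

theorem measurable_trunc_past (x : ℕ → Ω → X) (r : ℕ → Ω → A → unitInterval) (a : ℕ → Ω → A)
    (o : Obs X A) (t : ℕ) :
    Measurable[past x r a t] fun ω => trunc o t (obs x r a ω) := by
  refine @measurable_pi_lambda _ _ _ (past x r a t) _ _ fun s => ?_
  by_cases hs : 1 ≤ s ∧ s < t
  · have h1 : Measurable[past x r a t] fun ω => (x s ω, r s ω, a s ω) := by
      refine Measurable.mono (comap_measurable _) ?_ le_rfl
      exact le_iSup₂_of_le s (Finset.mem_Ico.2 hs) le_rfl
    have h2 : Measurable fun z : X × (A → unitInterval) × A => (z.1, z.2.2, z.2.1 z.2.2) :=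
      measurable_fst.prodMk ((measurable_snd.comp measurable_snd).prodMk
        ((measurable_eval_arm _).comp measurable_snd))
    have h3 : (fun ω => trunc o t (obs x r a ω) s) =
        (fun z : X × (A → unitInterval) × A => (z.1, z.2.2, z.2.1 z.2.2)) ∘
          fun ω => (x s ω, r s ω, a s ω) := by
      ext1 ω; simp [trunc, hs, obs]
    rw [h3]
    exact h2.comp h1
  · have h3 : (fun ω => trunc o t (obs x r a ω) s) = fun _ => o := by
      ext1 ω; simp only [trunc, if_neg hs]
    rw [h3]
    exact measurable_const

/-- Given the past, the observation of round `t` is drawn from `D` and the action probabilities. -/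
theorem IsRun.lintegral_obs [IsProbabilityMeasure D] [IsProbabilityMeasure μ]
    (hrun : IsRun D alg μ x r a) (hreg : alg.Regular) (hτ : 1 ≤ alg.τ₁) (o : Obs X A) {t : ℕ}
    (ht : 1 ≤ t) {φ : (ℕ → Obs X A) × Obs X A → ℝ≥0∞} (hφ : Measurable φ) :
    ∫⁻ ω, φ (trunc o t (obs x r a ω), obs x r a ω t) ∂μ =
      ∫⁻ ω, ∫⁻ y, ∑ b, ENNReal.ofReal
        (alg.actionProb (trunc o t (obs x r a ω)) (epochOf alg.τ₁ t) y.1 b) *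
          φ (trunc o t (obs x r a ω), (y.1, b, y.2 b)) ∂D ∂μ := by
  set Z : Ω → ℕ → Obs X A := fun ω => trunc o t (obs x r a ω) with hZdef
  set Y : Ω → X × (A → unitInterval) := fun ω => (x t ω, r t ω) with hYdef
  have hZp : Measurable[past x r a t] Z := measurable_trunc_past x r a o t
  have hZ : Measurable Z := hZp.mono (hrun.past_le t) le_rfl
  have hYc : Measurable[current x r t] Y := comap_measurable _
  have hY : Measurable Y := (hrun.x_meas t).prodMk (hrun.r_meas t)
  have hsup : past x r a t ⊔ current x r t ≤ ‹MeasurableSpace Ω› :=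
    sup_le (hrun.past_le t) (hrun.current_le t)
  have hZY : Measurable[past x r a t ⊔ current x r t] fun ω => (Z ω, Y ω) :=
    (hZp.mono le_sup_left le_rfl).prodMk (hYc.mono le_sup_right le_rfl)
  set m := epochOf alg.τ₁ t with hm
  have hap : ∀ ω, alg.actionProb (obs x r a ω) m = alg.actionProb (Z ω) m := fun ω =>
    (actionProb_trunc o (epochEnd_epochOf_lt hτ ht)).symm
  have hψ : ∀ b, Measurable fun z : (ℕ → Obs X A) × X × (A → unitInterval) =>
      φ (z.1, (z.2.1, b, z.2.2 b)) := fun b =>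
    hφ.comp (measurable_fst.prodMk ((measurable_fst.comp measurable_snd).prodMk
      (measurable_const.prodMk ((measurable_pi_apply b).comp
        (measurable_snd.comp measurable_snd)))))
  have hw : ∀ b, Measurable fun z : (ℕ → Obs X A) × X × (A → unitInterval) =>
      ENNReal.ofReal (alg.actionProb z.1 m z.2.1 b) := fun b =>
    (measurable_actionProb_comp hreg m b measurable_fst
      (measurable_fst.comp measurable_snd)).ennreal_ofReal
  have hab : ∀ b, MeasurableSet (a t ⁻¹' {b}) := fun b =>
    hrun.a_meas t (measurableSet_singleton b)
  -- The action rule: given the past and the current context and rewards, the event `a_t = b` may be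
  -- replaced by its action probability.
  have step1 : ∀ b, ∫⁻ ω, (a t ⁻¹' {b}).indicator
      (fun ω => φ (Z ω, ((Y ω).1, b, (Y ω).2 b))) ω ∂μ =
      ∫⁻ ω, ENNReal.ofReal (alg.actionProb (Z ω) m (Y ω).1 b) *
        φ (Z ω, ((Y ω).1, b, (Y ω).2 b)) ∂μ := by
    intro b
    refine lintegral_eq_of_setLIntegral_eq (w := fun ω =>
      ENNReal.ofReal (alg.actionProb (Z ω) m (Y ω).1 b)) hsup (hab b)
      (measurable_actionProb_comp hreg m b hZ (measurable_fst.comp hY)).ennreal_ofReal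
      (fun s hs => ?_) ((hψ b).comp hZY)
    have hpnn : ∀ ω, 0 ≤ alg.actionProb (Z ω) m (Y ω).1 b := fun ω =>
      (isPolicy_actionProb hreg (Z ω) m).nonneg _ _
    have hpm : Measurable fun ω => alg.actionProb (Z ω) m (Y ω).1 b :=
      measurable_actionProb_comp hreg m b hZ (measurable_fst.comp hY)
    have hpint : Integrable (fun ω => alg.actionProb (Z ω) m (Y ω).1 b) μ :=
      Integrable.of_mem_Icc 0 1 hpm.aemeasurable (ae_of_all _ fun ω =>
        ⟨hpnn ω, (isPolicy_actionProb hreg (Z ω) m).le_one _ _⟩)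
    have hind : Integrable ((a t ⁻¹' {b}).indicator fun _ => (1 : ℝ)) μ :=
      (integrable_const 1).indicator (hab b)
    have h1 := setIntegral_condExp hsup hind hs
    have h2 : ∫ ω in s, (μ[(a t ⁻¹' {b}).indicator (fun _ => (1 : ℝ)) |
        past x r a t ⊔ current x r t]) ω ∂μ =
        ∫ ω in s, alg.actionProb (Z ω) m (Y ω).1 b ∂μ := by
      refine integral_congr_ae (ae_restrict_of_ae ((hrun.action t ht b).trans ?_))
      exact ae_of_all _ fun ω => congrFun (congrFun (hap ω) _) _
    rw [h2, setIntegral_indicator (hab b), setIntegral_const, smul_eq_mul, mul_one] at h1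
    rw [← ofReal_integral_eq_lintegral_ofReal hpint.integrableOn (ae_of_all _ hpnn), h1,
      Measure.real, ENNReal.ofReal_toReal (measure_ne_top _ _)]
  have step2 : ∀ ω, φ (Z ω, obs x r a ω t) = ∑ b, (a t ⁻¹' {b}).indicator
      (fun ω => φ (Z ω, ((Y ω).1, b, (Y ω).2 b))) ω := by
    intro ω
    rw [Finset.sum_eq_single (a t ω)]
    · rw [Set.indicator_of_mem (by simp)]
      rfl
    · intro b _ hb
      exact Set.indicator_of_notMem (by simpa using hb.symm) _
    · simp
  have hΨ : Measurable fun z : (ℕ → Obs X A) × X × (A → unitInterval) =>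
      ∑ b, ENNReal.ofReal (alg.actionProb z.1 m z.2.1 b) * φ (z.1, (z.2.1, b, z.2.2 b)) :=
    Finset.measurable_sum _ fun b _ => (hw b).mul (hψ b)
  -- Once the action is integrated out only past `Z` and current draw `Y` remain. By independence
  -- their joint law is a product, and `Y` has law `D`.
  have hindep : IndepFun Z Y μ := by
    rw [IndepFun_iff_Indep]
    exact indep_of_indep_of_le_left (indep_of_indep_of_le_right (hrun.indep t ht).symm
      hYc.comap_le) hZp.comap_le
  have hlaw : μ.map Y = D := hrun.law t ht
  have hψ' : ∀ b, Measurable fun ω => φ (Z ω, ((Y ω).1, b, (Y ω).2 b)) := fun b =>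
    (hψ b).comp (hZ.prodMk hY)
  have hw' : ∀ b, Measurable fun ω => ENNReal.ofReal (alg.actionProb (Z ω) m (Y ω).1 b) :=
    fun b => (measurable_actionProb_comp hreg m b hZ (measurable_fst.comp hY)).ennreal_ofReal
  rw [lintegral_congr step2, lintegral_finsetSum _ fun b _ => (hψ' b).indicator (hab b)]
  rw [Finset.sum_congr rfl fun b _ => step1 b]
  have hsum := lintegral_finsetSum (μ := μ) Finset.univ (f := fun b ω =>
    ENNReal.ofReal (alg.actionProb (Z ω) m (Y ω).1 b) * φ (Z ω, ((Y ω).1, b, (Y ω).2 b)))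
    fun b _ => (hw' b).mul (hψ' b)
  rw [← hsum]
  have e1 := lintegral_map (μ := μ) (g := fun ω => (Z ω, Y ω)) hΨ (hZ.prodMk hY)
  rw [(indepFun_iff_map_prod_eq_prod_map_map hZ.aemeasurable hY.aemeasurable).1 hindep, hlaw,
    lintegral_prod _ hΨ.aemeasurable, lintegral_map hΨ.lintegral_prod_right' hZ] at e1
  exact e1.symm

theorem measurable_snoc {E S : Type*} [MeasurableSpace E] [MeasurableSpace S] {k : ℕ}
    {f : S → Fin k → E} {g : S → E} (hf : Measurable f) (hg : Measurable g) :
    Measurable fun s => (Fin.snoc (f s) (g s) : Fin (k + 1) → E) := by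
  refine measurable_pi_lambda _ fun j => ?_
  refine Fin.lastCases ?_ (fun j => ?_) j
  · simpa only [Fin.snoc_last] using hg
  · simp only [Fin.snoc_castSucc]
    exact (measurable_pi_apply j).comp hf

theorem lintegral_pi_snoc {E : Type*} [MeasurableSpace E] (ν : Measure E) [SigmaFinite ν] {k : ℕ}
    {f : (Fin (k + 1) → E) → ℝ≥0∞} (hf : Measurable f) :
    ∫⁻ v, f v ∂(Measure.pi fun _ : Fin (k + 1) => ν) =
      ∫⁻ v, ∫⁻ e, f (Fin.snoc v e) ∂ν ∂(Measure.pi fun _ : Fin k => ν) := by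
  have h := (measurePreserving_piFinSuccAbove (fun _ : Fin (k + 1) => ν) (Fin.last k)).symm
  rw [← h.lintegral_comp hf, lintegral_prod_symm]
  · refine lintegral_congr fun v => lintegral_congr fun e => ?_
    congr 1
    exact Fin.insertNth_last' e v
  · exact (hf.comp h.measurable).aemeasurable

variable {X A Ω : Type*} [MeasurableSpace X] [MeasurableSpace A] [Fintype A]
  [MeasurableSingletonClass A] [MeasurableSpace Ω]
  {D : Measure (X × (A → unitInterval))} {alg : ModIGW X A}
  {μ : Measure Ω} {x : ℕ → Ω → X} {r : ℕ → Ω → A → unitInterval} {a : ℕ → Ω → A}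

/-- Given the past of an epoch, its observations are independent samples from `D(p)`, where `p` are
the action probabilities of the epoch. -/
theorem IsRun.lintegral_epoch [IsProbabilityMeasure D] [IsProbabilityMeasure μ]
    (hrun : IsRun D alg μ x r a) (hreg : alg.Regular) (hτ : 1 ≤ alg.τ₁) (o : Obs X A) (l : ℕ)
    {k : ℕ} (hk : k ≤ epochLen alg.τ₁ l)
    {φ : (ℕ → Obs X A) × (Fin k → Obs X A) → ℝ≥0∞} (hφ : Measurable φ) :
    ∫⁻ ω, φ (trunc o (epochEnd alg.τ₁ (l - 1) + 1) (obs x r a ω),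
        fun j => obs x r a ω (epochEnd alg.τ₁ (l - 1) + 1 + j)) ∂μ =
      ∫⁻ ω, ∫⁻ v, φ (trunc o (epochEnd alg.τ₁ (l - 1) + 1) (obs x r a ω), v)
        ∂(Measure.pi fun _ => sampleLaw D (isPolicy_actionProb hreg
          (trunc o (epochEnd alg.τ₁ (l - 1) + 1) (obs x r a ω)) l).kernel) ∂μ := by
  set s := epochEnd alg.τ₁ (l - 1) + 1 with hs
  induction k with
  | zero =>
    refine lintegral_congr fun ω => ?_
    have := isProbabilityMeasure_sampleLaw D (isPolicy_actionProb hreg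
      (trunc o s (obs x r a ω)) l)
    rw [Measure.pi_of_empty, lintegral_dirac]
    exact congrArg (fun v => φ (trunc o s (obs x r a ω), v)) (Subsingleton.elim _ _)
  | succ k ih =>
    have hlen := epochEnd_add_epochLen (τ₁ := alg.τ₁) l
    have hepoch : epochOf alg.τ₁ (s + k) = l := epochOf_eq hτ (by omega) (by omega)
    -- The induction peels off the last observation: the past of round `s + k` contains the earlier
    -- history together with the first `k` observations of the epoch, so the one-round law applies.
    have hφ' : Measurable fun z : (ℕ → Obs X A) × Obs X A =>
        φ (trunc o s z.1, Fin.snoc (fun j : Fin k => z.1 (s + j)) z.2) := by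
      refine hφ.comp (((measurable_trunc o s).comp measurable_fst).prodMk ?_)
      refine measurable_snoc ?_ measurable_snd
      exact measurable_pi_lambda _ fun j => (measurable_pi_apply _).comp measurable_fst
    have h1 := hrun.lintegral_obs hreg hτ o (t := s + k) (by omega) hφ'
    rw [hepoch] at h1
    set Φ : (ℕ → Obs X A) × (Fin k → Obs X A) → ℝ≥0∞ := fun z =>
      ∫⁻ y, ∑ b, ENNReal.ofReal (alg.actionProb z.1 l y.1 b) *
        φ (z.1, Fin.snoc z.2 (y.1, b, y.2 b)) ∂D with hΦdef
    have hΦ : Measurable Φ := by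
      refine Measurable.lintegral_prod_right' (f := fun w : ((ℕ → Obs X A) × (Fin k → Obs X A)) ×
        (X × (A → unitInterval)) => ∑ b, ENNReal.ofReal (alg.actionProb w.1.1 l w.2.1 b) *
        φ (w.1.1, Fin.snoc w.1.2 (w.2.1, b, w.2.2 b))) ?_
      refine Finset.measurable_sum _ fun b _ => Measurable.mul ?_ ?_
      · exact (measurable_actionProb_comp hreg l b (measurable_fst.comp measurable_fst)
          (measurable_fst.comp measurable_snd)).ennreal_ofReal
      · refine hφ.comp ((measurable_fst.comp measurable_fst).prodMk ?_)
        refine measurable_snoc (measurable_snd.comp measurable_fst) ?_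
        exact (measurable_fst.comp measurable_snd).prodMk (measurable_const.prodMk
          ((measurable_pi_apply b).comp (measurable_snd.comp measurable_snd)))
    have h2 := ih (by omega) hΦ
    have e1 : ∀ ω, φ (trunc o s (obs x r a ω), fun j : Fin (k + 1) => obs x r a ω (s + j)) =
        φ (trunc o s (trunc o (s + k) (obs x r a ω)),
          Fin.snoc (fun j : Fin k => trunc o (s + k) (obs x r a ω) (s + j))
            (obs x r a ω (s + k))) := by
      intro ω
      rw [trunc_trunc (by omega)]
      congr 2
      ext1 j
      refine Fin.lastCases ?_ (fun j => ?_) j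
      · simp
      · simp only [Fin.val_castSucc, Fin.snoc_castSucc]
        rw [trunc_apply _ (by omega) (by omega)]
    rw [lintegral_congr e1]
    refine h1.trans (Eq.trans ?_ (h2.trans ?_))
    · refine lintegral_congr fun ω => ?_
      simp only [hΦdef]
      rw [trunc_trunc (by omega)]
      have e2 : (fun j : Fin k => trunc o (s + k) (obs x r a ω) (s + j)) =
          fun j : Fin k => obs x r a ω (s + j) := by
        ext1 j
        exact trunc_apply _ (by omega) (by omega)
      rw [e2, actionProb_trunc o (by omega), actionProb_trunc o (by omega)]
    · refine lintegral_congr fun ω => ?_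
      have hpol := isPolicy_actionProb hreg (trunc o s (obs x r a ω)) l
      have := isProbabilityMeasure_sampleLaw D hpol
      have hφω : Measurable fun v => φ (trunc o s (obs x r a ω), v) :=
        hφ.comp measurable_prodMk_left
      rw [lintegral_pi_snoc _ hφω]
      refine lintegral_congr fun v => ?_
      have hφv : Measurable fun e => φ (trunc o s (obs x r a ω), Fin.snoc v e) :=
        hφω.comp (measurable_snoc measurable_const measurable_id)
      rw [lintegral_sampleLaw D hpol hφv]

/-! ### Concentration of the regret around its predictable part. -/

section Concentration

/-- The regret of one round. -/
def instRegret (best : (A → unitInterval) → A) (fstar : Model X A) (z : Obs X A) : ℝ :=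
  (fstar z.1 (best (fstar z.1)) : ℝ) - fstar z.1 z.2.1

/-- The expected regret of round `t`, given the past. -/
def condRegret (D : Measure (X × (A → unitInterval))) (alg : ModIGW X A) (fstar : Model X A)
    (h : ℕ → Obs X A) (t : ℕ) : ℝ :=
  gapRegret alg.best D.fst fstar (alg.actionProb h (epochOf alg.τ₁ t))

/-- The deviation of the regret from its predictable part. -/
def regretNoise (D : Measure (X × (A → unitInterval))) (alg : ModIGW X A) (fstar : Model X A)
    (h : ℕ → Obs X A) (t : ℕ) : ℝ :=
  ∑ s ∈ Finset.Icc 1 t, (instRegret alg.best fstar (h s) - condRegret D alg fstar h s)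

variable {fstar : Model X A}

theorem measurable_instRegret (hreg : alg.Regular) (hf : Measurable fstar) :
    Measurable (instRegret alg.best fstar : Obs X A → ℝ) :=
  ((measurable_best_value hreg.best_meas hf).comp measurable_fst).sub
    (measurable_subtype_coe.comp ((measurable_eval_arm _).comp
      ((hf.comp measurable_fst).prodMk (measurable_fst.comp measurable_snd))))

theorem measurable_condRegret [IsProbabilityMeasure D] (hreg : alg.Regular)
    (hf : Measurable fstar) (t : ℕ) :
    Measurable fun h => condRegret D alg fstar h t := by
  have h : Measurable fun z : (ℕ → Obs X A) × X => ∑ b,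
      alg.actionProb z.1 (epochOf alg.τ₁ t) z.2 b *
        ((fstar z.2 (alg.best (fstar z.2)) : ℝ) - fstar z.2 b) :=
    Finset.measurable_sum _ fun b _ =>
      (measurable_actionProb_comp hreg _ b measurable_fst measurable_snd).mul
        (((measurable_best_value hreg.best_meas hf).comp measurable_snd).sub
          ((measurable_model_apply hf b).comp measurable_snd))
  exact (h.stronglyMeasurable.integral_prod_right' (ν := D.fst)).measurable

theorem condRegret_mem [IsProbabilityMeasure D] (hreg : alg.Regular)
    (hf : Measurable fstar) (h : ℕ → Obs X A) (t : ℕ) :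
    condRegret D alg fstar h t ∈ Set.Icc (0 : ℝ) 1 :=
  gapRegret_mem hreg.best_meas hreg.best_max hf (isPolicy_actionProb hreg h _)

theorem condRegret_trunc (hτ : 1 ≤ alg.τ₁) (o : Obs X A) (h : ℕ → Obs X A) {s t : ℕ}
    (hs : 1 ≤ s) (hst : s ≤ t) :
    condRegret D alg fstar (trunc o t h) s = condRegret D alg fstar h s := by
  unfold condRegret
  rw [actionProb_trunc o ((epochEnd_epochOf_lt hτ hs).trans_le hst)]

theorem regretNoise_trunc (hτ : 1 ≤ alg.τ₁) (o : Obs X A) (h : ℕ → Obs X A) (t : ℕ) :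
    regretNoise D alg fstar (trunc o (t + 1) h) t = regretNoise D alg fstar h t := by
  refine Finset.sum_congr rfl fun s hs => ?_
  rw [Finset.mem_Icc] at hs
  rw [condRegret_trunc hτ o h hs.1 (by omega), trunc_apply _ hs.1 (by omega)]

theorem measurable_regretNoise [IsProbabilityMeasure D] (hreg : alg.Regular)
    (hf : Measurable fstar) (t : ℕ) :
    Measurable fun h => regretNoise D alg fstar h t :=
  Finset.measurable_sum _ fun s _ =>
    ((measurable_instRegret hreg hf).comp (measurable_pi_apply s)).sub
      (measurable_condRegret hreg hf s)

/-- Convexity of `exp` on the chord between `-u` and `u`. -/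
theorem exp_mul_le_cosh_add {u d : ℝ} (hd : d ∈ Set.Icc (-1 : ℝ) 1) :
    Real.exp (u * d) ≤ Real.cosh u + d * Real.sinh u := by
  have h := convexOn_exp.2 (Set.mem_univ u) (Set.mem_univ (-u))
    (show 0 ≤ (1 + d) / 2 by linarith [hd.1]) (show 0 ≤ (1 - d) / 2 by linarith [hd.2]) (by ring)
  simp only [smul_eq_mul] at h
  have e : (1 + d) / 2 * u + (1 - d) / 2 * -u = u * d := by ring
  rw [e] at h
  rw [Real.cosh_eq, Real.sinh_eq]
  linarith

/-- Hoeffding's lemma: the centred gap has values in `[-1,1]` and mean zero, so the `sinh` term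
integrates to zero, and `cosh u ≤ exp (u²/2)`. -/
theorem integral_exp_sub_gapRegret_le {best : (A → unitInterval) → A} {ν : Measure X}
    [IsProbabilityMeasure ν] (hbest : Measurable best) (hmax : IsArgmax best)
    {f : Model X A} (hf : Measurable f) {q : X → A → ℝ} (hq : IsPolicy q) (u : ℝ) :
    ∫ x, ∑ b, q x b * Real.exp (u * (((f x (best (f x)) : ℝ) - f x b) - gapRegret best ν f q)) ∂ν
      ≤ Real.exp (u ^ 2 / 2) := by
  set G := gapRegret best ν f q with hG
  have hGm := gapRegret_mem (ν := ν) hbest hmax hf hq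
  have hgap := integrable_gap_sum (ν := ν) hbest hmax hf hq
  have hpt : ∀ x, ∑ b, q x b * Real.exp (u * (((f x (best (f x)) : ℝ) - f x b) - G)) ≤
      Real.cosh u + (∑ b, q x b * ((f x (best (f x)) : ℝ) - f x b) - G) * Real.sinh u := by
    intro x
    calc _ ≤ ∑ b, q x b * (Real.cosh u + (((f x (best (f x)) : ℝ) - f x b) - G) * Real.sinh u) := by
          refine Finset.sum_le_sum fun b _ => mul_le_mul_of_nonneg_left
            (exp_mul_le_cosh_add ?_) (hq.nonneg x b)
          have h1 : (f x b : ℝ) ≤ f x (best (f x)) := hmax (f x) b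
          have h2 := (f x (best (f x))).2.2
          have h3 := (f x b).2.1
          exact ⟨by linarith [hGm.2], by linarith [hGm.1]⟩
      _ = ∑ b, (q x b * (Real.cosh u - G * Real.sinh u) +
            q x b * ((f x (best (f x)) : ℝ) - f x b) * Real.sinh u) :=
          Finset.sum_congr rfl fun b _ => by ring
      _ = _ := by
          rw [Finset.sum_add_distrib, ← Finset.sum_mul, ← Finset.sum_mul, hq.sum_eq_one]
          ring
  have hint1 : Integrable (fun x =>
      (∑ b, q x b * ((f x (best (f x)) : ℝ) - f x b) - G) * Real.sinh u) ν :=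
    (hgap.sub (integrable_const _)).mul_const _
  have hint2 : Integrable (fun x => Real.cosh u +
      (∑ b, q x b * ((f x (best (f x)) : ℝ) - f x b) - G) * Real.sinh u) ν :=
    (integrable_const _).add hint1
  have h1 := integral_mono_of_nonneg (ae_of_all ν fun x => Finset.sum_nonneg fun b _ =>
    mul_nonneg (hq.nonneg x b) (Real.exp_nonneg _)) hint2 (ae_of_all ν hpt)
  refine h1.trans ?_
  rw [integral_add (integrable_const _) hint1,
    integral_mul_const, integral_sub hgap (integrable_const _)]
  have : ∫ x, ∑ b, q x b * ((f x (best (f x)) : ℝ) - f x b) ∂ν = G := rfl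
  rw [this]
  simpa using Real.cosh_le_exp_half_sq u

theorem IsRun.lintegral_exp_regretNoise_le [IsProbabilityMeasure D] [IsProbabilityMeasure μ]
    (hrun : IsRun D alg μ x r a) (hreg : alg.Regular) (hτ : 1 ≤ alg.τ₁) (hf : Measurable fstar)
    (u : ℝ) (t : ℕ) :
    ∫⁻ ω, ENNReal.ofReal (Real.exp (u * regretNoise D alg fstar (obs x r a ω) t)) ∂μ ≤
      ENNReal.ofReal (Real.exp (t * (u ^ 2 / 2))) := by
  obtain ⟨ω₀⟩ : Nonempty Ω := μ.nonempty_of_neZero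
  set o : Obs X A := obs x r a ω₀ 0
  induction t with
  | zero => simp [regretNoise]
  | succ t ih =>
    have hφ : Measurable fun z : (ℕ → Obs X A) × Obs X A =>
        ENNReal.ofReal (Real.exp (u * regretNoise D alg fstar z.1 t)) *
          ENNReal.ofReal (Real.exp (u * (instRegret alg.best fstar z.2 -
            condRegret D alg fstar z.1 (t + 1)))) := by
      have m1 : Measurable fun z : (ℕ → Obs X A) × Obs X A =>
          u * regretNoise D alg fstar z.1 t :=
        ((measurable_regretNoise hreg hf t).comp measurable_fst).const_mul u
      have m2 : Measurable fun z : (ℕ → Obs X A) × Obs X A =>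
          u * (instRegret alg.best fstar z.2 - condRegret D alg fstar z.1 (t + 1)) :=
        (((measurable_instRegret hreg hf).comp measurable_snd).sub
          ((measurable_condRegret hreg hf (t + 1)).comp measurable_fst)).const_mul u
      exact (Real.measurable_exp.comp m1).ennreal_ofReal.mul
        (Real.measurable_exp.comp m2).ennreal_ofReal
    have h1 := hrun.lintegral_obs hreg hτ o (t := t + 1) (by omega) hφ
    have e1 : ∀ ω, ENNReal.ofReal (Real.exp (u * regretNoise D alg fstar (obs x r a ω) (t + 1))) =
        ENNReal.ofReal (Real.exp (u * regretNoise D alg fstar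
            (trunc o (t + 1) (obs x r a ω)) t)) *
          ENNReal.ofReal (Real.exp (u * (instRegret alg.best fstar (obs x r a ω (t + 1)) -
            condRegret D alg fstar (trunc o (t + 1) (obs x r a ω)) (t + 1)))) := by
      intro ω
      rw [regretNoise_trunc hτ, condRegret_trunc hτ o _ (by omega) le_rfl,
        ← ENNReal.ofReal_mul (Real.exp_nonneg _), ← Real.exp_add, ← mul_add]
      congr 3
      exact Finset.sum_Icc_succ_top (by omega) _
    rw [lintegral_congr e1, h1]
    have h2 : ∀ ω, ∫⁻ y, ∑ b, ENNReal.ofReal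
        (alg.actionProb (trunc o (t + 1) (obs x r a ω)) (epochOf alg.τ₁ (t + 1)) y.1 b) *
        (ENNReal.ofReal (Real.exp (u * regretNoise D alg fstar
            (trunc o (t + 1) (obs x r a ω)) t)) *
          ENNReal.ofReal (Real.exp (u * (instRegret alg.best fstar (y.1, b, y.2 b) -
            condRegret D alg fstar (trunc o (t + 1) (obs x r a ω)) (t + 1))))) ∂D ≤
        ENNReal.ofReal (Real.exp (u * regretNoise D alg fstar (obs x r a ω) t)) *
          ENNReal.ofReal (Real.exp (u ^ 2 / 2)) := by
      intro ω
      rw [regretNoise_trunc hτ]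
      set z := trunc o (t + 1) (obs x r a ω) with hz
      have hq := isPolicy_actionProb hreg z (epochOf alg.τ₁ (t + 1))
      set c := ENNReal.ofReal (Real.exp (u * regretNoise D alg fstar (obs x r a ω) t))
      set g : X → ℝ := fun y => ∑ b, alg.actionProb z (epochOf alg.τ₁ (t + 1)) y b *
        Real.exp (u * (((fstar y (alg.best (fstar y)) : ℝ) - fstar y b) -
          condRegret D alg fstar z (t + 1))) with hg
      have hg0 : ∀ y, 0 ≤ g y := fun y => Finset.sum_nonneg fun b _ =>
        mul_nonneg (hq.nonneg y b) (Real.exp_nonneg _)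
      have hgm : Measurable g := Finset.measurable_sum _ fun b _ => (hq.meas b).mul
        (Real.measurable_exp.comp ((((measurable_best_value hreg.best_meas hf).sub
          (measurable_model_apply hf b)).sub_const _).const_mul u))
      have hgb : ∀ y, g y ≤ Real.exp |u| := by
        intro y
        rw [← one_mul (Real.exp _), ← hq.sum_eq_one y, Finset.sum_mul]
        refine Finset.sum_le_sum fun b _ => mul_le_mul_of_nonneg_left
          (Real.exp_le_exp.2 ?_) (hq.nonneg y b)
        refine (le_abs_self _).trans ?_
        rw [abs_mul]
        refine mul_le_of_le_one_right (abs_nonneg u) ?_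
        have h1 : (fstar y b : ℝ) ≤ fstar y (alg.best (fstar y)) := hreg.best_max (fstar y) b
        have h2 := (fstar y (alg.best (fstar y))).2.2
        have h3 := (fstar y b).2.1
        obtain ⟨h4, h5⟩ := condRegret_mem (D := D) hreg hf z (t + 1)
        exact abs_le.2 ⟨by linarith, by linarith⟩
      have e2 : ∀ y : X × (A → unitInterval), ∑ b, ENNReal.ofReal
          (alg.actionProb z (epochOf alg.τ₁ (t + 1)) y.1 b) * (c *
          ENNReal.ofReal (Real.exp (u * (instRegret alg.best fstar (y.1, b, y.2 b) -
            condRegret D alg fstar z (t + 1))))) = c * ENNReal.ofReal (g y.1) := by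
        intro y
        rw [hg, ENNReal.ofReal_sum_of_nonneg fun b _ =>
          mul_nonneg (hq.nonneg y.1 b) (Real.exp_nonneg _), Finset.mul_sum]
        refine Finset.sum_congr rfl fun b _ => ?_
        rw [ENNReal.ofReal_mul (hq.nonneg y.1 b)]
        simp only [instRegret]
        ring
      rw [lintegral_congr e2, lintegral_const_mul c
        (f := fun y : X × (A → unitInterval) => ENNReal.ofReal (g y.1))
        (hgm.comp measurable_fst).ennreal_ofReal]
      gcongr
      have e3 : ∫⁻ y, ENNReal.ofReal (g y.1) ∂D = ∫⁻ y, ENNReal.ofReal (g y) ∂D.fst := by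
        rw [Measure.fst, lintegral_map hgm.ennreal_ofReal measurable_fst]
      rw [e3, ← ofReal_integral_eq_lintegral_ofReal
        (Integrable.of_mem_Icc 0 _ hgm.aemeasurable (ae_of_all _ fun y => ⟨hg0 y, hgb y⟩))
        (ae_of_all _ hg0)]
      exact ENNReal.ofReal_le_ofReal
        (integral_exp_sub_gapRegret_le hreg.best_meas hreg.best_max hf hq u)
    refine (lintegral_mono h2).trans ?_
    rw [lintegral_mul_const' _ _ ENNReal.ofReal_ne_top]
    calc _ ≤ ENNReal.ofReal (Real.exp (t * (u ^ 2 / 2))) * ENNReal.ofReal (Real.exp (u ^ 2 / 2)) :=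
          by gcongr
      _ = _ := by
          rw [← ENNReal.ofReal_mul (Real.exp_nonneg _), ← Real.exp_add]
          congr 2
          push_cast
          ring

/-- Azuma's inequality for the regret. -/
theorem IsRun.measure_regretNoise_ge_le [IsProbabilityMeasure D] [IsProbabilityMeasure μ]
    (hrun : IsRun D alg μ x r a) (hreg : alg.Regular) (hτ : 1 ≤ alg.τ₁) (hf : Measurable fstar)
    {t : ℕ} (ht : 1 ≤ t) {L : ℝ} (hL : 0 ≤ L) :
    μ {ω | √(2 * t * L) ≤ regretNoise D alg fstar (obs x r a ω) t} ≤
      ENNReal.ofReal (Real.exp (-L)) := by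
  -- The optimal Chernoff parameter: the threshold contributes `2L` and the moment bound `L`,
  -- leaving `exp (-L)`.
  set u := √(2 * L / t) with hu
  have ht0 : (0 : ℝ) < t := by exact_mod_cast ht
  have hu2 : u ^ 2 = 2 * L / t := Real.sq_sqrt (by positivity)
  have huv : u * √(2 * t * L) = 2 * L := by
    rw [hu, ← Real.sqrt_mul (by positivity)]
    have : 2 * L / t * (2 * t * L) = (2 * L) ^ 2 := by field_simp
    rw [this, Real.sqrt_sq (by positivity)]
  have hmeas : Measurable fun ω =>
      ENNReal.ofReal (Real.exp (u * regretNoise D alg fstar (obs x r a ω) t)) :=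
    (Real.measurable_exp.comp (((measurable_regretNoise hreg hf t).comp
      hrun.measurable_history).const_mul u)).ennreal_ofReal
  have h1 := mul_meas_ge_le_lintegral (μ := μ) hmeas (ENNReal.ofReal (Real.exp (2 * L)))
  have h2 := h1.trans (hrun.lintegral_exp_regretNoise_le hreg hτ hf u t)
  have h3 : (t : ℝ) * (u ^ 2 / 2) = L := by rw [hu2]; field_simp
  rw [h3] at h2
  have hsub : {ω | √(2 * t * L) ≤ regretNoise D alg fstar (obs x r a ω) t} ⊆
      {ω | ENNReal.ofReal (Real.exp (2 * L)) ≤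
        ENNReal.ofReal (Real.exp (u * regretNoise D alg fstar (obs x r a ω) t))} := by
    intro ω hω
    refine ENNReal.ofReal_le_ofReal (Real.exp_le_exp.2 ?_)
    rw [← huv]
    exact mul_le_mul_of_nonneg_left hω (Real.sqrt_nonneg _)
  refine (measure_mono hsub).trans ?_
  have h4 : ENNReal.ofReal (Real.exp (-L)) =
      ENNReal.ofReal (Real.exp L) / ENNReal.ofReal (Real.exp (2 * L)) := by
    rw [← ENNReal.ofReal_div_of_pos (Real.exp_pos _), ← Real.exp_sub]
    congr 2; ring
  rw [h4, ENNReal.le_div_iff_mul_le (Or.inl (by simp [Real.exp_pos])) (Or.inl ENNReal.ofReal_ne_top),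
    mul_comm]
  exact h2

end Concentration

theorem measure_compl_le_of_ofReal_one_sub_le {Ω : Type*} [MeasurableSpace Ω] {μ : Measure Ω}
    [IsProbabilityMeasure μ] {s : Set Ω} (hs : MeasurableSet s) {ζ : ℝ}
    (h : ENNReal.ofReal (1 - ζ) ≤ μ s) : μ sᶜ ≤ ENNReal.ofReal ζ := by
  rw [prob_compl_eq_one_sub hs]
  refine (tsub_le_tsub_left h 1).trans ?_
  rw [tsub_le_iff_right, ← ENNReal.ofReal_one]
  refine le_trans (ENNReal.ofReal_le_ofReal (by linarith)) ENNReal.ofReal_add_le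

/-! ### Comparison of the misspecification under one kernel with the worst case. -/

section Misspecification

variable {X A : Type*} [MeasurableSpace X] [MeasurableSpace A]
  {D : Measure (X × (A → unitInterval))} [IsProbabilityMeasure D] {fstar : Model X A}

theorem sq_sub_unitInterval_le_one (u v : unitInterval) : ((u : ℝ) - v) ^ 2 ≤ 1 := by
  have h1 := u.2.1
  have h2 := u.2.2
  have h3 := v.2.1
  have h4 := v.2.2
  nlinarith

theorem sqRisk_le_one (p : Kernel X A) [IsMarkovKernel p] (f : Model X A) :
    sqRisk D fstar p f ≤ 1 := by
  have h1 : ∀ x, ‖∫ a, ((f x a : ℝ) - fstar x a) ^ 2 ∂(p x)‖ ≤ 1 := fun x => by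
    have := norm_integral_le_of_norm_le_const (μ := p x) (C := 1)
      (f := fun a => ((f x a : ℝ) - fstar x a) ^ 2) (ae_of_all _ fun a => by
        rw [Real.norm_of_nonneg (sq_nonneg _)]
        exact sq_sub_unitInterval_le_one _ _)
    simpa using this
  have h2 := norm_integral_le_of_norm_le_const (μ := D.fst) (C := 1) (ae_of_all _ h1)
  exact (le_abs_self _).trans (by simpa [sqRisk] using h2)

theorem misspec_le_maxMisspec (F : Set (Model X A)) (p : Kernel X A) [IsMarkovKernel p] :
    misspec D fstar F p ≤ maxMisspec D fstar F := by
  refine le_ciSup (f := fun p : {p : Kernel X A // IsMarkovKernel p} => misspec D fstar F p)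
    ⟨1, ?_⟩ ⟨p, inferInstance⟩
  rintro _ ⟨⟨p, hp⟩, rfl⟩
  -- For an empty class the infimum is `0` by convention, so the uniform bound `1` needed for the
  -- supremum still holds.
  rcases isEmpty_or_nonempty F with hF | ⟨⟨f⟩⟩
  · simp [misspec]
  · refine (ciInf_le ⟨0, ?_⟩ f).trans (sqRisk_le_one p f.1)
    rintro _ ⟨g, rfl⟩
    exact integral_nonneg fun x => integral_nonneg fun a => sq_nonneg _

end Misspecification

/-! ### The event on which all estimates, tests and deviations behave. -/

section GoodEvent

variable {X A Ω : Type*} [MeasurableSpace X] [MeasurableSpace A] [Fintype A]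

/-- The estimate computed after epoch `l` is accurate. -/
def EpochAccurate (D : Measure (X × (A → unitInterval))) (fstar : Model X A)
    (F : ℕ → Set (Model X A)) (alg : ModIGW X A) (C₀ : ℝ) (h : ℕ → Obs X A) (l : ℕ) : Prop :=
  ∀ j ∈ Finset.Icc 1 alg.M,
    ∫ x, ∑ b, alg.actionProb h l x b *
      ((alg.est alg.M _ (alg.data h l) x b : ℝ) - fstar x b) ^ 2 ∂D.fst ≤
        C₀ * maxMisspec D fstar (F j) + alg.xi j (epochLen alg.τ₁ l) (alg.level l)

/-- The misspecification test of class `i` after epoch `l` answers correctly. -/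
def TestCorrect (D : Measure (X × (A → unitInterval))) (fstar : Model X A)
    (F : ℕ → Set (Model X A)) (alg : ModIGW X A) (C₀ : ℝ) (β' β : ℕ → ℝ≥0∞)
    (h : ℕ → Obs X A) (i l : ℕ) : Prop :=
  ((epochEnd alg.τ₁ l : ℝ≥0∞) ≤ β' i * safeRounds D fstar F alg C₀ i →
    alg.mt i _ (alg.data h l) (alg.level l) = false) ∧
  (β i < (epochEnd alg.τ₁ l : ℝ≥0∞) → alg.mt i _ (alg.data h l) (alg.level l) = true)

/-- All the estimates and tests of a run succeed, and its regret concentrates. -/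
def GoodHistory (D : Measure (X × (A → unitInterval))) (fstar : Model X A)
    (F : ℕ → Set (Model X A)) (alg : ModIGW X A) (C₀ : ℝ) (β' β : ℕ → ℝ≥0∞)
    (h : ℕ → Obs X A) : Prop :=
  ∀ n : ℕ, 1 ≤ n → EpochAccurate D fstar F alg C₀ h n ∧
    (∀ i ∈ Finset.Icc 1 alg.M, TestCorrect D fstar F alg C₀ β' β h i n) ∧
    regretNoise D alg fstar h n < √(2 * n * Real.log (12 * n ^ 2 / alg.δ))

variable [MeasurableSingletonClass A] [MeasurableSpace Ω]
  {D : Measure (X × (A → unitInterval))} {alg : ModIGW X A} {fstar : Model X A}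
  {F : ℕ → Set (Model X A)} {C₀ : ℝ} {β' β : ℕ → ℝ≥0∞}
  {μ : Measure Ω} {x : ℕ → Ω → X} {r : ℕ → Ω → A → unitInterval} {a : ℕ → Ω → A}

theorem IsRun.measure_not_epochAccurate_le [IsProbabilityMeasure D] [IsProbabilityMeasure μ]
    (hrun : IsRun D alg μ x r a) (hreg : alg.Regular) (hτ : 2 ≤ alg.τ₁) (hf : Measurable fstar)
    (hM : 1 ≤ alg.M) (hδ0 : 0 < alg.δ) (hδ1 : alg.δ < 1) (hC₀ : 0 ≤ C₀)
    (horacle : EstimationOracle D fstar F alg C₀) {l : ℕ} (hl : 1 ≤ l) :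
    μ {ω | ¬ EpochAccurate D fstar F alg C₀ (obs x r a ω) l} ≤
      ENNReal.ofReal (alg.δ / (4 * l ^ 2)) := by
  obtain ⟨ω₀⟩ : Nonempty Ω := μ.nonempty_of_neZero
  set o : Obs X A := obs x r a ω₀ 0
  set s := epochEnd alg.τ₁ (l - 1) + 1 with hs
  set n := epochLen alg.τ₁ l with hn
  have hl1 : (1 : ℝ) ≤ (l : ℝ) ^ 2 := one_le_pow₀ (by exact_mod_cast hl)
  have hζ : alg.δ / (4 * (l : ℝ) ^ 2) ∈ Set.Ioo (0 : ℝ) 1 := by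
    refine ⟨by positivity, ?_⟩
    rw [div_lt_one (by positivity)]
    linarith
  -- Oracle `M` at confidence `ζ` has rates at level `ζ/M`, so `ζ = δ/(4l²)` matches the level used
  -- by the algorithm.
  have hlevel : alg.δ / (4 * (l : ℝ) ^ 2) / alg.M = alg.level l := by
    rw [ModIGW.level, div_div]
    congr 1; ring
  have hn2 : 2 ≤ n := by
    rcases l with _ | _ | l
    · omega
    · rw [hn, epochLen_one]; exact hτ
    · rw [hn, epochLen_add_two]
      have := epochEnd_mono (τ₁ := alg.τ₁) (show 1 ≤ l + 1 by omega)
      rw [epochEnd_one] at this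
      omega
  set risk : (ℕ → Obs X A) × (Fin n → Obs X A) → ℝ := fun z =>
    ∫ x, ∑ b, alg.actionProb z.1 l x b * ((alg.est alg.M n z.2 x b : ℝ) - fstar x b) ^ 2 ∂D.fst
    with hrisk
  have hriskm : Measurable risk := by
    have h : Measurable fun w : ((ℕ → Obs X A) × (Fin n → Obs X A)) × X =>
        ∑ b, alg.actionProb w.1.1 l w.2 b *
          ((alg.est alg.M n w.1.2 w.2 b : ℝ) - fstar w.2 b) ^ 2 := by
      refine Finset.measurable_sum _ fun b _ => ?_
      have h1 := measurable_actionProb_comp hreg l b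
        (S := ((ℕ → Obs X A) × (Fin n → Obs X A)) × X)
        (measurable_fst.comp measurable_fst) measurable_snd
      have h2 : Measurable fun w : ((ℕ → Obs X A) × (Fin n → Obs X A)) × X =>
          (alg.est alg.M n w.1.2 w.2 b : ℝ) :=
        measurable_subtype_coe.comp ((measurable_pi_apply b).comp ((measurable_est_model hreg _ _).comp
          ((measurable_snd.comp measurable_fst).prodMk measurable_snd)))
      have h3 : Measurable fun w : ((ℕ → Obs X A) × (Fin n → Obs X A)) × X =>
          (fstar w.2 b : ℝ) := (measurable_model_apply hf b).comp measurable_snd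
      exact h1.mul ((h2.sub h3).pow_const 2)
    exact (h.stronglyMeasurable.integral_prod_right' (ν := D.fst)).measurable
  set G : Set ((ℕ → Obs X A) × (Fin n → Obs X A)) := {z | ∀ j ∈ Finset.Icc 1 alg.M,
    risk z ≤ C₀ * maxMisspec D fstar (F j) + alg.xi j n (alg.level l)} with hG
  have hGm : MeasurableSet G := by
    have : G = ⋂ j ∈ Finset.Icc 1 alg.M,
        {z | risk z ≤ C₀ * maxMisspec D fstar (F j) + alg.xi j n (alg.level l)} := by
      ext z; simp [hG]
    rw [this]
    exact Finset.measurableSet_biInter _ fun j _ => measurableSet_le hriskm measurable_const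
  -- Accuracy is a property of the history before the epoch, which fixes the policy, and of the data
  -- of the epoch; this allows conditioning on the former.
  have hbad : ∀ ω, (¬ EpochAccurate D fstar F alg C₀ (obs x r a ω) l) ↔
      (trunc o s (obs x r a ω), fun j : Fin n => obs x r a ω (s + j)) ∈ Gᶜ := by
    intro ω
    rw [Set.mem_compl_iff, not_iff_not]
    simp only [hG, Set.mem_ofPred_eq, hrisk, EpochAccurate]
    rw [actionProb_trunc o (by omega)]
    rfl
  have hpair : Measurable fun ω =>
      (trunc o s (obs x r a ω), fun j : Fin n => obs x r a ω (s + j)) :=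
    ((measurable_trunc o s).comp hrun.measurable_history).prodMk
      (measurable_pi_lambda _ fun j => hrun.measurable_obs _)
  have key := hrun.lintegral_epoch hreg (by omega) o l (k := n) le_rfl
    (φ := Gᶜ.indicator 1) (measurable_one.indicator hGm.compl)
  have e1 : μ {ω | ¬ EpochAccurate D fstar F alg C₀ (obs x r a ω) l} =
      ∫⁻ ω, Gᶜ.indicator 1 (trunc o s (obs x r a ω), fun j : Fin n => obs x r a ω (s + j)) ∂μ := by
    rw [← lintegral_indicator_one]
    · refine lintegral_congr fun ω => ?_
      by_cases h : ω ∈ {ω | ¬ EpochAccurate D fstar F alg C₀ (obs x r a ω) l}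
      · rw [Set.indicator_of_mem h, Set.indicator_of_mem ((hbad ω).1 h)]; rfl
      · rw [Set.indicator_of_notMem h, Set.indicator_of_notMem (mt (hbad ω).2 h)]
    · simp only [hbad]
      exact hpair hGm.compl
  rw [e1, key]
  have hle : ∀ ω, ∫⁻ v, Gᶜ.indicator 1 (trunc o s (obs x r a ω), v)
      ∂(Measure.pi fun _ : Fin n => sampleLaw D (isPolicy_actionProb hreg
          (trunc o s (obs x r a ω)) l).kernel) ≤ ENNReal.ofReal (alg.δ / (4 * l ^ 2)) := by
    intro ω
    set z := trunc o s (obs x r a ω)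
    have hpol := isPolicy_actionProb hreg z l
    have := isProbabilityMeasure_sampleLaw D hpol
    have := hpol.isMarkovKernel
    have hGz : MeasurableSet {v | (z, v) ∈ G} := measurable_prodMk_left hGm
    have e2 : ∫⁻ v, Gᶜ.indicator 1 (z, v) ∂(Measure.pi fun _ : Fin n => sampleLaw D hpol.kernel) =
        (Measure.pi fun _ : Fin n => sampleLaw D hpol.kernel) {v | (z, v) ∈ G}ᶜ := by
      rw [← lintegral_indicator_one hGz.compl]
      rfl
    rw [e2]
    refine measure_compl_le_of_ofReal_one_sub_le hGz ?_
    refine (horacle alg.M (Finset.mem_Icc.2 ⟨hM, le_rfl⟩) hpol.kernel hpol.isMarkovKernel n hn2 _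
      hζ).trans (measure_mono fun v hv => ?_)
    intro j hj
    have h1 := hv j hj
    rw [hlevel, sqRisk_kernel] at h1
    refine h1.trans ?_
    gcongr
    exact misspec_le_maxMisspec _ _
  refine (lintegral_mono hle).trans ?_
  simp

theorem IsRun.measure_not_testCorrect_le [IsProbabilityMeasure μ]
    (hrun : IsRun D alg μ x r a) (hreg : alg.Regular)
    (hδ0 : 0 < alg.δ) (hδ1 : alg.δ < 1)
    (htest : MisspecificationTest D fstar F alg C₀ β' β μ x r a) {i : ℕ}
    (hi : i ∈ Finset.Icc 1 alg.M) {l : ℕ} (hl : 1 ≤ l) :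
    μ {ω | ¬ TestCorrect D fstar F alg C₀ β' β (obs x r a ω) i l} ≤
      ENNReal.ofReal (alg.level l) := by
  have hl1 : (1 : ℝ) ≤ (l : ℝ) ^ 2 := one_le_pow₀ (by exact_mod_cast hl)
  have hM : (1 : ℝ) ≤ alg.M := by
    have := Finset.mem_Icc.1 hi
    exact_mod_cast this.1.trans this.2
  have hlevel : alg.level l ∈ Set.Ioo (0 : ℝ) 1 := by
    unfold ModIGW.level
    refine ⟨by positivity, ?_⟩
    rw [div_lt_one (by positivity)]
    nlinarith
  have hm : ∀ v : Bool, MeasurableSet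
      {ω | alg.mt i _ (alg.data (obs x r a ω) l) (alg.level l) = v} := fun v =>
    ((hreg.mt_meas i _ _).comp ((measurable_data alg l).comp hrun.measurable_history))
      (measurableSet_singleton v)
  by_cases h1 : (epochEnd alg.τ₁ l : ℝ≥0∞) ≤ β' i * safeRounds D fstar F alg C₀ i
  -- The gap condition on `β` ensures that at most one of the two answers is required in an epoch.
  · have h2 : ¬ β i < (epochEnd alg.τ₁ l : ℝ≥0∞) := by
      rcases htest.beta_gt i hi with h | h
      · exact not_lt.2 (h1.trans h.le)
      · simp [h]
    refine le_trans (measure_mono fun ω hω => ?_) (measure_compl_le_of_ofReal_one_sub_le (hm false)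
      (htest.answers_false i hi l hl _ hlevel h1))
    intro h
    exact hω ⟨fun _ => h, fun h' => absurd h' h2⟩
  · by_cases h2 : β i < (epochEnd alg.τ₁ l : ℝ≥0∞)
    · refine le_trans (measure_mono fun ω hω => ?_)
        (measure_compl_le_of_ofReal_one_sub_le (hm true)
          (htest.answers_true i hi l hl _ hlevel h2))
      intro h
      exact hω ⟨fun h' => absurd h' h1, fun _ => h⟩
    · have : {ω | ¬ TestCorrect D fstar F alg C₀ β' β (obs x r a ω) i l} = ∅ := by
        ext ω
        simp [TestCorrect, h1, h2]
      simp [this]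

theorem IsRun.measure_goodHistory_ge [IsProbabilityMeasure D] [IsProbabilityMeasure μ]
    (hrun : IsRun D alg μ x r a) (hreg : alg.Regular) (hτ : 2 ≤ alg.τ₁) (hf : Measurable fstar)
    (hM : 1 ≤ alg.M) (hδ0 : 0 < alg.δ) (hδ1 : alg.δ < 1) (hC₀ : 0 ≤ C₀)
    (horacle : EstimationOracle D fstar F alg C₀)
    (htest : MisspecificationTest D fstar F alg C₀ β' β μ x r a) :
    ENNReal.ofReal (1 - alg.δ) ≤
      μ {ω | GoodHistory D fstar F alg C₀ β' β (obs x r a ω)} := by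
  set bad : ℕ → Set Ω := fun n => {ω | ¬ EpochAccurate D fstar F alg C₀ (obs x r a ω) (n + 1)} ∪
    (⋃ i ∈ Finset.Icc 1 alg.M, {ω | ¬ TestCorrect D fstar F alg C₀ β' β (obs x r a ω) i (n + 1)}) ∪
    {ω | √(2 * (n + 1 : ℕ) * Real.log (12 * (n + 1 : ℕ) ^ 2 / alg.δ)) ≤
      regretNoise D alg fstar (obs x r a ω) (n + 1)} with hbad
  have hM0 : (0 : ℝ) < alg.M := by exact_mod_cast hM
  -- The share `7/12` is `1/4` for the estimate, `1/4` for the `M` tests together and `1/12` for the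
  -- noise. Summing `1/n²` gives `(7/12)(π²/6) < 1`.
  have hle : ∀ n, μ (bad n) ≤ ENNReal.ofReal (7 / 12 * alg.δ * (1 / ((n + 1 : ℕ) : ℝ) ^ 2)) := by
    intro n
    have hn : 1 ≤ n + 1 := by omega
    have hn1 : (1 : ℝ) ≤ ((n + 1 : ℕ) : ℝ) ^ 2 := one_le_pow₀ (by exact_mod_cast hn)
    have h1 := hrun.measure_not_epochAccurate_le hreg hτ hf hM hδ0 hδ1 hC₀ horacle hn
    have h2 : μ (⋃ i ∈ Finset.Icc 1 alg.M,
        {ω | ¬ TestCorrect D fstar F alg C₀ β' β (obs x r a ω) i (n + 1)}) ≤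
        ENNReal.ofReal (alg.δ / (4 * ((n + 1 : ℕ) : ℝ) ^ 2)) := by
      refine (measure_biUnion_finset_le _ _).trans ?_
      refine (Finset.sum_le_sum fun i hi =>
        hrun.measure_not_testCorrect_le hreg hδ0 hδ1 htest hi hn).trans_eq ?_
      rw [Finset.sum_const, Nat.card_Icc, Nat.add_sub_cancel, nsmul_eq_mul,
        ← ENNReal.ofReal_natCast, ← ENNReal.ofReal_mul hM0.le]
      congr 1
      unfold ModIGW.level
      field_simp
    have hL : 0 ≤ Real.log (12 * ((n + 1 : ℕ) : ℝ) ^ 2 / alg.δ) := by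
      refine Real.log_nonneg ?_
      rw [le_div_iff₀ hδ0]
      linarith
    have h3 := hrun.measure_regretNoise_ge_le hreg (by omega) hf hn hL
    have h4 : Real.exp (-Real.log (12 * ((n + 1 : ℕ) : ℝ) ^ 2 / alg.δ)) =
        alg.δ / (12 * ((n + 1 : ℕ) : ℝ) ^ 2) := by
      rw [Real.exp_neg, Real.exp_log (by positivity), inv_div]
    rw [h4] at h3
    refine (measure_union_le _ _).trans ((add_le_add ((measure_union_le _ _).trans
      (add_le_add h1 h2)) h3).trans_eq ?_)
    rw [← ENNReal.ofReal_add (by positivity) (by positivity),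
      ← ENNReal.ofReal_add (by positivity) (by positivity)]
    congr 1
    field_simp
    norm_num
  -- Dropping the index `0` from the Basel series is harmless since `1/0² = 0`.
  have hsum : HasSum (fun n : ℕ => 1 / ((n + 1 : ℕ) : ℝ) ^ 2) (Real.pi ^ 2 / 6) := by
    have := (hasSum_nat_add_iff' 1).2 hasSum_zeta_two
    simpa using this
  have hunion : μ (⋃ n, bad n) ≤ ENNReal.ofReal alg.δ := by
    refine (measure_iUnion_le _).trans ((ENNReal.tsum_le_tsum hle).trans ?_)
    rw [← ENNReal.ofReal_tsum_of_nonneg (fun n => by positivity) (hsum.summable.mul_left _),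
      tsum_mul_left, hsum.tsum_eq]
    refine ENNReal.ofReal_le_ofReal ?_
    have hpi : Real.pi ^ 2 ≤ 3.142 ^ 2 :=
      pow_le_pow_left₀ Real.pi_pos.le (Real.pi_lt_d4.le.trans (by norm_num)) 2
    have : 7 / 12 * (Real.pi ^ 2 / 6) ≤ 1 := by norm_num at hpi ⊢; linarith
    nlinarith
  have hsub : (⋃ n, bad n)ᶜ ⊆ {ω | GoodHistory D fstar F alg C₀ β' β (obs x r a ω)} := by
    intro ω hω n hn
    obtain ⟨n, rfl⟩ : ∃ k, n = k + 1 := ⟨n - 1, by omega⟩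
    simp only [Set.mem_compl_iff, Set.mem_iUnion, not_exists] at hω
    have h := hω n
    simp only [hbad, Set.mem_union, Set.mem_ofPred_eq, Set.mem_iUnion, not_or, not_exists, not_not,
      not_le] at h
    exact ⟨h.1.1, fun i hi => h.1.2 i hi, h.2⟩
  rw [ENNReal.ofReal_sub _ hδ0.le, ENNReal.ofReal_one, tsub_le_iff_right]
  calc 1 = μ ((⋃ n, bad n)ᶜ ∪ ⋃ n, bad n) := by rw [Set.compl_union_self, measure_univ]
    _ ≤ _ := (measure_union_le _ _).trans (add_le_add (measure_mono hsub) hunion)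

end GoodEvent

/-- The standing assumptions on the parameters of the algorithm. -/
structure ModIGW.ValidParams {X A : Type*} (alg : ModIGW X A) : Prop where
  one_le_M : 1 ≤ alg.M
  two_le_τ₁ : 2 ≤ alg.τ₁
  C₁_pos : 0 < alg.C₁
  δ_pos : 0 < alg.δ
  δ_lt_one : alg.δ < 1
  one_le_d : 1 ≤ alg.d 1
  d_mono : ∀ i ∈ Finset.Icc 1 alg.M, ∀ j ∈ Finset.Icc 1 alg.M, i ≤ j → alg.d i ≤ alg.d j

/-! ### Behaviour of the estimation rates along the epochs. -/

section Rates

variable {X A : Type*} {alg : ModIGW X A}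

theorem ModIGW.ValidParams.one_mem (hv : alg.ValidParams) : 1 ∈ Finset.Icc 1 alg.M :=
  Finset.mem_Icc.2 ⟨le_rfl, hv.one_le_M⟩

theorem ModIGW.ValidParams.d_one_le (hv : alg.ValidParams) {i : ℕ}
    (hi : i ∈ Finset.Icc 1 alg.M) : alg.d 1 ≤ alg.d i :=
  hv.d_mono _ hv.one_mem _ hi (Finset.mem_Icc.1 hi).1

theorem ModIGW.ValidParams.one_le_d_of_mem (hv : alg.ValidParams) {i : ℕ}
    (hi : i ∈ Finset.Icc 1 alg.M) : 1 ≤ alg.d i :=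
  hv.one_le_d.trans (hv.d_one_le hi)

/-- The estimation rate `ξ_i` of class `i` on the data of epoch `m`. -/
def ModIGW.epochRate (alg : ModIGW X A) (i m : ℕ) : ℝ :=
  alg.xi i (epochLen alg.τ₁ m) (alg.level m)

theorem epochRate_eq (alg : ModIGW X A) (i m : ℕ) :
    alg.epochRate i m = alg.d i * (alg.C₁ * Real.log (epochLen alg.τ₁ m) *
      Real.log (4 * alg.M * (m : ℝ) ^ 2 / alg.δ) / epochLen alg.τ₁ m) := by
  unfold ModIGW.epochRate ModIGW.xi rate ModIGW.level
  rw [one_div_div]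
  ring

theorem two_le_epochLen (hτ : 2 ≤ alg.τ₁) {m : ℕ} (hm : 1 ≤ m) : 2 ≤ epochLen alg.τ₁ m := by
  rcases m with _ | _ | m
  · omega
  · rw [epochLen_one]; exact hτ
  · rw [epochLen_add_two]
    have := epochEnd_mono (τ₁ := alg.τ₁) (show 1 ≤ m + 1 by omega)
    rw [epochEnd_one] at this
    omega

theorem epochLen_eq_two_pow_mul {l m : ℕ} (hl : 1 ≤ l) (hlm : l ≤ m) :
    ∃ k, epochLen alg.τ₁ m = 2 ^ k * epochLen alg.τ₁ l ∧ m ≤ l * (k + 2) := by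
  have hpos : ∀ j : ℕ, epochLen alg.τ₁ (j + 2) = 2 ^ j * alg.τ₁ := fun j => by
    rw [epochLen_add_two, epochEnd]
  rcases l with _ | _ | l
  · omega
  · rcases m with _ | _ | m
    · omega
    · exact ⟨0, by simp, by omega⟩
    · exact ⟨m, by rw [hpos, epochLen_one], by omega⟩
  · obtain ⟨k, rfl⟩ : ∃ k, m = l + k + 2 := ⟨m - l - 2, by omega⟩
    exact ⟨k, by rw [hpos, hpos, pow_add]; ring, by nlinarith⟩

/-- The two logarithms of the rate grow by at most `k + 1` and `2k + 3` while the epoch length grows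
by `2ᵏ`. -/
theorem succ_mul_le_six_mul_two_pow (k : ℕ) : (k + 1) * (2 * k + 3) ≤ 6 * 2 ^ k := by
  induction k with
  | zero => norm_num
  | succ k ih =>
    rcases k with _ | _ | k
    · norm_num
    · norm_num
    · rw [pow_succ]
      nlinarith

theorem one_le_log_level (hv : alg.ValidParams) {m : ℕ} (hm : 1 ≤ m) :
    1 ≤ Real.log (4 * alg.M * (m : ℝ) ^ 2 / alg.δ) := by
  have hM : (1 : ℝ) ≤ alg.M := by exact_mod_cast hv.one_le_M
  have hm2 : (1 : ℝ) ≤ (m : ℝ) ^ 2 := one_le_pow₀ (by exact_mod_cast hm)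
  have h4 : (4 : ℝ) ≤ 4 * alg.M * (m : ℝ) ^ 2 / alg.δ := by
    rw [le_div_iff₀ hv.δ_pos]
    nlinarith [hv.δ_lt_one, mul_le_mul hM hm2 zero_le_one (by linarith)]
  rw [Real.le_log_iff_exp_le (by linarith)]
  linarith [Real.exp_one_lt_d9]

theorem epochRate_pos (hv : alg.ValidParams) {i m : ℕ} (hi : i ∈ Finset.Icc 1 alg.M)
    (hm : 1 ≤ m) : 0 < alg.epochRate i m := by
  rw [epochRate_eq]
  have h1 := one_le_log_level hv hm
  have h2 : (2 : ℝ) ≤ epochLen alg.τ₁ m := by exact_mod_cast two_le_epochLen hv.two_le_τ₁ hm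
  have h3 : 0 < Real.log (epochLen alg.τ₁ m) := Real.log_pos (by linarith)
  have h4 : (1 : ℝ) ≤ alg.d i := by exact_mod_cast hv.one_le_d_of_mem hi
  have := hv.C₁_pos
  positivity

/-- A substitute for monotonicity: the first two epochs have equal length and the confidence level
shrinks, so the rate may increase, but by no more than a factor 6. -/
theorem epochRate_le (hv : alg.ValidParams) {i l m : ℕ} (hl : 1 ≤ l) (hlm : l ≤ m) :
    alg.epochRate i m ≤ 6 * alg.epochRate i l := by
  obtain ⟨k, hk, hmk⟩ := epochLen_eq_two_pow_mul (alg := alg) hl hlm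
  rw [epochRate_eq, epochRate_eq, hk]
  set n : ℝ := (epochLen alg.τ₁ l : ℝ) with hn
  have hn2 : 2 ≤ n := by rw [hn]; exact_mod_cast two_le_epochLen hv.two_le_τ₁ hl
  set L := Real.log (4 * alg.M * (l : ℝ) ^ 2 / alg.δ) with hL
  have hL1 : 1 ≤ L := one_le_log_level hv hl
  have hM : (1 : ℝ) ≤ alg.M := by exact_mod_cast hv.one_le_M
  have hl0 : (0 : ℝ) < l := by exact_mod_cast hl
  have hm0 : (0 : ℝ) < m := by exact_mod_cast hl.trans hlm
  have hδ := hv.δ_pos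
  have hlog2 : Real.log 2 ≤ Real.log n := Real.log_le_log (by norm_num) hn2
  have hlogn : 0 < Real.log n := Real.log_pos (by linarith)
  have h1 : Real.log ((2 ^ k * epochLen alg.τ₁ l : ℕ) : ℝ) ≤ (k + 1) * Real.log n := by
    push_cast
    rw [Real.log_mul (by positivity) (by positivity), Real.log_pow]
    nlinarith [Nat.cast_nonneg (α := ℝ) k]
  have h2 : Real.log (4 * alg.M * (m : ℝ) ^ 2 / alg.δ) ≤ (2 * k + 3) * L := by
    have hmk' : (m : ℝ) ≤ l * (k + 2) := by exact_mod_cast hmk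
    have h3 : 4 * alg.M * (m : ℝ) ^ 2 / alg.δ ≤
        (4 * alg.M * (l : ℝ) ^ 2 / alg.δ) * ((k : ℝ) + 2) ^ 2 := by
      have : (4 * alg.M * (l : ℝ) ^ 2 / alg.δ) * ((k : ℝ) + 2) ^ 2 =
          4 * alg.M * ((l : ℝ) * (k + 2)) ^ 2 / alg.δ := by ring
      rw [this]
      gcongr
    refine (Real.log_le_log (by positivity) h3).trans ?_
    rw [Real.log_mul (by positivity) (by positivity), Real.log_pow]
    have h4 := Real.log_le_sub_one_of_pos (show (0 : ℝ) < k + 2 by positivity)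
    push_cast
    nlinarith [Nat.cast_nonneg (α := ℝ) k]
  have hlog0 : 0 ≤ Real.log (4 * alg.M * (m : ℝ) ^ 2 / alg.δ) :=
    zero_le_one.trans (one_le_log_level hv (hl.trans hlm))
  have hk6 : ((k : ℝ) + 1) * (2 * k + 3) ≤ 6 * 2 ^ k := by
    exact_mod_cast succ_mul_le_six_mul_two_pow k
  have hC := hv.C₁_pos
  have h5 : alg.C₁ * Real.log ((2 ^ k * epochLen alg.τ₁ l : ℕ) : ℝ) *
      Real.log (4 * alg.M * (m : ℝ) ^ 2 / alg.δ) / ((2 ^ k * epochLen alg.τ₁ l : ℕ) : ℝ) ≤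
      6 * (alg.C₁ * Real.log n * L / n) := by
    rw [div_le_iff₀ (by push_cast; positivity)]
    have h6 : 6 * (alg.C₁ * Real.log n * L / n) * ((2 ^ k * epochLen alg.τ₁ l : ℕ) : ℝ) =
        alg.C₁ * Real.log n * L * (6 * 2 ^ k) := by
      push_cast
      rw [← hn]
      field_simp
    rw [h6]
    calc _ ≤ alg.C₁ * ((k + 1) * Real.log n) * ((2 * k + 3) * L) := by gcongr
      _ = alg.C₁ * Real.log n * L * ((k + 1) * (2 * k + 3)) := by ring
      _ ≤ _ := by gcongr
  calc _ ≤ (alg.d i : ℝ) * (6 * (alg.C₁ * Real.log n * L / n)) := by gcongr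
    _ = _ := by ring

/-- The choice `γ = √(K/(8ξ))` balances the exploration cost `K/γ` against `8γξ`: both equal
`√(8Kξ)`, by this and the next identity. -/
theorem div_sqrt_div_eight_mul {K ξ : ℝ} (hK : 0 < K) (hξ : 0 < ξ) :
    K / √(K / (8 * ξ)) = √(8 * K * ξ) := by
  rw [div_eq_iff (by positivity), ← Real.sqrt_mul (by positivity)]
  have : 8 * K * ξ * (K / (8 * ξ)) = K ^ 2 := by field_simp
  rw [this, Real.sqrt_sq hK.le]

theorem sqrt_div_eight_mul_mul {K ξ : ℝ} (hξ : 0 < ξ) :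
    √(K / (8 * ξ)) * (8 * ξ) = √(8 * K * ξ) := by
  have h : 8 * ξ = √((8 * ξ) ^ 2) := (Real.sqrt_sq (by positivity)).symm
  rw [h, ← Real.sqrt_mul' _ (by positivity), ← h]
  congr 1
  field_simp

end Rates

/-! ### Numerical comparison of the logarithmic factors. -/

section Logarithms

theorem log_three_ge : (1.039 : ℝ) ≤ Real.log 3 := by
  have h1 : Real.log 8 ≤ Real.log 9 := Real.log_le_log (by norm_num) (by norm_num)
  have h2 : Real.log 8 = 3 * Real.log 2 := by
    rw [show (8 : ℝ) = 2 ^ 3 by norm_num, Real.log_pow]; norm_num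
  have h3 : Real.log 9 = 2 * Real.log 3 := by
    rw [show (9 : ℝ) = 3 ^ 2 by norm_num, Real.log_pow]; norm_num
  linarith [Real.log_two_gt_d9]

theorem log_sixteen_le : Real.log 16 ≤ 2.773 := by
  rw [show (16 : ℝ) = 2 ^ 4 by norm_num, Real.log_pow]
  push_cast
  linarith [Real.log_two_lt_d9]

variable {T M δ : ℝ}

/-- Where `t ≥ 3` matters: `ln 3 > 1` makes `ln(M ln t / δ)` bounded away from zero, so additive
constants can be absorbed into it. -/
theorem log_log_ge (hT : 3 ≤ T) (hM : 1 ≤ M) (hδ0 : 0 < δ) (hδ1 : δ < 1) :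
    0.037 + Real.log (1 / δ) ≤ Real.log (M * Real.log T / δ) := by
  have h1 : 1.039 ≤ Real.log T := log_three_ge.trans (Real.log_le_log (by norm_num) hT)
  have h2 : (0.037 : ℝ) ≤ Real.log 1.039 := by
    have := Real.one_sub_inv_le_log_of_pos (show (0 : ℝ) < 1.039 by norm_num)
    norm_num at this ⊢
    linarith
  have h3 : 1.039 * (1 / δ) ≤ M * Real.log T / δ := by
    rw [mul_one_div]
    gcongr
    nlinarith
  have h4 := Real.log_le_log (by positivity) h3
  rw [Real.log_mul (by norm_num) (by positivity)] at h4
  linarith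

theorem log_one_div_nonneg (hδ0 : 0 < δ) (hδ1 : δ < 1) : 0 ≤ Real.log (1 / δ) :=
  Real.log_nonneg (by rw [le_div_iff₀ hδ0]; linarith)

theorem log_level_le (hT : 3 ≤ T) (hM : 1 ≤ M) (hδ0 : 0 < δ) (hδ1 : δ < 1) {k : ℕ}
    (hk0 : 1 ≤ k) (hk : (2 : ℝ) ^ k ≤ T) :
    Real.log (4 * M * (k : ℝ) ^ 2 / δ) ≤ 80 * Real.log (M * Real.log T / δ) := by
  have h1 : 1.039 ≤ Real.log T := log_three_ge.trans (Real.log_le_log (by norm_num) hT)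
  have hY := log_log_ge hT hM hδ0 hδ1
  have hδ := log_one_div_nonneg hδ0 hδ1
  have h2 : k * Real.log 2 ≤ Real.log T := by
    rw [← Real.log_pow]
    exact Real.log_le_log (by positivity) hk
  have h3 : (k : ℝ) ≤ 2 * Real.log T := by
    nlinarith [Real.log_two_gt_d9, Nat.cast_nonneg (α := ℝ) k]
  have hk' : (0 : ℝ) < k := by exact_mod_cast hk0
  -- As `M/δ ≥ 1`, the argument is at most a constant times the square of the target argument. The
  -- logarithm turns the square into a factor 2, and the remaining factor 78 absorbs `ln 16`.
  have h4 : 4 * M * (k : ℝ) ^ 2 / δ ≤ 16 * (M * Real.log T / δ) ^ 2 := by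
    have hMd : M / δ ≤ (M / δ) ^ 2 := by
      have : 1 ≤ M / δ := by rw [le_div_iff₀ hδ0]; linarith
      nlinarith
    calc 4 * M * (k : ℝ) ^ 2 / δ ≤ 4 * M * (2 * Real.log T) ^ 2 / δ := by gcongr
      _ = 16 * (M / δ) * Real.log T ^ 2 := by ring
      _ ≤ 16 * (M / δ) ^ 2 * Real.log T ^ 2 := by gcongr
      _ = _ := by ring
  have h5 := Real.log_le_log (by positivity) h4
  rw [Real.log_mul (by norm_num) (by positivity), Real.log_pow] at h5
  push_cast at h5
  linarith [log_sixteen_le]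

theorem log_noise_le (hT : 3 ≤ T) (hM : 1 ≤ M) (hδ0 : 0 < δ) (hδ1 : δ < 1) :
    Real.log (12 * T ^ 2 / δ) ≤ 128 * (Real.log T * Real.log (M * Real.log T / δ)) := by
  have h1 : 1.039 ≤ Real.log T := log_three_ge.trans (Real.log_le_log (by norm_num) hT)
  have hY := log_log_ge hT hM hδ0 hδ1
  have hδ := log_one_div_nonneg hδ0 hδ1
  have h2 : Real.log (12 * T ^ 2 / δ) = Real.log 12 + 2 * Real.log T + Real.log (1 / δ) := by
    rw [div_eq_mul_one_div, Real.log_mul (by positivity) (by positivity),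
      Real.log_mul (by norm_num) (by positivity), Real.log_pow]
    norm_num
  have h3 : Real.log 12 ≤ 2.773 :=
    (Real.log_le_log (by norm_num) (by norm_num)).trans log_sixteen_le
  rw [h2]
  have h4 : Real.log T * (0.037 + Real.log (1 / δ)) ≤
      Real.log T * Real.log (M * Real.log T / δ) :=
    mul_le_mul_of_nonneg_left hY (by linarith)
  nlinarith

end Logarithms

/-! ### Summing per-round bounds over doubling epochs. -/

section EpochSums

variable {τ₁ : ℕ}

theorem epochEnd_add (τ₁ : ℕ) {l : ℕ} (hl : 1 ≤ l) (k : ℕ) :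
    epochEnd τ₁ (l + k) = 2 ^ k * epochEnd τ₁ l := by
  obtain ⟨l, rfl⟩ : ∃ j, l = j + 1 := ⟨l - 1, by omega⟩
  rw [show l + 1 + k = l + k + 1 by ring]
  simp only [epochEnd, pow_add]
  ring

theorem sqrt_half_le : √(1 / 2 : ℝ) ≤ 0.7072 := by
  rw [Real.sqrt_le_left (by norm_num)]; norm_num

theorem le_sqrt_half : 0.7 ≤ √(1 / 2 : ℝ) := by
  apply Real.le_sqrt_of_sq_le; norm_num

/-- If the per-round losses decay like `4⁻ᵏ + W/√τ` over the epochs, their sum is `O(W√τ)`. -/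
theorem sum_epochs_le {ρ : ℕ → ℝ} (hρ1 : ∀ s, ρ s ≤ 1) {l₀ : ℕ}
    (hl₀ : 1 ≤ l₀) {W : ℝ} (hW : 0 ≤ W) {k : ℕ}
    (hρ : ∀ j, 1 ≤ j → j ≤ k → ∀ s, epochEnd τ₁ (l₀ + j - 1) < s → s ≤ epochEnd τ₁ (l₀ + j) →
      ρ s ≤ (1 / 4) ^ j + 402 * (W / √(epochEnd τ₁ (l₀ + j)))) :
    ∑ s ∈ Finset.Icc 1 (epochEnd τ₁ (l₀ + k)), ρ s ≤
      epochEnd τ₁ l₀ * (2 - (1 / 2) ^ k) + 1000 * (W * √(epochEnd τ₁ (l₀ + k))) := by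
  induction k with
  | zero =>
    have h1 : ∑ s ∈ Finset.Icc 1 (epochEnd τ₁ l₀), ρ s ≤
        ∑ s ∈ Finset.Icc 1 (epochEnd τ₁ l₀), (1 : ℝ) := Finset.sum_le_sum fun s _ => hρ1 s
    rw [Finset.sum_const, Nat.card_Icc, Nat.add_sub_cancel, nsmul_eq_mul] at h1
    have h2 : 0 ≤ W * √(epochEnd τ₁ (l₀ + 0)) := by positivity
    norm_num at h1 h2 ⊢
    linarith
  | succ k ih =>
    have ih' := ih fun j hj hjk => hρ j hj (by omega)
    set T := epochEnd τ₁ (l₀ + k) with hT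
    have hT2 : epochEnd τ₁ (l₀ + (k + 1)) = 2 * T := by
      rw [hT, epochEnd_add τ₁ hl₀, epochEnd_add τ₁ hl₀, pow_succ]; ring
    have hTk : (T : ℝ) = 2 ^ k * epochEnd τ₁ l₀ := by
      rw [hT, epochEnd_add τ₁ hl₀]; push_cast; ring
    have hsplit : ∑ s ∈ Finset.Icc 1 (2 * T), ρ s =
        ∑ s ∈ Finset.Icc 1 T, ρ s + ∑ s ∈ Finset.Ioc T (2 * T), ρ s := by
      have h := Finset.sum_Ioc_consecutive ρ (Nat.zero_le T) (show T ≤ 2 * T by omega)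
      exact h.symm
    -- The new epoch has `T` rounds. Its transient part is at most `τ_{l₀} 2^{-(k+1)}`, the next
    -- decrement of `2 - 2^{-k}`. Its persistent part is `201 W √(2T)`, and `0.7072 · 1000 + 201 <
    -- 1000` closes the induction.
    have hnew : ∑ s ∈ Finset.Ioc T (2 * T), ρ s ≤
        T * ((1 / 4) ^ (k + 1) + 402 * (W / √((2 * T : ℕ) : ℝ))) := by
      have h := Finset.sum_le_card_nsmul (Finset.Ioc T (2 * T)) ρ
        ((1 / 4) ^ (k + 1) + 402 * (W / √((2 * T : ℕ) : ℝ))) (fun s hs => by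
          rw [Finset.mem_Ioc] at hs
          have := hρ (k + 1) (by omega) le_rfl s hs.1 (by rw [hT2]; exact hs.2)
          rwa [hT2] at this)
      rw [Nat.card_Ioc, nsmul_eq_mul, show 2 * T - T = T by omega] at h
      exact h
    rw [hT2, hsplit]
    have hsq : √((2 * T : ℕ) : ℝ) * √(1 / 2) = √(T : ℝ) := by
      rw [← Real.sqrt_mul (by positivity)]
      congr 1; push_cast; ring
    have hS0 : 0 ≤ √((2 * T : ℕ) : ℝ) := Real.sqrt_nonneg _
    have hTW : (T : ℝ) * (W / √((2 * T : ℕ) : ℝ)) = W * √((2 * T : ℕ) : ℝ) / 2 := by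
      rcases Nat.eq_zero_or_pos T with h0 | h0
      · simp [h0]
      · have h1 : 0 < √((2 * T : ℕ) : ℝ) := Real.sqrt_pos.2 (by positivity)
        have h2 : √((2 * T : ℕ) : ℝ) * √((2 * T : ℕ) : ℝ) = 2 * T := by
          rw [Real.mul_self_sqrt (by positivity)]; push_cast; ring
        field_simp
        nlinarith
    have hdec : (T : ℝ) * (1 / 4) ^ (k + 1) ≤ epochEnd τ₁ l₀ * (1 / 2) ^ (k + 1) := by
      have : (T : ℝ) * (1 / 4) ^ (k + 1) = epochEnd τ₁ l₀ * ((1 / 2) ^ k * (1 / 4)) := by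
        rw [hTk, pow_succ, show (1 / 4 : ℝ) = (1 / 2) * (1 / 2) by norm_num, mul_pow]
        have : (2 : ℝ) ^ k * (1 / 2) ^ k = 1 := by rw [← mul_pow]; norm_num
        linear_combination (epochEnd τ₁ l₀ : ℝ) * (1 / 2) ^ k * (1 / 4) * this
      rw [this, pow_succ]
      gcongr
      norm_num
    have hWsq : W * √(T : ℝ) ≤ 0.7072 * (W * √((2 * T : ℕ) : ℝ)) := by
      rw [← hsq]
      nlinarith [mul_nonneg hW hS0, sqrt_half_le]
    have hpow : ((1 : ℝ) / 2) ^ k = 2 * (1 / 2) ^ (k + 1) := by rw [pow_succ]; ring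
    rw [hpow] at ih'
    have h0 : 0 ≤ W * √((2 * T : ℕ) : ℝ) := mul_nonneg hW hS0
    have e : (T : ℝ) * ((1 / 4) ^ (k + 1) + 402 * (W / √((2 * T : ℕ) : ℝ))) =
      T * (1 / 4) ^ (k + 1) + 402 * (T * (W / √((2 * T : ℕ) : ℝ))) := by ring
    rw [e, hTW] at hnew
    nlinarith

end EpochSums

/-! ### Monotonicity of the index sets. -/

section Index

variable {X A : Type*} {alg : ModIGW X A} {h : ℕ → Obs X A}

theorem indexSet_succ (h : ℕ → Obs X A) {l : ℕ} (hl : 1 ≤ l) :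
    alg.indexSet h (l + 1) = (alg.indexSet h l).filter fun i =>
      alg.mt i _ (alg.data h l) (alg.level l) = false := by
  obtain ⟨l, rfl⟩ : ∃ j, l = j + 1 := ⟨l - 1, by omega⟩
  rfl

theorem indexSet_antitone (h : ℕ → Obs X A) {l m : ℕ} (hl : 1 ≤ l) (hlm : l ≤ m) :
    alg.indexSet h m ⊆ alg.indexSet h l := by
  induction m, hlm using Nat.le_induction with
  | base => exact subset_rfl
  | succ m hm ih =>
    rw [indexSet_succ h (hl.trans hm)]
    exact (Finset.filter_subset _ _).trans ih

theorem indexSet_subset (h : ℕ → Obs X A) {l : ℕ} (hl : 1 ≤ l) :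
    alg.indexSet h l ⊆ Finset.Icc 1 alg.M :=
  indexSet_antitone h le_rfl hl

theorem index_mem (h : ℕ → Obs X A) {l i : ℕ} (hi : i ∈ alg.indexSet h l) :
    alg.index h l ∈ alg.indexSet h l := by
  have hne : (alg.indexSet h l).Nonempty := ⟨i, hi⟩
  rw [ModIGW.index, dif_pos hne]
  exact Finset.min'_mem _ _

theorem index_le (h : ℕ → Obs X A) {l i : ℕ} (hi : i ∈ alg.indexSet h l) :
    alg.index h l ≤ i := by
  have hne : (alg.indexSet h l).Nonempty := ⟨i, hi⟩
  rw [ModIGW.index, dif_pos hne]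
  exact Finset.min'_le _ _ hi

end Index

/-! ### Deterministic regret analysis on the good event. -/

section Regret

variable {X A : Type*} [MeasurableSpace X] [MeasurableSpace A] [Fintype A]
  [MeasurableSingletonClass A]
  {D : Measure (X × (A → unitInterval))} {alg : ModIGW X A} {fstar : Model X A}
  {F : ℕ → Set (Model X A)} {C₀ : ℝ} {β' β : ℕ → ℝ≥0∞} {h : ℕ → Obs X A} {i : ℕ}

/-- The supremum defining the safe epoch is at least `l`, because `epochEnd` is strictly increasing;
so some admissible epoch is not before `l`, also when the supremum is infinite. -/
theorem exists_safe_epoch_ge (hτ : 1 ≤ alg.τ₁) {l : ℕ} (hl : 1 ≤ l)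
    (hsafe : (epochEnd alg.τ₁ l : ℝ≥0∞) ≤ safeRounds D fstar F alg C₀ i) :
    ∃ m, l ≤ m ∧ ∃ i' ∈ Finset.Icc 1 i, C₀ * maxMisspec D fstar (F i') ≤ alg.epochRate i m := by
  by_contra! hcon
  have h1 : safeEpoch D fstar F alg C₀ i ≤ ((l - 1 : ℕ) : ℕ∞) := by
    refine iSup₂_le fun m hm => ?_
    obtain ⟨-, i', hi', hle⟩ := hm
    have : m < l := by
      by_contra hlm
      exact absurd hle (not_le.2 (hcon m (not_lt.1 hlm) i' hi'))
    exact_mod_cast Nat.le_sub_one_of_lt this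
  have h2 : safeEpoch D fstar F alg C₀ i ≠ ⊤ := ne_top_of_le_ne_top (ENat.natCast_ne_top _) h1
  rw [safeRounds, if_neg h2] at hsafe
  have h3 : (safeEpoch D fstar F alg C₀ i).toNat ≤ l - 1 := by
    rw [← ENat.natCast_toNat h2] at h1
    exact_mod_cast h1
  have h4 : epochEnd alg.τ₁ l ≤ epochEnd alg.τ₁ (safeEpoch D fstar F alg C₀ i).toNat := by
    exact_mod_cast hsafe
  have h5 := epochEnd_mono (τ₁ := alg.τ₁) h3
  have h6 := epochEnd_strictMono hτ (show l - 1 < l by omega)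
  omega

/-- The horizon `t` is one up to which class `i` is guaranteed to pass its tests. -/
structure SafeHorizon (D : Measure (X × (A → unitInterval))) (fstar : Model X A)
    (F : ℕ → Set (Model X A)) (alg : ModIGW X A) (C₀ : ℝ) (β' : ℕ → ℝ≥0∞) (i t : ℕ) : Prop where
  mem : i ∈ Finset.Icc 1 alg.M
  three_le : 3 ≤ t
  le_one : β' i ≤ 1
  le_safe : (t : ℝ≥0∞) ≤ β' i * safeRounds D fstar F alg C₀ i

variable {t : ℕ}

theorem SafeHorizon.epochEnd_le (hs : SafeHorizon D fstar F alg C₀ β' i t) (hτ : 1 ≤ alg.τ₁)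
    {l : ℕ} (hl : l < epochOf alg.τ₁ t) :
    (epochEnd alg.τ₁ l : ℝ≥0∞) ≤ β' i * safeRounds D fstar F alg C₀ i := by
  refine le_trans ?_ hs.le_safe
  have h1 := epochEnd_mono (τ₁ := alg.τ₁) (show l ≤ epochOf alg.τ₁ t - 1 by omega)
  have h2 := epochEnd_epochOf_lt hτ (show 1 ≤ t by linarith [hs.three_le])
  exact_mod_cast (h1.trans h2.le)

theorem SafeHorizon.mem_indexSet (hs : SafeHorizon D fstar F alg C₀ β' i t) (hτ : 1 ≤ alg.τ₁)
    (hgood : GoodHistory D fstar F alg C₀ β' β h) {l : ℕ} (hl : 1 ≤ l)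
    (hlt : l ≤ epochOf alg.τ₁ t) : i ∈ alg.indexSet h l := by
  induction l, hl using Nat.le_induction with
  | base => exact hs.mem
  | succ l hl ih =>
    rw [indexSet_succ h hl, Finset.mem_filter]
    exact ⟨ih (by omega), ((hgood l hl).2.1 i hs.mem).1 (hs.epochEnd_le hτ (by omega))⟩

/-- As `β` is monotone, every class below `i` is past its threshold in epoch `k`. It is rejected
there at the latest, and rejected classes never return. -/
theorem GoodHistory.le_index (hgood : GoodHistory D fstar F alg C₀ β' β h)
    (hβ : ∀ i ∈ Finset.Icc 1 alg.M, ∀ j ∈ Finset.Icc 1 alg.M, i ≤ j → β i ≤ β j)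
    (hi : i ∈ Finset.Icc 1 alg.M) {k l : ℕ} (hk : 1 ≤ k)
    (hτk : β (i - 1) < epochEnd alg.τ₁ k) (hkl : k < l) (hil : i ∈ alg.indexSet h l) :
    i ≤ alg.index h l := by
  by_contra hcon
  have hmem := index_mem h hil
  have hM := indexSet_subset h (by omega) hmem
  have h1 := indexSet_antitone h (show 1 ≤ k + 1 by omega) hkl hmem
  rw [indexSet_succ h hk, Finset.mem_filter] at h1
  have hi' := Finset.mem_Icc.1 hi
  have hM' := Finset.mem_Icc.1 hM
  have h2 : β (alg.index h l) < epochEnd alg.τ₁ k :=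
    (hβ _ hM (i - 1) (Finset.mem_Icc.2 ⟨by omega, by omega⟩) (by omega)).trans_lt hτk
  have h3 := ((hgood k hk).2.1 _ hM).2 h2
  rw [h1.2] at h3
  exact absurd h3 (by simp)

/-- The oracle competes with a class `i' ≤ i` whose misspecification is dominated by the rate `ξ_i`
of some epoch `m ≥ l`. That rate is at most `6 ξ_i` in epoch `l`, and the estimation error adds at
most one more `ξ_i`. -/
theorem SafeHorizon.sq_error_le (hs : SafeHorizon D fstar F alg C₀ β' i t)
    (hv : alg.ValidParams) (hgood : GoodHistory D fstar F alg C₀ β' β h)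
    {l : ℕ} (hl : 1 ≤ l) (hlt : l < epochOf alg.τ₁ t) :
    ∫ x, ∑ b, alg.actionProb h l x b *
      ((alg.fhat h (l + 1) x b : ℝ) - fstar x b) ^ 2 ∂D.fst ≤ 7 * alg.epochRate i l := by
  have hτ : 1 ≤ alg.τ₁ := by linarith [hv.two_le_τ₁]
  have hsafe : (epochEnd alg.τ₁ l : ℝ≥0∞) ≤ safeRounds D fstar F alg C₀ i :=
    (hs.epochEnd_le hτ hlt).trans (mul_le_of_le_one_left' hs.le_one)
  obtain ⟨m, hlm, i', hi', hle⟩ := exists_safe_epoch_ge hτ hl hsafe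
  have hi := Finset.mem_Icc.1 hs.mem
  have hi'' := Finset.mem_Icc.1 hi'
  have hi'M : i' ∈ Finset.Icc 1 alg.M := Finset.mem_Icc.2 ⟨hi''.1, by omega⟩
  have h1 := (hgood l hl).1 i' hi'M
  have h2 : alg.epochRate i' l ≤ alg.epochRate i l := by
    rw [epochRate_eq, epochRate_eq]
    have hd : (alg.d i' : ℝ) ≤ alg.d i := by exact_mod_cast hv.d_mono _ hi'M _ hs.mem hi''.2
    have hpos := epochRate_pos hv hs.mem hl
    rw [epochRate_eq] at hpos
    exact mul_le_mul_of_nonneg_right hd (pos_of_mul_pos_right hpos (Nat.cast_nonneg _)).le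
  have h3 := epochRate_le hv (i := i) hl hlm
  obtain ⟨l, rfl⟩ : ∃ j, l = j + 1 := ⟨l - 1, by omega⟩
  refine le_trans h1 ?_
  change _ + alg.epochRate i' (l + 1) ≤ _
  linarith

/-- The regret bound `√(K d_i t ln(t) ln(M ln(t)/δ))`, up to constants. -/
def regretScale (alg : ModIGW X A) (i t : ℕ) : ℝ :=
  √(Fintype.card A * alg.d i * t * Real.log t * Real.log (alg.M * Real.log t / alg.δ))

/-- The bound on the per-round regret in an epoch that ends in round `τ` is this number, over `√τ`,
up to constants. -/
def widthScale (alg : ModIGW X A) (i t : ℕ) : ℝ :=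
  √(2560 * alg.C₁ * (Fintype.card A * alg.d i * Real.log t *
    Real.log (alg.M * Real.log t / alg.δ)))

/-- The constant of `widthScale` is `2560 = 8 · 80 · 4`: 8 from the statement, 80 from
`log_level_le`, and 4 because `τ_{l+1}` is at most four times the length of epoch `l`. -/
theorem sqrt_rate_le (hv : alg.ValidParams) (ht : 3 ≤ t)
    {l : ℕ} (hl : 1 ≤ l) (hlt : l < epochOf alg.τ₁ t) :
    √(8 * Fintype.card A * alg.epochRate i l) ≤
      widthScale alg i t / √(epochEnd alg.τ₁ (l + 1)) := by
  have hτ : 1 ≤ alg.τ₁ := by linarith [hv.two_le_τ₁]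
  have hC := hv.C₁_pos
  have hEnd : 0 < epochEnd alg.τ₁ (l + 1) := by have := le_epochEnd hτ (l + 1); omega
  rw [widthScale, ← Real.sqrt_div' _ (Nat.cast_nonneg _)]
  refine Real.sqrt_le_sqrt ?_
  rw [epochRate_eq]
  have hlen2 := two_le_epochLen hv.two_le_τ₁ hl
  have hlt' : epochEnd alg.τ₁ l < t :=
    (epochEnd_mono (show l ≤ epochOf alg.τ₁ t - 1 by omega)).trans_lt
      (epochEnd_epochOf_lt hτ (by omega))
  have hlenle : epochLen alg.τ₁ l ≤ t := by
    have := epochEnd_add_epochLen (τ₁ := alg.τ₁) l; omega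
  have hlen4 : epochEnd alg.τ₁ (l + 1) ≤ 4 * epochLen alg.τ₁ l := by
    rcases l with _ | _ | l
    · omega
    · rw [epochEnd_succ_succ, epochLen_one, epochEnd_one]; omega
    · rw [epochEnd_succ_succ, epochEnd_succ_succ, epochLen_add_two]; omega
  -- Here `τ₁ ≥ 2` is needed, to get `2ˡ ≤ τ_l`.
  have hpow : (2 : ℝ) ^ l ≤ t := by
    obtain ⟨j, rfl⟩ : ∃ j, l = j + 1 := ⟨l - 1, by omega⟩
    have h1 : 2 ^ j * 2 ≤ 2 ^ j * alg.τ₁ := Nat.mul_le_mul_left _ hv.two_le_τ₁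
    have h2 : 2 ^ (j + 1) ≤ t := by
      rw [pow_succ]
      exact h1.trans hlt'.le
    exact_mod_cast h2
  have hL := log_level_le (T := t) (M := alg.M) (by exact_mod_cast ht)
    (by exact_mod_cast hv.one_le_M) hv.δ_pos hv.δ_lt_one hl hpow
  have hL0 := zero_le_one.trans (one_le_log_level hv hl)
  have hlog : Real.log (epochLen alg.τ₁ l) ≤ Real.log t :=
    Real.log_le_log (by positivity) (by exact_mod_cast hlenle)
  have hlog0 : 0 ≤ Real.log (epochLen alg.τ₁ l) := Real.log_natCast_nonneg _
  have hEnd' : (0 : ℝ) < epochEnd alg.τ₁ (l + 1) := by exact_mod_cast hEnd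
  have hlen' : (0 : ℝ) < epochLen alg.τ₁ l := by
    have : 0 < epochLen alg.τ₁ l := by omega
    exact_mod_cast this
  have hinv : 1 / (epochLen alg.τ₁ l : ℝ) ≤ 4 / epochEnd alg.τ₁ (l + 1) := by
    rw [div_le_div_iff₀ hlen' hEnd', one_mul]
    exact_mod_cast hlen4
  have h5 : 8 * (Fintype.card A : ℝ) * (alg.d i * (alg.C₁ * Real.log (epochLen alg.τ₁ l) *
      Real.log (4 * alg.M * (l : ℝ) ^ 2 / alg.δ) / epochLen alg.τ₁ l)) =
      8 * Fintype.card A * alg.d i * alg.C₁ * (Real.log (epochLen alg.τ₁ l) *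
      (Real.log (4 * alg.M * (l : ℝ) ^ 2 / alg.δ) * (1 / epochLen alg.τ₁ l))) := by ring
  rw [h5]
  have hlogt : 0 ≤ Real.log t := hlog0.trans hlog
  calc _ ≤ 8 * Fintype.card A * alg.d i * alg.C₁ * (Real.log t *
      (80 * Real.log (alg.M * Real.log t / alg.δ) * (4 / epochEnd alg.τ₁ (l + 1)))) := by
        gcongr
        exact hL0.trans hL
    _ = _ := by ring

theorem SafeHorizon.regretsComparable [IsProbabilityMeasure D]
    (hs : SafeHorizon D fstar F alg C₀ β' i t)
    (hv : alg.ValidParams) (hreg : alg.Regular) (hf : Measurable fstar)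
    (hgood : GoodHistory D fstar F alg C₀ β' β h) {l₀ : ℕ} (hl₀ : 2 ≤ l₀)
    (hd : ∀ l, l₀ ≤ l → l ≤ epochOf alg.τ₁ t → alg.d i ≤ 2 * alg.d (alg.index h l)) (k : ℕ)
    (hk : l₀ + k ≤ epochOf alg.τ₁ t) :
    RegretsComparable alg.best D.fst (alg.fhat h (l₀ + k)) fstar
        ((1 / 4) ^ k + 400 * (widthScale alg i t / √(epochEnd alg.τ₁ (l₀ + k)))) ∧
      0 < alg.gamma h (l₀ + k) ∧
      Fintype.card A / alg.gamma h (l₀ + k) ≤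
        widthScale alg i t / √(epochEnd alg.τ₁ (l₀ + k)) := by
  have hτ : 1 ≤ alg.τ₁ := by linarith [hv.two_le_τ₁]
  have hA : 0 < (Fintype.card A : ℝ) := by
    exact_mod_cast Fintype.card_pos_iff.2 ⟨alg.best fun _ => 0⟩
  -- The parameter of epoch `l` is tuned to the rate `ξ` of the chosen class in epoch `l - 1`, and
  -- `ξ ≤ ξ_i ≤ 2ξ` there. The error in epoch `l` is then at most `7 · 6 · 2 ξ = 84 ξ`, and `84/8 =
  -- 10.5`.
  have hgamma : ∀ l, l₀ ≤ l → l ≤ epochOf alg.τ₁ t → 0 < alg.gamma h l ∧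
      Fintype.card A / alg.gamma h l ≤ widthScale alg i t / √(epochEnd alg.τ₁ l) ∧
      alg.gamma h l * (7 * alg.epochRate i l) ≤
        10.5 * (widthScale alg i t / √(epochEnd alg.τ₁ l)) := by
    intro l hl hlt
    obtain ⟨j, rfl⟩ : ∃ j, l = j + 2 := ⟨l - 2, by omega⟩
    have hmem := hs.mem_indexSet hτ hgood (show 1 ≤ j + 2 by omega) hlt
    have hidx := indexSet_subset h (by omega) (index_mem h hmem)
    have hξ := epochRate_pos hv hidx (show 1 ≤ j + 1 by omega)
    set ξ := alg.epochRate (alg.index h (j + 2)) (j + 1) with hξdef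
    have hg : alg.gamma h (j + 2) = √(Fintype.card A / (8 * ξ)) := rfl
    have hpos := epochRate_pos hv hs.mem (show 1 ≤ j + 1 by omega)
    have hcpos : 0 ≤ alg.C₁ * Real.log (epochLen alg.τ₁ (j + 1)) *
        Real.log (4 * alg.M * ((j + 1 : ℕ) : ℝ) ^ 2 / alg.δ) / epochLen alg.τ₁ (j + 1) := by
      rw [epochRate_eq] at hpos
      exact (pos_of_mul_pos_right hpos (Nat.cast_nonneg _)).le
    have hξle : ξ ≤ alg.epochRate i (j + 1) := by
      rw [hξdef, epochRate_eq, epochRate_eq]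
      refine mul_le_mul_of_nonneg_right ?_ hcpos
      exact_mod_cast hv.d_mono _ hidx _ hs.mem (index_le h hmem)
    have hleξ : alg.epochRate i (j + 1) ≤ 2 * ξ := by
      rw [hξdef, epochRate_eq, epochRate_eq, ← mul_assoc]
      refine mul_le_mul_of_nonneg_right ?_ hcpos
      exact_mod_cast hd _ hl hlt
    have hw := sqrt_rate_le (i := i) hv hs.three_le (show 1 ≤ j + 1 by omega)
      (show j + 1 < epochOf alg.τ₁ t by omega)
    have hw' : √(8 * Fintype.card A * ξ) ≤ widthScale alg i t / √(epochEnd alg.τ₁ (j + 2)) := by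
      refine le_trans (Real.sqrt_le_sqrt ?_) hw
      gcongr
    refine ⟨?_, ?_, ?_⟩
    · rw [hg]; positivity
    · rw [hg, div_sqrt_div_eight_mul hA hξ]
      exact hw'
    · have h6 := epochRate_le hv (i := i) (show 1 ≤ j + 1 by omega) (show j + 1 ≤ j + 2 by omega)
      have h7 := sqrt_div_eight_mul_mul (K := Fintype.card A) hξ
      have h8 : alg.gamma h (j + 2) * (7 * alg.epochRate i (j + 2)) ≤
          alg.gamma h (j + 2) * (84 * ξ) :=
        mul_le_mul_of_nonneg_left (by linarith) (gamma_nonneg alg h _)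
      rw [hg] at h8 ⊢
      linarith
  refine ⟨?_, (hgamma _ (by omega) hk).1, (hgamma _ (by omega) hk).2.1⟩
  induction k with
  | zero =>
    refine (regretsComparable_one hreg.best_meas hreg.best_max
      (measurable_fhat_model hreg h _) hf).mono ?_
    have : 0 ≤ widthScale alg i t / √(epochEnd alg.τ₁ (l₀ + 0)) :=
      div_nonneg (Real.sqrt_nonneg _) (Real.sqrt_nonneg _)
    rw [pow_zero]
    linarith
  | succ k ih =>
    have hg := hgamma (l₀ + k) (by omega) (by omega)
    have hη := hs.sq_error_le hv hgood (show 1 ≤ l₀ + k by omega) (by omega)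
    have hstep := (ih (by omega)).step hreg.best_meas hreg.best_max
      (measurable_fhat_model hreg h (l₀ + k + 1)) hf (measurable_fhat_model hreg h (l₀ + k))
      (isPolicy_actionProb hreg h (l₀ + k)) hg.1
      (fun x b => one_le_igw_mul (gamma_nonneg alg h _) (hreg.best_max (alg.fhat h (l₀ + k) x)) b)
      hη
    refine hstep.mono ?_
    have h2 : epochEnd alg.τ₁ (l₀ + (k + 1)) = 2 * epochEnd alg.τ₁ (l₀ + k) := by
      rw [epochEnd_add _ (by omega), epochEnd_add _ (by omega), pow_succ]; ring
    rw [h2]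
    set T := epochEnd alg.τ₁ (l₀ + k)
    have hW : 0 ≤ widthScale alg i t := Real.sqrt_nonneg _
    have hdiv : widthScale alg i t / √((2 * T : ℕ) : ℝ) =
        √(1 / 2) * (widthScale alg i t / √(T : ℝ)) := by
      have : √((2 * T : ℕ) : ℝ) = √2 * √(T : ℝ) := by
        rw [← Real.sqrt_mul (by norm_num)]; push_cast; rfl
      rw [this, Real.sqrt_div (by norm_num), Real.sqrt_one, div_mul_div_comm, one_mul]
    rw [hdiv]
    have hWT : 0 ≤ widthScale alg i t / √(T : ℝ) := div_nonneg hW (Real.sqrt_nonneg _)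
    have h4 : ((1 : ℝ) / 4) ^ (k + 1) = (1 / 4) ^ k / 4 := by rw [pow_succ]; ring
    rw [h4]
    -- The value 400 is self-consistent: `400/4 + 1/4 + 16 · 10.5 = 268.25`, below `0.7 · 400 =
    -- 280`, while the width shrinks by `√(1/2)`.
    nlinarith [mul_le_mul_of_nonneg_right le_sqrt_half hWT, hg.2.1, hg.2.2]

theorem SafeHorizon.sum_condRegret_le [IsProbabilityMeasure D]
    (hs : SafeHorizon D fstar F alg C₀ β' i t)
    (hv : alg.ValidParams) (hreg : alg.Regular) (hf : Measurable fstar)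
    (hgood : GoodHistory D fstar F alg C₀ β' β h) {l₀ : ℕ} (hl₀ : 2 ≤ l₀)
    (hd : ∀ l, l₀ ≤ l → l ≤ epochOf alg.τ₁ t → alg.d i ≤ 2 * alg.d (alg.index h l)) :
    ∑ s ∈ Finset.Icc 1 t, condRegret D alg fstar h s ≤
      2 * epochEnd alg.τ₁ l₀ + 72000 * (√alg.C₁ * regretScale alg i t) := by
  have hτ : 1 ≤ alg.τ₁ := by linarith [hv.two_le_τ₁]
  have ht := hs.three_le
  have hC := hv.C₁_pos
  have hS0 : 0 ≤ √alg.C₁ * regretScale alg i t :=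
    mul_nonneg (Real.sqrt_nonneg _) (Real.sqrt_nonneg _)
  have hρ := fun s => condRegret_mem (D := D) hreg hf h s
  set m := epochOf alg.τ₁ t with hm
  have htm : t ≤ epochEnd alg.τ₁ m := le_epochEnd_epochOf hτ t
  by_cases hml : m < l₀
  · have h1 : ∑ s ∈ Finset.Icc 1 t, condRegret D alg fstar h s ≤ ∑ s ∈ Finset.Icc 1 t, (1 : ℝ) :=
      Finset.sum_le_sum fun s _ => (hρ s).2
    rw [Finset.sum_const, Nat.card_Icc, Nat.add_sub_cancel, nsmul_eq_mul, mul_one] at h1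
    have h2 : (t : ℝ) ≤ epochEnd alg.τ₁ l₀ := by
      exact_mod_cast htm.trans (epochEnd_mono hml.le)
    have h3 : (0 : ℝ) ≤ epochEnd alg.τ₁ l₀ := Nat.cast_nonneg _
    linarith
  · obtain ⟨k, hk⟩ : ∃ k, m = l₀ + k := ⟨m - l₀, by omega⟩
    have hsum := sum_epochs_le (τ₁ := alg.τ₁) (ρ := fun s => condRegret D alg fstar h s)
      (fun s => (hρ s).2) (show 1 ≤ l₀ by omega) (W := widthScale alg i t) (Real.sqrt_nonneg _)
      -- The regret under `fstar` is at most twice the predicted regret `K/γ` plus the comparison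
      -- error; hence `402 = 400 + 2`.
      (k := k) (fun j hj hjk s hs1 hs2 => by
        have hep : epochOf alg.τ₁ s = l₀ + j := epochOf_eq hτ hs1 hs2
        obtain ⟨hcomp, hγ, hKγ⟩ := hs.regretsComparable hv hreg hf hgood hl₀ hd j (by omega)
        have hpol := isPolicy_actionProb hreg h (l₀ + j)
        have h1 := (hcomp _ hpol).1
        have h2 : gapRegret alg.best D.fst (alg.fhat h (l₀ + j)) (alg.actionProb h (l₀ + j)) ≤
            Fintype.card A / alg.gamma h (l₀ + j) := by
          have := integral_mono (integrable_gap_sum (ν := D.fst) hreg.best_meas hreg.best_max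
            (measurable_fhat_model hreg h (l₀ + j)) hpol)
            (integrable_const (Fintype.card A / alg.gamma h (l₀ + j)))
            fun x => sum_igw_mul_gap_le hγ (hreg.best_max (alg.fhat h (l₀ + j) x))
          simpa [gapRegret] using this
        simp only [condRegret, hep]
        linarith)
    rw [← hk] at hsum
    -- Expected regrets are nonnegative, so the sum may be completed to the end of the epoch of `t`,
    -- at most doubling the horizon.
    have hle : ∑ s ∈ Finset.Icc 1 t, condRegret D alg fstar h s ≤
        ∑ s ∈ Finset.Icc 1 (epochEnd alg.τ₁ m), condRegret D alg fstar h s :=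
      Finset.sum_le_sum_of_subset_of_nonneg (Finset.Icc_subset_Icc_right htm)
        fun s _ _ => (hρ s).1
    have hm2t : epochEnd alg.τ₁ m ≤ 2 * t := by
      have h1 := epochEnd_epochOf_lt hτ (show 1 ≤ t by omega)
      rw [← hm] at h1
      obtain ⟨j, hj⟩ : ∃ j, m = j + 2 := ⟨m - 2, by omega⟩
      rw [hj] at h1 ⊢
      rw [epochEnd_succ_succ]
      simp only [Nat.add_succ_sub_one] at h1
      omega
    have hprod : widthScale alg i t * √(epochEnd alg.τ₁ m) ≤
        72 * (√alg.C₁ * regretScale alg i t) := by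
      have h1 : √(epochEnd alg.τ₁ m : ℝ) ≤ √(2 * t) :=
        Real.sqrt_le_sqrt (by exact_mod_cast hm2t)
      refine (mul_le_mul_of_nonneg_left h1 (Real.sqrt_nonneg _)).trans ?_
      unfold regretScale
      rw [← Real.sqrt_mul' _ (by positivity), ← Real.sqrt_mul hC.le]
      have h72 : (72 : ℝ) = √(72 ^ 2) := (Real.sqrt_sq (by norm_num)).symm
      rw [h72, ← Real.sqrt_mul (by positivity)]
      refine Real.sqrt_le_sqrt ?_
      have hY : 0 ≤ Real.log (alg.M * Real.log t / alg.δ) := by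
        have h1 := log_log_ge (T := t) (M := alg.M) (by exact_mod_cast ht)
          (by exact_mod_cast hv.one_le_M) hv.δ_pos hv.δ_lt_one
        linarith [log_one_div_nonneg hv.δ_pos hv.δ_lt_one]
      have hX : 0 ≤ Real.log t := Real.log_natCast_nonneg _
      have h0 : 0 ≤ alg.C₁ * (Fintype.card A * alg.d i * t * Real.log t *
        Real.log (alg.M * Real.log t / alg.δ)) := by positivity
      nlinarith
    have hpow : (0 : ℝ) ≤ epochEnd alg.τ₁ l₀ * (1 / 2) ^ k := by positivity
    nlinarith

theorem regretNoise_le_scale (hv : alg.ValidParams) (hi : i ∈ Finset.Icc 1 alg.M) (ht : 3 ≤ t) :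
    √(2 * t * Real.log (12 * (t : ℝ) ^ 2 / alg.δ)) ≤ 16 * regretScale alg i t := by
  have hA : 1 ≤ (Fintype.card A : ℝ) := by
    exact_mod_cast Fintype.card_pos_iff.2 ⟨alg.best fun _ => 0⟩
  have hd : (1 : ℝ) ≤ alg.d i := by exact_mod_cast hv.one_le_d_of_mem hi
  have ht' : (3 : ℝ) ≤ t := by exact_mod_cast ht
  have hM : (1 : ℝ) ≤ alg.M := by exact_mod_cast hv.one_le_M
  have h1 := log_noise_le ht' hM hv.δ_pos hv.δ_lt_one
  have hY : 0 ≤ Real.log (alg.M * Real.log t / alg.δ) := by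
    linarith [log_log_ge ht' hM hv.δ_pos hv.δ_lt_one, log_one_div_nonneg hv.δ_pos hv.δ_lt_one]
  have hX : 0 ≤ Real.log t := Real.log_natCast_nonneg _
  rw [regretScale, show (16 : ℝ) = √(16 ^ 2) from (Real.sqrt_sq (by norm_num)).symm,
    ← Real.sqrt_mul (by positivity)]
  refine Real.sqrt_le_sqrt ?_
  have h2 : 1 ≤ (Fintype.card A : ℝ) * alg.d i := by nlinarith
  calc 2 * t * Real.log (12 * (t : ℝ) ^ 2 / alg.δ) ≤
      2 * t * (128 * (Real.log t * Real.log (alg.M * Real.log t / alg.δ))) := by gcongr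
    _ = 16 ^ 2 * (1 * (t * Real.log t * Real.log (alg.M * Real.log t / alg.δ))) := by ring
    _ ≤ 16 ^ 2 * ((Fintype.card A * alg.d i) *
        (t * Real.log t * Real.log (alg.M * Real.log t / alg.δ))) := by gcongr
    _ = _ := by ring

theorem one_le_three_mul_regretScale (hv : alg.ValidParams) (hi : i ∈ Finset.Icc 1 alg.M)
    (ht : 3 ≤ t) : 1 ≤ 3 * regretScale alg i t := by
  have hA : 1 ≤ (Fintype.card A : ℝ) := by
    exact_mod_cast Fintype.card_pos_iff.2 ⟨alg.best fun _ => 0⟩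
  have hd : (1 : ℝ) ≤ alg.d i := by exact_mod_cast hv.one_le_d_of_mem hi
  have ht' : (3 : ℝ) ≤ t := by exact_mod_cast ht
  have hM : (1 : ℝ) ≤ alg.M := by exact_mod_cast hv.one_le_M
  have hY : 0.037 ≤ Real.log (alg.M * Real.log t / alg.δ) := by
    linarith [log_log_ge ht' hM hv.δ_pos hv.δ_lt_one, log_one_div_nonneg hv.δ_pos hv.δ_lt_one]
  have hX : 1.039 ≤ Real.log t := log_three_ge.trans (Real.log_le_log (by norm_num) ht')
  rw [regretScale, show (3 : ℝ) = √(3 ^ 2) from (Real.sqrt_sq (by norm_num)).symm,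
    ← Real.sqrt_mul (by positivity)]
  apply Real.le_sqrt_of_sq_le
  have h2 : (1 : ℝ) * 1 * 3 * 1.039 * 0.037 ≤ Fintype.card A * alg.d i * t * Real.log t *
      Real.log (alg.M * Real.log t / alg.δ) := by gcongr
  linarith

end Regret

/-! ### Choice of the starting epoch and assembly of the bound. -/

section Final

variable {X A : Type*} [MeasurableSpace X] [MeasurableSpace A] [Fintype A]
  [MeasurableSingletonClass A]
  {D : Measure (X × (A → unitInterval))} {alg : ModIGW X A} {fstar : Model X A}
  {F : ℕ → Set (Model X A)} {C₀ : ℝ} {β' β : ℕ → ℝ≥0∞} {h : ℕ → Obs X A} {i t : ℕ}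

/-- The constant of the regret bound. -/
def regretConst (C₁ : ℝ) (τ₁ : ℕ) : ℝ := 72000 * √C₁ + 12 * τ₁ + 28

theorem sum_instRegret_le_sum_condRegret_add (hv : alg.ValidParams)
    (hgood : GoodHistory D fstar F alg C₀ β' β h) (hi : i ∈ Finset.Icc 1 alg.M) (ht : 3 ≤ t) :
    ∑ s ∈ Finset.Icc 1 t, instRegret alg.best fstar (h s) ≤
      ∑ s ∈ Finset.Icc 1 t, condRegret D alg fstar h s + 16 * regretScale alg i t := by
  have h1 := (hgood t (by omega)).2.2.le.trans (regretNoise_le_scale hv hi ht)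
  rw [regretNoise, Finset.sum_sub_distrib] at h1
  linarith

theorem log_div_ge_of_two_mul_lt {a b : ℕ} (ha : 1 ≤ a) (hab : 2 * a < b) :
    0.69 ≤ Real.log ((b : ℝ) / a) := by
  have ha' : (0 : ℝ) < a := by exact_mod_cast ha
  have h1 : (2 : ℝ) ≤ (b : ℝ) / a := by
    rw [le_div_iff₀ ha']
    exact_mod_cast hab.le
  linarith [Real.log_two_gt_d9, Real.log_le_log (by norm_num) h1]

theorem SafeHorizon.sum_instRegret_le [IsProbabilityMeasure D]
    (hs : SafeHorizon D fstar F alg C₀ β' i t)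
    (hv : alg.ValidParams) (hreg : alg.Regular) (hf : Measurable fstar)
    (hgood : GoodHistory D fstar F alg C₀ β' β h)
    (hβ : ∀ i ∈ Finset.Icc 1 alg.M, ∀ j ∈ Finset.Icc 1 alg.M, i ≤ j → β i ≤ β j)
    (hβt : 2 * alg.d 1 < alg.d i → β (i - 1) ≠ ⊤) :
    ∑ s ∈ Finset.Icc 1 t, instRegret alg.best fstar (h s) ≤
      regretConst alg.C₁ alg.τ₁ * ((β (i - 1)).toReal * Real.log ((alg.d i : ℝ) / alg.d 1) +
        regretScale alg i t) := by
  have hτ : 1 ≤ alg.τ₁ := by linarith [hv.two_le_τ₁]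
  have hτ0 : (0 : ℝ) < alg.τ₁ := by exact_mod_cast hτ
  have hd1 : (0 : ℝ) < alg.d 1 := by exact_mod_cast hv.one_le_d
  have h1 := sum_instRegret_le_sum_condRegret_add hv hgood hs.mem hs.three_le
  have h3 := one_le_three_mul_regretScale hv hs.mem hs.three_le
  have hlog : 0 ≤ Real.log ((alg.d i : ℝ) / alg.d 1) := by
    refine Real.log_nonneg ?_
    rw [le_div_iff₀ hd1, one_mul]
    exact_mod_cast hv.d_one_le hs.mem
  set b := (β (i - 1)).toReal with hb
  have hb0 : 0 ≤ b := ENNReal.toReal_nonneg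
  have hblog : 0 ≤ b * Real.log ((alg.d i : ℝ) / alg.d 1) := mul_nonneg hb0 hlog
  have hC0 : 0 ≤ √alg.C₁ := Real.sqrt_nonneg _
  have hS : 0 ≤ regretScale alg i t := by linarith
  have hCb : 0 ≤ √alg.C₁ * (b * Real.log ((alg.d i : ℝ) / alg.d 1)) := mul_nonneg hC0 hblog
  have hτb : 0 ≤ alg.τ₁ * (b * Real.log ((alg.d i : ℝ) / alg.d 1)) := mul_nonneg hτ0.le hblog
  have hτS : (alg.τ₁ : ℝ) ≤ alg.τ₁ * (3 * regretScale alg i t) :=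
    le_mul_of_one_le_right hτ0.le h3
  -- The term `4 τ₁` is absorbed into the square root, since `regretScale` is at least `1/3`; this
  -- explains `12 τ₁` in the constant.
  suffices hkey : ∃ l₀, 2 ≤ l₀ ∧ (∀ l, l₀ ≤ l → l ≤ epochOf alg.τ₁ t →
      alg.d i ≤ 2 * alg.d (alg.index h l)) ∧
      2 * (epochEnd alg.τ₁ l₀ : ℝ) ≤ 4 * alg.τ₁ + 12 * (b * Real.log ((alg.d i : ℝ) / alg.d 1)) by
    obtain ⟨l₀, hl₀, hd, hle⟩ := hkey
    have h2 := hs.sum_condRegret_le hv hreg hf hgood hl₀ hd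
    unfold regretConst
    nlinarith
  have hend2 : (epochEnd alg.τ₁ 2 : ℝ) = 2 * alg.τ₁ := by
    rw [epochEnd_succ_succ 0, epochEnd_one]; push_cast; ring
  have hmem : ∀ l, 2 ≤ l → l ≤ epochOf alg.τ₁ t → i ∈ alg.indexSet h l := fun l hl hlt =>
    hs.mem_indexSet hτ hgood (by omega) hlt
  -- If the smallest dimension is within a factor 2, any chosen class is good enough and no waiting
  -- is needed.
  by_cases hd : alg.d i ≤ 2 * alg.d 1
  · refine ⟨2, le_rfl, fun l hl hlt => hd.trans ?_, by rw [hend2]; linarith⟩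
    have := hv.d_one_le (indexSet_subset h (by omega) (index_mem h (hmem l hl hlt)))
    omega
  · push Not at hd
    have hβ' := hβt hd
    have hex : ∃ l, β (i - 1) < epochEnd alg.τ₁ (l + 1) := by
      obtain ⟨n, hn⟩ := ENNReal.exists_nat_gt hβ'
      refine ⟨n, hn.trans_le ?_⟩
      exact_mod_cast (Nat.le_succ n).trans (le_epochEnd hτ (n + 1))
    classical
    set k := Nat.find hex with hk
    have hkspec : β (i - 1) < epochEnd alg.τ₁ (k + 1) := Nat.find_spec hex
    -- Epoch `k + 1` is the first to end after `β_{i-1}`, and its tests take effect from epoch `k +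
    -- 2` on. For `k ≥ 1`, `τ_{k+2} = 4 τ_k ≤ 4 β_{i-1}`, and `8 ≤ 12 · 0.69` charges the waiting
    -- time to the logarithm.
    refine ⟨k + 2, by omega, fun l hl hlt => ?_, ?_⟩
    · have h4 := hgood.le_index hβ hs.mem (k := k + 1) (by omega) hkspec (by omega)
        (hmem l (by omega) hlt)
      have h5 := index_le h (hmem l (by omega) hlt)
      rw [le_antisymm h5 h4]
      omega
    · rcases Nat.eq_zero_or_pos k with h0 | h0
      · rw [h0, zero_add, hend2]; linarith
      · obtain ⟨j, hj⟩ : ∃ j, k = j + 1 := ⟨k - 1, by omega⟩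
        have h6 : ¬ β (i - 1) < epochEnd alg.τ₁ (j + 1) :=
          Nat.find_min hex (by omega)
        have h7 : (epochEnd alg.τ₁ (j + 1) : ℝ) ≤ b := by
          have := ENNReal.toReal_mono hβ' (not_lt.1 h6)
          simpa using this
        have h8 : (epochEnd alg.τ₁ (k + 2) : ℝ) = 4 * epochEnd alg.τ₁ (j + 1) := by
          rw [hj, epochEnd_succ_succ, epochEnd_succ_succ]; push_cast; ring
        have h9 := log_div_ge_of_two_mul_lt hv.one_le_d hd
        have h10 : b * 0.69 ≤ b * Real.log ((alg.d i : ℝ) / alg.d 1) :=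
          mul_le_mul_of_nonneg_left h9 hb0
        rw [h8]
        linarith

theorem SafeHorizon.ofReal_sum_instRegret_le [IsProbabilityMeasure D]
    (hs : SafeHorizon D fstar F alg C₀ β' i t)
    (hv : alg.ValidParams) (hreg : alg.Regular) (hf : Measurable fstar)
    (hgood : GoodHistory D fstar F alg C₀ β' β h)
    (hβ : ∀ i ∈ Finset.Icc 1 alg.M, ∀ j ∈ Finset.Icc 1 alg.M, i ≤ j → β i ≤ β j) :
    ENNReal.ofReal (∑ s ∈ Finset.Icc 1 t, instRegret alg.best fstar (h s)) ≤
      ENNReal.ofReal (regretConst alg.C₁ alg.τ₁) *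
        (β (i - 1) * ENNReal.ofReal (Real.log ((alg.d i : ℝ) / alg.d 1)) +
          ENNReal.ofReal (regretScale alg i t)) := by
  have hc : 0 < regretConst alg.C₁ alg.τ₁ := by unfold regretConst; positivity
  have hS : 0 ≤ regretScale alg i t := Real.sqrt_nonneg _
  have hd1 : (0 : ℝ) < alg.d 1 := by exact_mod_cast hv.one_le_d
  have hlog : 0 ≤ Real.log ((alg.d i : ℝ) / alg.d 1) := by
    refine Real.log_nonneg ?_
    rw [le_div_iff₀ hd1, one_mul]
    exact_mod_cast hv.d_one_le hs.mem
  by_cases htop : 2 * alg.d 1 < alg.d i ∧ β (i - 1) = ⊤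
  -- With an infinite threshold and a positive logarithm the right side is infinite. If `β_{i-1}` is
  -- infinite but `d_i ≤ 2 d_1`, the real bound with `(⊤).toReal = 0` still holds and is the
  -- stronger one.
  · have h1 := log_div_ge_of_two_mul_lt hv.one_le_d htop.1
    have h2 : β (i - 1) * ENNReal.ofReal (Real.log ((alg.d i : ℝ) / alg.d 1)) = ⊤ := by
      rw [htop.2]
      exact ENNReal.top_mul (by simpa using by linarith)
    rw [h2, top_add, ENNReal.mul_top (by simpa using hc)]
    exact le_top
  · have hβt : 2 * alg.d 1 < alg.d i → β (i - 1) ≠ ⊤ := fun h1 h2 => htop ⟨h1, h2⟩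
    refine (ENNReal.ofReal_le_ofReal
      (hs.sum_instRegret_le hv hreg hf hgood hβ hβt)).trans ?_
    rw [ENNReal.ofReal_mul hc.le,
      ENNReal.ofReal_add (mul_nonneg ENNReal.toReal_nonneg hlog) hS,
      ENNReal.ofReal_mul ENNReal.toReal_nonneg]
    gcongr
    exact ENNReal.ofReal_toReal_le

end Final

end ModelSelection

end

/-! ### The regret bound. -/

theorem corollary2 :
    -- the constant depends on `C₁` and the initial epoch length `τ₁` only
    ∃ c : ℝ → ℕ → ℝ,
      ∀ (X A Ω : Type*) [MeasurableSpace X] [Fintype A] [MeasurableSpace A]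
        [MeasurableSingletonClass A] [MeasurableSpace Ω]
        (D : Measure (X × (A → unitInterval))) [IsProbabilityMeasure D]
        (fstar : ModelSelection.Model X A) (πstar : X → A)
        (F : ℕ → Set (ModelSelection.Model X A)) (alg : ModelSelection.ModIGW X A)
        (C₀ : ℝ) (β' β : ℕ → ℝ≥0∞)
        (μ : Measure Ω) [IsProbabilityMeasure μ]
        (x : ℕ → Ω → X) (r : ℕ → Ω → A → unitInterval) (a : ℕ → Ω → A),
        ModelSelection.IsMeanReward D fstar →
        ModelSelection.IsOptimalPolicy fstar πstar →
        -- the classes and their VC subgraph dimensions `1 ≤ d_1 ≤ ⋯ ≤ d_M < ∞`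
        (∀ i ∈ Finset.Icc 1 alg.M, ∀ f ∈ F i, ∀ b, Measurable fun y => f y b) →
        (∀ i ∈ Finset.Icc 1 alg.M, ModelSelection.vcSubgraphDim (F i) = alg.d i) →
        (∀ i ∈ Finset.Icc 1 alg.M, ∀ j ∈ Finset.Icc 1 alg.M, i ≤ j → alg.d i ≤ alg.d j) →
        1 ≤ alg.d 1 →
        -- the parameters and the oracles
        2 ≤ alg.τ₁ → 0 < alg.C₁ → 1 ≤ C₀ → 0 < alg.δ → alg.δ < 1 →
        alg.Regular →
        ModelSelection.EstimationOracle D fstar F alg C₀ →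
        ModelSelection.IsRun D alg μ x r a →
        ModelSelection.MisspecificationTest D fstar F alg C₀ β' β μ x r a →
        ENNReal.ofReal (1 - alg.δ) ≤
          μ {ω | ∀ i ∈ Finset.Icc 1 alg.M, ∀ t : ℕ, 3 ≤ t →
            (t : ℝ≥0∞) ≤ β' i * ModelSelection.safeRounds D fstar F alg C₀ i →
            ENNReal.ofReal (ModelSelection.regret fstar πstar x a t ω) ≤
              ENNReal.ofReal (c alg.C₁ alg.τ₁) *
                (β (i - 1) * ENNReal.ofReal (Real.log ((alg.d i : ℝ) / alg.d 1)) +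
                  ENNReal.ofReal √(Fintype.card A * alg.d i * t * Real.log t *
                    Real.log (alg.M * Real.log t / alg.δ)))} := by
  refine ⟨ModelSelection.regretConst, ?_⟩
  intro X A Ω _ _ _ _ _ D _ fstar πstar F alg C₀ β' β μ _ x r a hmean hopt _ _ hdmono hd1 hτ hC₁
    hC₀ hδ0 hδ1 hreg horacle hrun htest
  rcases Nat.eq_zero_or_pos alg.M with hM | hM
  · have huniv : {ω | ∀ i ∈ Finset.Icc 1 alg.M, ∀ t : ℕ, 3 ≤ t →
        (t : ℝ≥0∞) ≤ β' i * ModelSelection.safeRounds D fstar F alg C₀ i →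
        ENNReal.ofReal (ModelSelection.regret fstar πstar x a t ω) ≤
          ENNReal.ofReal (ModelSelection.regretConst alg.C₁ alg.τ₁) *
            (β (i - 1) * ENNReal.ofReal (Real.log ((alg.d i : ℝ) / alg.d 1)) +
              ENNReal.ofReal √(Fintype.card A * alg.d i * t * Real.log t *
                Real.log (alg.M * Real.log t / alg.δ)))} = Set.univ := by
      refine Set.eq_univ_of_forall fun ω i hi => ?_
      have := Finset.mem_Icc.1 hi
      omega
    rw [huniv, measure_univ]
    exact ENNReal.ofReal_le_one.2 (by linarith)
  have hv : alg.ValidParams := ⟨hM, hτ, hC₁, hδ0, hδ1, hd1, hdmono⟩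
  have hf : Measurable fstar := measurable_pi_iff.2 fun b => (hmean b).1
  refine (hrun.measure_goodHistory_ge hreg hτ hf hM hδ0 hδ1 (zero_le_one.trans hC₀) horacle
    htest).trans (measure_mono fun ω hω i hi t ht hsafe => ?_)
  have hregret : ModelSelection.regret fstar πstar x a t ω = ∑ s ∈ Finset.Icc 1 t,
      ModelSelection.instRegret alg.best fstar (ModelSelection.obs x r a ω s) := by
    refine Finset.sum_congr rfl fun s _ => ?_
    -- Both arms maximize `fstar`, so the measurable selection `alg.best` can replace `πstar`, whose
    -- measurability is not given.
    have : fstar (x s ω) (πstar (x s ω)) = fstar (x s ω) (alg.best (fstar (x s ω))) :=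
      le_antisymm (hreg.best_max _ _) (hopt _ _)
    rw [this]
    rfl
  rw [hregret]
  have hs : ModelSelection.SafeHorizon D fstar F alg C₀ β' i t :=
    ⟨hi, ht, (htest.beta'_mem i hi).2, hsafe⟩
  exact hs.ofReal_sum_instRegret_le hv hreg hf hω htest.beta_mono
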